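/- **Channel.** Let $\beta>0$ and $\sigma_N^2>0$. For an integer $L\ge 1$ (samples per symbol) put $\Delta=1/L$. For complex input symbols $X_1,\dots,X_n$ the simplified oversampled Wiener phase noise channel has the $nL$ outputs $$Y_k = X_{\lceil k/L\rceil}\,\Delta\, e^{j\Theta_k}+N_k,\qquad k=1,\dots,nL,$$ where $j=\sqrt{-1}$, $\Theta_{k+1}=\Theta_k+W_k$, $\Theta_1$ is uniform on $[-\pi,\pi)$, the $W_k$ are i.i.d. real Gaussian with mean $0$ and variance $2\pi\beta\Delta$, the $N_k$ are i.i.d. circularly-symmetric complex Gaussian with mean $0$ and $\mathbb E|N_k|^2=\sigma_N^2\Delta$, and $\Theta_1$, $\{W_k\}$, $\{N_k\}$ and the input are independent. For $\mathsf{SNR}>0$ let $P=\mathsf{SNR}\cdot\sigma_N^2$ and let $$C_L(\mathsf{SNR})=\lim_{n\to\infty}\frac1n\,\sup I(X_1,\dots,X_n;\,Y_1,\dots,Y_{nL}),$$ where $I$ is the mutual information in nats and the supremum is over all joint distributions of $(X_1,\dots,X_n)$ with $\frac1n\sum_{m=1}^n\mathbb E|X_m|^2\le P$. **Corollary.** For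 all $L\ge1$ and $\mathsf{SNR}>0$ the limit defining $C_L(\mathsf{SNR})$ exists and is finite. If the number of samples per symbol grows as $L=\lceil\beta\sqrt{\mathsf{SNR}}\rceil$, then the capacity pre-log is at least $3/4$: $$\liminf_{\mathsf{SNR}\to\infty}\frac{C_{\lceil\beta\sqrt{\mathsf{SNR}}\rceil}(\mathsf{SNR})}{\log\mathsf{SNR}}\;\ge\;\frac34 .$$ This is strictly larger than the pre-log obtained with one sample per symbol, which is $1/2$: $$\lim_{\mathsf{SNR}\to\infty}\frac{C_1(\mathsf{SNR})}{\log\mathsf{SNR}}=\frac12 .$$ -/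

import Mathlib

open MeasureTheory ProbabilityTheory Filter Topology
open scoped ENNReal NNReal

namespace PhaseNoise

noncomputable section

/-- The circularly-symmetric complex Gaussian law with mean `0` and `E |N|² = s`:
the real and imaginary parts are independent `N(0, s/2)`. -/
def complexGaussian (s : ℝ≥0) : Measure ℂ :=
  ((gaussianReal 0 (s / 2)).prod (gaussianReal 0 (s / 2))).map
    Complex.measurableEquivRealProd.symm

instance (s : ℝ≥0) : IsProbabilityMeasure (complexGaussian s) :=
  Measure.isProbabilityMeasure_map (MeasurableEquiv.measurable _).aemeasurable

/-- The uniform law on `[-π, π)`. -/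
def uniformPhase : Measure ℝ := volume[|Set.Ico (-Real.pi) Real.pi]

instance : IsProbabilityMeasure uniformPhase := by
  refine cond_isProbabilityMeasure_of_finite ?_ ?_ <;>
    simp [Real.volume_Ico, Real.pi_pos]

/-- The noise of `n * L` consecutive output samples: the initial phase `Θ₁`, the phase increments
`W₁, W₂, …` and the additive noise samples `N₁, N₂, …`. -/
abbrev Noise (n L : ℕ) : Type := ℝ × (Fin (n * L) → ℝ) × (Fin (n * L) → ℂ)

/-- The law of the noise with `Δ = 1 / L`: `Θ₁` is uniform on `[-π, π)`, the `W_k` are i.i.d. real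
Gaussian with mean `0` and variance `2πβΔ`, the `N_k` are i.i.d. circularly-symmetric complex
Gaussian with mean `0` and `E |N_k|² = σ² Δ`, and all of these are independent.
The parameter `noiseVar` is `σ²`. -/
def noiseLaw (β noiseVar : ℝ) (n L : ℕ) : Measure (Noise n L) :=
  uniformPhase.prod
    ((Measure.pi fun _ : Fin (n * L) => gaussianReal 0 (2 * Real.pi * β / L).toNNReal).prod
      (Measure.pi fun _ : Fin (n * L) => complexGaussian (noiseVar / L).toNNReal))

instance (β noiseVar : ℝ) (n L : ℕ) : IsProbabilityMeasure (noiseLaw β noiseVar n L) := by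
  unfold noiseLaw; infer_instance

/-- The discrete-time Wiener phase process: `Θ_{k+1} = Θ_k + W_k`, that is
`Θ_k = Θ₁ + ∑_{i < k} W_i`. -/
def phase {n L : ℕ} (ω : Noise n L) (k : Fin (n * L)) : ℝ :=
  ω.1 + ∑ i ∈ Finset.Iio k, ω.2.1 i

/-- The output samples `Y_k = X_{⌈k/L⌉} Δ exp(j Θ_k) + N_k` with `Δ = 1 / L`. Samples and symbols
are counted from `0`, so that sample `k` belongs to symbol `⌊k / L⌋`, which is `k.divNat`. -/
def output {n L : ℕ} (x : Fin n → ℂ) (ω : Noise n L) (k : Fin (n * L)) : ℂ :=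
  x k.divNat * (1 / (L : ℂ)) * Complex.exp (Complex.I * (phase ω k : ℂ)) + ω.2.2 k

theorem measurable_output (n L : ℕ) :
    Measurable fun p : (Fin n → ℂ) × Noise n L => (p.1, output p.1 p.2) := by
  unfold output phase
  fun_prop

/-- The joint law of input `X^n` and output `Y^n` when `X^n` has law `μ` and is independent
of the noise. -/
def jointLaw (β noiseVar : ℝ) (n L : ℕ) (μ : Measure (Fin n → ℂ)) :
    Measure ((Fin n → ℂ) × (Fin (n * L) → ℂ)) :=
  (μ.prod (noiseLaw β noiseVar n L)).map fun p => (p.1, output p.1 p.2)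

/-- The mutual information (in nats) of a pair of random variables with joint law `ρ`. -/
def mutualInfo {A B : Type*} [MeasurableSpace A] [MeasurableSpace B] (ρ : Measure (A × B)) :
    ℝ≥0∞ :=
  InformationTheory.klDiv ρ (ρ.fst.prod ρ.snd)

/-- The admissible laws of the input `X^n`: the joint probability laws that satisfy the average
power constraint `(1/n) ∑ E |X_m|² ≤ P`. -/
def admissibleInputs (n : ℕ) (P : ℝ) : Set (Measure (Fin n → ℂ)) :=
  {μ | IsProbabilityMeasure μ ∧
    (n : ℝ≥0∞)⁻¹ * ∑ m : Fin n, ∫⁻ x, ‖x m‖ₑ ^ 2 ∂μ ≤ ENNReal.ofReal P}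

/-- `(1/n) sup I(X^n; Y^n)`, the supremum being over all admissible input laws. -/
def blockRate (β noiseVar : ℝ) (L : ℕ) (P : ℝ) (n : ℕ) : ℝ≥0∞ :=
  (n : ℝ≥0∞)⁻¹ * ⨆ μ ∈ admissibleInputs n P, mutualInfo (jointLaw β noiseVar n L μ)

/-- The capacity `C(SNR) = lim_{n → ∞} (1/n) sup I(X^n; Y^n)` of the channel with `L` samples per
symbol, noise variance `noiseVar = σ²` and power `P = SNR * σ²`. -/
def capacity (β noiseVar : ℝ) (L : ℕ) (snr : ℝ) : ℝ≥0∞ :=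
  limUnder atTop (blockRate β noiseVar L (snr * noiseVar))

end

end PhaseNoise

/-!
Everything rests on two comparisons of the divergence `I(X; Y) = D(P_{XY} ‖ P_X × P_Y)`: replacing
`P_Y` by another law bounds it from above, and Gibbs' inequality
`D(ρ ‖ ν) ≥ ∫ log q dρ` with `∫ q dν ≤ 1` bounds it from below.

*Existence of the limit.* If the inputs of two consecutive blocks are independent, then the two
block informations add up to at most the information of the joint block (`mutualInfo_add_le`). Each
block alone sees the channel law, because a uniform initial phase stays uniform modulo `2π` after a
rotation and the output is `2π`-periodic in it. Hence `n * blockRate n` is superadditive. It is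
bounded linearly in `n`, since the conditional output density is bounded and the output power is
controlled (`mutualInfo_jointLaw_le_linear`), so Fekete's lemma applies (`tendsto_blockRate`).

*One sample per symbol, upper bound.* Given the input, the output phases without the additive noise
form a random walk on the circle whose steps are smoothed by a Gaussian, so their joint density is at
most `Cⁿ` (`lintegral_phase_prod_le`). Averaging the additive noise over a circle of radius `|xₖ|`
then bounds the conditional output density by `∏ C' / (1 + |xₖ|)` (`lintegral_circle_density_le`).
The reference output law is a product of circularly symmetric laws with density of order
`exp (-|y|² / (2P)) / (√P (1 + |y|))` (`radialDensity`). Since `|yₖ| - |xₖ|` is of the order of the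
noise, the log-ratio of the two densities has mean at most `1/2 log P + O(1)` per symbol
(`exists_capacity_one_le`).

*Lower bound.* The inputs are i.i.d. with `|x|²` uniform on `[P/2, P]` and with uniform phase. Gibbs'
inequality is applied to an explicit decoding metric `q = exp (c - h)`, in which `h` is a sum of two
penalties per symbol. `powerPenalty` compares `|x|²` with the energy of the `L` samples of the
symbol, whose error has variance of order `P + L`. `phasePenalty` compares the direction of the
first sample of the symbol with the direction of the last sample of the preceding symbol, whose
difference has mean square of order `1 / L + L / SNR`. The penalty of a symbol depends on the inputs
through this symbol and its predecessor only, so the metric is normalized by a chain computation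
(`lintegral_chain_le_one`), with normalizing constant `c` equal to
`1/2 log P + 1/2 log κ + O(1)` per symbol for a phase precision `κ`. The resulting bound is
`le_capacity`. For `L = 1` and `κ = 1` it gives `1/2 log SNR + O(1)`; for `L = ⌈β √SNR⌉` both phase
errors are of order `SNR^(-1/2)`, and `κ = √SNR` gives `3/4 log SNR + O(1)`.
-/

namespace PhaseNoise

/-! ### Bounds on the Kullback-Leibler divergence -/

section Information

open InformationTheory

variable {α A B : Type*} {mα : MeasurableSpace α} [MeasurableSpace A] [MeasurableSpace B]

/-- A pointwise bound `exp f` on the density bounds the divergence by the mean of `f`. No integrability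
is needed, because the right-hand side may be infinite. -/
theorem klDiv_le_lintegral_of_le_withDensity {ρ ν : Measure α} [IsProbabilityMeasure ρ]
    [IsFiniteMeasure ν] (hν : ν Set.univ ≤ 1) {f : α → ℝ} (hf : Measurable f) (hf0 : ∀ x, 0 ≤ f x)
    (hle : ρ ≤ ν.withDensity fun x => ENNReal.ofReal (Real.exp (f x))) :
    klDiv ρ ν ≤ ∫⁻ x, ENNReal.ofReal (f x) ∂ρ := by
  by_cases htop : ∫⁻ x, ENNReal.ofReal (f x) ∂ρ = ∞
  · rw [htop]; exact le_top
  have hac : ρ ≪ ν :=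
    (Measure.absolutelyContinuous_of_le hle).trans (withDensity_absolutelyContinuous _ _)
  have hrn : ∀ᵐ x ∂ν, ρ.rnDeriv ν x ≤ ENNReal.ofReal (Real.exp (f x)) := by
    refine ae_le_of_forall_setLIntegral_le_of_sigmaFinite (Measure.measurable_rnDeriv ρ ν) ?_
    intro s hs _
    rw [← withDensity_apply _ hs, ← withDensity_apply _ hs]
    exact (Measure.withDensity_rnDeriv_le ρ ν s).trans (hle s)
  have hrn' : ∀ᵐ x ∂ν, (ρ.rnDeriv ν x).toReal ≤ Real.exp (f x) := by
    filter_upwards [hrn] with x hx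
    exact ENNReal.toReal_le_of_le_ofReal (Real.exp_pos _).le hx
  have hlog : ∀ᵐ x ∂ν, llr ρ ν x ≤ f x := by
    filter_upwards [hrn'] with x hx
    rw [llr_def]
    rcases eq_or_lt_of_le (ENNReal.toReal_nonneg (a := ρ.rnDeriv ν x)) with h | h
    · simp [← h, hf0 x]
    · exact (Real.log_le_iff_le_exp h).2 hx
  have hint_f : Integrable f ρ := by
    refine (lintegral_ofReal_ne_top_iff_integrable hf.aestronglyMeasurable
      (ae_of_all _ hf0)).1 htop
  have hint_rf : Integrable (fun x => (ρ.rnDeriv ν x).toReal * f x) ν := by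
    simpa [smul_eq_mul] using (integrable_rnDeriv_smul_iff hac (f := f)).2 hint_f
  -- the negative part of the log-likelihood ratio is controlled by nonnegativity of `klFun`
  have hint : Integrable (llr ρ ν) ρ := by
    rw [← integrable_klFun_rnDeriv_iff hac]
    refine Integrable.mono' (hint_rf.add (integrable_const (1 : ℝ)))
      (measurable_klFun.comp (Measure.measurable_rnDeriv ρ ν).ennreal_toReal).aestronglyMeasurable ?_
    filter_upwards [hlog] with x hx
    rw [Real.norm_of_nonneg (klFun_nonneg ENNReal.toReal_nonneg), klFun_apply]
    have h0 := ENNReal.toReal_nonneg (a := ρ.rnDeriv ν x)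
    have := mul_le_mul_of_nonneg_left hx h0
    simp only [llr_def, Pi.add_apply] at this ⊢
    linarith
  rw [klDiv_of_ac_of_integrable hac hint,
    ← ofReal_integral_eq_lintegral_ofReal hint_f (ae_of_all _ hf0)]
  refine ENNReal.ofReal_le_ofReal ?_
  have h1 : ∫ x, llr ρ ν x ∂ρ ≤ ∫ x, f x ∂ρ := integral_mono_ae hint hint_f (hac hlog)
  have h2 : ν.real Set.univ ≤ 1 := by
    simpa [Measure.real] using ENNReal.toReal_mono ENNReal.one_ne_top hν
  simp only [probReal_univ]
  linarith

/-- **Gibbs' inequality** in variational form: a likelihood ratio `g` that is normalized under `ν`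
bounds the divergence from below. -/
theorem ofReal_integral_le_klDiv {ρ ν : Measure α} [IsProbabilityMeasure ρ]
    [IsProbabilityMeasure ν] {F : α → ℝ} (hF : Integrable F ρ) {g : α → ℝ≥0∞}
    (hg : Measurable g) (hFg : ∀ᵐ x ∂ρ, ENNReal.ofReal (Real.exp (F x)) ≤ g x)
    (hg1 : ∫⁻ x, g x ∂ν ≤ 1) :
    ENNReal.ofReal (∫ x, F x ∂ρ) ≤ klDiv ρ ν := by
  by_cases h : klDiv ρ ν = ∞
  · rw [h]; exact le_top
  obtain ⟨hac, hint⟩ := klDiv_ne_top_iff.1 h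
  rw [klDiv_of_ac_of_integrable hac hint]
  refine ENNReal.ofReal_le_ofReal ?_
  simp only [probReal_univ, add_sub_cancel_right]
  rw [← sub_nonpos, ← integral_sub hF hint]
  set G : α → ℝ := fun x => (g x * ν.rnDeriv ρ x).toReal
  have hgG : ∫⁻ x, g x * ν.rnDeriv ρ x ∂ρ ≤ 1 := by
    calc ∫⁻ x, g x * ν.rnDeriv ρ x ∂ρ
        = ∫⁻ x, g x ∂(ρ.withDensity (ν.rnDeriv ρ)) := by
          rw [lintegral_withDensity_eq_lintegral_mul _ (Measure.measurable_rnDeriv ν ρ) hg]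
          simp [mul_comm]
      _ ≤ ∫⁻ x, g x ∂ν := lintegral_mono' (Measure.withDensity_rnDeriv_le ν ρ) le_rfl
      _ ≤ 1 := hg1
  have hmeas : Measurable fun x => g x * ν.rnDeriv ρ x := hg.mul (Measure.measurable_rnDeriv ν ρ)
  have hGint : Integrable G ρ :=
    integrable_toReal_of_lintegral_ne_top hmeas.aemeasurable (hgG.trans_lt ENNReal.one_lt_top).ne
  have hG1 : ∫ x, G x ∂ρ ≤ 1 := by
    rw [integral_toReal hmeas.aemeasurable (ae_lt_top hmeas
      (hgG.trans_lt ENNReal.one_lt_top).ne)]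
    simpa using ENNReal.toReal_mono ENNReal.one_ne_top hgG
  have hle : ∀ᵐ x ∂ρ, F x - llr ρ ν x ≤ G x - 1 := by
    filter_upwards [hFg, exp_neg_llr hac, ae_lt_top hmeas (hgG.trans_lt ENNReal.one_lt_top).ne]
      with x h1 h2 h3
    have h4 : Real.exp (F x - llr ρ ν x) ≤ G x := by
      rw [sub_eq_add_neg, Real.exp_add]
      have h2' : Real.exp (-llr ρ ν x) = (ν.rnDeriv ρ x).toReal := h2
      have hpos : ν.rnDeriv ρ x ≠ 0 := by
        intro h0
        rw [h0] at h2'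
        simpa using (Real.exp_pos (-llr ρ ν x)).ne' h2'
      have hgfin : g x ≠ ∞ := by
        intro h0
        rw [h0, ENNReal.top_mul hpos] at h3
        exact lt_irrefl _ h3
      rw [h2']
      simp only [G, ENNReal.toReal_mul]
      refine mul_le_mul_of_nonneg_right ?_ ENNReal.toReal_nonneg
      exact (ENNReal.ofReal_le_iff_le_toReal hgfin).1 h1
    have := Real.add_one_le_exp (F x - llr ρ ν x)
    linarith
  calc ∫ x, F x - llr ρ ν x ∂ρ ≤ ∫ x, G x - 1 ∂ρ :=
        integral_mono_ae (hF.sub hint) (hGint.sub (integrable_const _)) hle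
    _ = ∫ x, G x ∂ρ - 1 := by rw [integral_sub hGint (integrable_const _)]; simp
    _ ≤ 0 := by linarith

/-- Gibbs' inequality for a likelihood ratio `exp (c - h)` with a nonnegative penalty `h`. -/
theorem ofReal_sub_le_klDiv {ρ ν : Measure α} [IsProbabilityMeasure ρ] [IsProbabilityMeasure ν]
    {h : α → ℝ} (hh : Measurable h) (hh0 : ∀ x, 0 ≤ h x) {c H : ℝ} (hH : 0 ≤ H)
    (hρ : ∫⁻ x, ENNReal.ofReal (h x) ∂ρ ≤ ENNReal.ofReal H)
    (hν : ∫⁻ x, ENNReal.ofReal (Real.exp (c - h x)) ∂ν ≤ 1) :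
    ENNReal.ofReal (c - H) ≤ klDiv ρ ν := by
  have hint : Integrable h ρ :=
    (lintegral_ofReal_ne_top_iff_integrable hh.aestronglyMeasurable (ae_of_all _ hh0)).1
      (hρ.trans_lt ENNReal.ofReal_lt_top).ne
  rw [← ofReal_integral_eq_lintegral_ofReal hint (ae_of_all _ hh0),
    ENNReal.ofReal_le_ofReal_iff hH] at hρ
  refine le_trans (ENNReal.ofReal_le_ofReal ?_) (ofReal_integral_le_klDiv
    ((integrable_const c).sub hint) (g := fun x => ENNReal.ofReal (Real.exp (c - h x)))
    (by fun_prop) (ae_of_all _ fun x => le_rfl) hν)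
  simp only [Pi.sub_apply]
  rw [integral_sub (integrable_const _) hint]
  simp only [integral_const, probReal_univ, one_smul]
  linarith

/-- Replacing the output law by any other probability law increases the divergence that defines the
mutual information. -/
theorem mutualInfo_le_klDiv [StandardBorelSpace A] [Nonempty A] {ρ : Measure (A × B)}
    [IsProbabilityMeasure ρ] (Q : Measure B) [IsFiniteMeasure Q] :
    mutualInfo ρ ≤ klDiv ρ (ρ.fst.prod Q) := by
  have hswap : ∀ (μ ν : Measure (A × B)) [IsFiniteMeasure μ] [IsFiniteMeasure ν],
      klDiv (μ.map Prod.swap) (ν.map Prod.swap) = klDiv μ ν := by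
    intro μ ν _ _
    refine le_antisymm (klDiv_map_le _ _ measurable_swap) ?_
    have := klDiv_map_le (μ.map Prod.swap) (ν.map Prod.swap) (measurable_swap (α := B) (β := A))
    simpa [Measure.map_map measurable_swap measurable_swap] using this
  have hdis : ρ.map Prod.swap = ρ.snd ⊗ₘ (ρ.map Prod.swap).condKernel := by
    rw [← Measure.fst_map_swap]
    exact ((ρ.map Prod.swap).disintegrate (ρ.map Prod.swap).condKernel).symm
  have hprod : ∀ (R : Measure B) [IsFiniteMeasure R],
      (ρ.fst.prod R).map Prod.swap = R ⊗ₘ Kernel.const B ρ.fst := by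
    intro R _
    rw [Measure.prod_swap, Measure.compProd_const]
  rw [mutualInfo, ← hswap, ← hswap ρ (ρ.fst.prod Q), hprod, hprod, hdis,
    klDiv_compProd_eq_add ρ.snd Q]
  exact le_add_self

theorem mutualInfo_le_lintegral [StandardBorelSpace A] [Nonempty A] {ρ : Measure (A × B)}
    [IsProbabilityMeasure ρ] (Q : Measure B) [IsFiniteMeasure Q] (hQ : Q Set.univ ≤ 1)
    {f : A × B → ℝ} (hf : Measurable f) (hf0 : ∀ x, 0 ≤ f x)
    (hle : ρ ≤ (ρ.fst.prod Q).withDensity fun x => ENNReal.ofReal (Real.exp (f x))) :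
    mutualInfo ρ ≤ ∫⁻ x, ENNReal.ofReal (f x) ∂ρ := by
  refine (mutualInfo_le_klDiv Q).trans (klDiv_le_lintegral_of_le_withDensity ?_ hf hf0 hle)
  rw [← Set.univ_prod_univ, Measure.prod_prod]
  simpa using hQ

end Information

/-! ### Product measures -/

section Pi

variable {E : Type*} [MeasurableSpace E]

theorem lintegral_pi_succ (μ : Measure E) [SigmaFinite μ] {n : ℕ} {F : (Fin (n + 1) → E) → ℝ≥0∞}
    (hF : Measurable F) :
    ∫⁻ x, F x ∂(Measure.pi fun _ => μ) =
      ∫⁻ a, ∫⁻ x, F (Fin.cons a x) ∂(Measure.pi fun _ : Fin n => μ) ∂μ := by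
  rw [← ((measurePreserving_piFinSuccAbove (fun _ : Fin (n + 1) => μ) 0).symm).lintegral_comp hF,
    lintegral_prod _ (by fun_prop)]
  refine lintegral_congr fun a => lintegral_congr fun x => congrArg F ?_
  exact Fin.insertNth_zero' a x

theorem lintegral_pi_prod (μ : Measure E) [SigmaFinite μ] {n : ℕ} {f : Fin n → E → ℝ≥0∞}
    (hf : ∀ k, Measurable (f k)) :
    ∫⁻ x, ∏ k, f k (x k) ∂(Measure.pi fun _ => μ) = ∏ k, ∫⁻ a, f k a ∂μ := by
  induction n with
  | zero => simp
  | succ n ih =>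
    rw [lintegral_pi_succ μ (by fun_prop), Fin.prod_univ_succ]
    simp only [Fin.prod_univ_succ, Fin.cons_zero, Fin.cons_succ]
    have h1 : ∀ a, ∫⁻ x : Fin n → E, f 0 a * ∏ i, f i.succ (x i) ∂(Measure.pi fun _ => μ)
        = f 0 a * ∏ i : Fin n, ∫⁻ a, f i.succ a ∂μ := fun a => by
      rw [lintegral_const_mul _ (by fun_prop), ih fun k => hf k.succ]
    simp_rw [h1]
    rw [lintegral_mul_const _ (hf 0)]

theorem pi_withDensity (μ : Measure E) [SigmaFinite μ] (n : ℕ) {g : E → ℝ≥0∞} (hg : Measurable g)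
    [SigmaFinite (μ.withDensity g)] :
    (Measure.pi fun _ : Fin n => μ.withDensity g) =
      (Measure.pi fun _ : Fin n => μ).withDensity fun x => ∏ k, g (x k) := by
  symm
  refine (Measure.pi_eq fun s hs => ?_).symm
  rw [withDensity_apply _ (MeasurableSet.univ_pi hs),
    ← lintegral_indicator (MeasurableSet.univ_pi hs)]
  have : ∀ x : Fin n → E, (Set.univ.pi s).indicator (fun x => ∏ k, g (x k)) x
      = ∏ k, (s k).indicator g (x k) := by
    intro x
    by_cases hx : x ∈ Set.univ.pi s
    · rw [Set.indicator_of_mem hx]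
      exact Finset.prod_congr rfl fun k _ => (Set.indicator_of_mem (hx k trivial) _).symm
    · rw [Set.indicator_of_notMem hx]
      simp only [Set.mem_pi, Set.mem_univ, true_imp_iff, not_forall] at hx
      obtain ⟨k, hk⟩ := hx
      exact (Finset.prod_eq_zero (Finset.mem_univ k) (Set.indicator_of_notMem hk _)).symm
  simp_rw [this]
  rw [lintegral_pi_prod μ fun k => hg.indicator (hs k)]
  exact Finset.prod_congr rfl fun k _ => by
    rw [lintegral_indicator (hs k), withDensity_apply _ (hs k)]

/-- A product of conditional likelihood ratios along a chain is normalized under the law of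
independent inputs; the predecessor of the first symbol is a fixed `s`. -/
theorem lintegral_chain_le_one (μ : Measure E) [IsProbabilityMeasure μ] {n : ℕ}
    {g : Fin n → E → E → ℝ≥0∞} (hg : ∀ k, Measurable fun p : E × E => g k p.1 p.2)
    (hg1 : ∀ k a, ∫⁻ b, g k a b ∂μ ≤ 1) (s : E) :
    ∫⁻ x, ∏ k, g k ((Fin.cons s x : Fin (n + 1) → E) k.castSucc) (x k)
      ∂(Measure.pi fun _ => μ) ≤ 1 := by
  induction n generalizing s with
  | zero => simp
  | succ n ih =>
    have hcons : ∀ (m : ℕ) (i : Fin (m + 1)),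
        Measurable fun p : E × (Fin m → E) => (Fin.cons p.1 p.2 : Fin (m + 1) → E) i := by
      intro m i
      refine Fin.cases ?_ (fun j => ?_) i
      · simpa using measurable_fst
      · simp only [Fin.cons_succ]; fun_prop
    have hmeas : ∀ (m : ℕ) (g : Fin m → E → E → ℝ≥0∞)
        (_ : ∀ k, Measurable fun p : E × E => g k p.1 p.2),
        Measurable fun p : E × (Fin m → E) =>
          ∏ k, g k ((Fin.cons p.1 p.2 : Fin (m + 1) → E) k.castSucc) (p.2 k) := by
      intro m g hg
      refine Finset.measurable_prod _ fun k _ => ?_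
      exact (hg k).comp ((hcons m k.castSucc).prodMk (by fun_prop))
    have hms : Measurable fun x : Fin (n + 1) → E =>
        ∏ k, g k ((Fin.cons s x : Fin (n + 2) → E) k.castSucc) (x k) :=
      (hmeas (n + 1) g hg).comp (measurable_const.prodMk measurable_id)
    rw [lintegral_pi_succ μ hms]
    simp only [Fin.prod_univ_succ, Fin.castSucc_zero, Fin.cons_zero, Fin.cons_succ,
      ← Fin.succ_castSucc]
    calc ∫⁻ a, ∫⁻ x : Fin n → E, g 0 s a *
          ∏ i : Fin n, g i.succ ((Fin.cons a x : Fin (n + 1) → E) i.castSucc) (x i)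
            ∂(Measure.pi fun _ => μ) ∂μ
        ≤ ∫⁻ a, g 0 s a ∂μ := by
          refine lintegral_mono fun a => ?_
          dsimp only
          have hm : Measurable fun x : Fin n → E =>
              ∏ i : Fin n, g i.succ ((Fin.cons a x : Fin (n + 1) → E) i.castSucc) (x i) :=
            (hmeas n (fun i => g i.succ) fun k => hg k.succ).comp
              (measurable_const.prodMk measurable_id)
          rw [lintegral_const_mul _ hm]
          calc _ ≤ g 0 s a * 1 := by
                gcongr
                exact ih (fun k => hg k.succ) (fun k => hg1 k.succ) a
            _ = g 0 s a := mul_one _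
      _ ≤ 1 := hg1 0 s

end Pi

/-! ### The uniform phase and periodic functions -/

section Phase

theorem lintegral_uniformPhase (G : ℝ → ℝ≥0∞) :
    ∫⁻ x, G x ∂uniformPhase =
      (ENNReal.ofReal (2 * Real.pi))⁻¹ * ∫⁻ x in Set.Ioc (-Real.pi) Real.pi, G x := by
  rw [uniformPhase, ProbabilityTheory.cond, lintegral_smul_measure, Real.volume_Ico, smul_eq_mul,
    Measure.restrict_congr_set Ico_ae_eq_Ioc]
  congr 3
  ring

theorem setLIntegral_Ioc_of_periodic {G : ℝ → ℝ≥0∞}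
    (hp : Function.Periodic G (2 * Real.pi)) (a : ℝ) :
    ∫⁻ x in Set.Ioc a (a + 2 * Real.pi), G x =
      ENNReal.ofReal (2 * Real.pi) * ∫⁻ x, G x ∂uniformPhase := by
  have h0 : ENNReal.ofReal (2 * Real.pi) ≠ 0 := by
    simp [Real.pi_pos]
  rw [lintegral_uniformPhase, ← mul_assoc, ENNReal.mul_inv_cancel h0 ENNReal.ofReal_ne_top,
    one_mul]
  have hd := fun t : ℝ => isAddFundamentalDomain_Ioc (Real.two_pi_pos) t (volume : Measure ℝ)
  have := (hd a).setLIntegral_eq (hd (-Real.pi)) G (by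
    rintro ⟨g, hg⟩ x
    obtain ⟨n, rfl⟩ := AddSubgroup.mem_zmultiples_iff.1 hg
    change G (n • (2 * Real.pi) + x) = G x
    rw [add_comm]
    exact hp.zsmul n x)
  rw [this]
  congr 3
  ring

theorem lintegral_uniformPhase_add {G : ℝ → ℝ≥0∞} (hG : Measurable G)
    (hp : Function.Periodic G (2 * Real.pi)) (s : ℝ) :
    ∫⁻ x, G (x + s) ∂uniformPhase = ∫⁻ x, G x ∂uniformPhase := by
  have h0 : ENNReal.ofReal (2 * Real.pi) ≠ 0 := by
    simp [Real.pi_pos]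
  have key : ∫⁻ x in Set.Ioc (-Real.pi) Real.pi, G (x + s)
      = ENNReal.ofReal (2 * Real.pi) * ∫⁻ x, G x ∂uniformPhase := by
    rw [← setLIntegral_Ioc_of_periodic hp (-Real.pi + s)]
    have hpre : (fun x : ℝ => x + s) ⁻¹' Set.Ioc (-Real.pi + s) (-Real.pi + s + 2 * Real.pi)
        = Set.Ioc (-Real.pi) Real.pi := by
      ext x; simp only [Set.mem_preimage, Set.mem_Ioc]
      constructor <;> rintro ⟨h1, h2⟩ <;> constructor <;> linarith
    rw [← (measurePreserving_add_right volume s).setLIntegral_comp_preimage measurableSet_Ioc hG,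
      hpre]
  rw [lintegral_uniformPhase (fun x => G (x + s)), key, ← mul_assoc,
    ENNReal.inv_mul_cancel h0 ENNReal.ofReal_ne_top, one_mul]

/-- A Gaussian law wrapped around the circle has a bounded density with respect to the uniform
law. -/
theorem exists_lintegral_gaussianReal_le {v : ℝ≥0} (hv : v ≠ 0) :
    ∃ C : ℝ, 0 < C ∧ ∀ G : ℝ → ℝ≥0∞, Measurable G → Function.Periodic G (2 * Real.pi) → ∀ s : ℝ,
      ∫⁻ w, G (s + w) ∂(gaussianReal 0 v) ≤ ENNReal.ofReal C * ∫⁻ x, G x ∂uniformPhase := by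
  have hvpos : (0 : ℝ) < v := lt_of_le_of_ne v.2 (by exact_mod_cast hv.symm)
  set A : ℝ := (√(2 * Real.pi * v))⁻¹ * Real.exp (v / 2) * Real.exp Real.pi
  have hA : 0 < A := by positivity
  have hsum : Summable fun k : ℤ => Real.exp (-|(k : ℝ)|) := by
    refine Summable.of_nat_of_neg ?_ ?_ <;>
    · simp only [Int.cast_natCast, Int.cast_neg, abs_neg, Nat.abs_cast]
      simpa using Real.summable_exp_neg_nat
  have hS : 0 < ∑' k : ℤ, Real.exp (-|(k : ℝ)|) :=
    hsum.tsum_pos (fun _ => (Real.exp_pos _).le) 0 (Real.exp_pos _)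
  refine ⟨A * (∑' k : ℤ, Real.exp (-|(k : ℝ)|)) * (2 * Real.pi), by positivity, ?_⟩
  intro G hG hp s
  rw [gaussianReal_of_var_ne_zero _ hv, lintegral_withDensity_eq_lintegral_mul _
    (measurable_gaussianPDF _ _) (by fun_prop)]
  rw [← setLIntegral_univ, ← iUnion_Ioc_add_zsmul Real.two_pi_pos (-Real.pi)]
  refine (lintegral_iUnion_le _ _).trans ?_
  -- on the `k`-th period `|k| ≤ |w| + π`, and the Gaussian density is at most a multiple of
  -- `exp (-|w|)`, so the periods contribute a summable sequence
  have hterm : ∀ k : ℤ,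
      ∫⁻ w in Set.Ioc (-Real.pi + k • (2 * Real.pi)) (-Real.pi + (k + 1) • (2 * Real.pi)),
        (gaussianPDF 0 v * fun w => G (s + w)) w
      ≤ ENNReal.ofReal (Real.exp (-|(k : ℝ)|)) *
        (ENNReal.ofReal (A * (2 * Real.pi)) * ∫⁻ x, G x ∂uniformPhase) := by
    intro k
    have hend : -Real.pi + (k + 1) • (2 * Real.pi)
        = -Real.pi + k • (2 * Real.pi) + 2 * Real.pi := by
      simp [add_smul]; ring
    rw [hend]
    set a := -Real.pi + k • (2 * Real.pi) with ha
    calc _ ≤ ∫⁻ w in Set.Ioc a (a + 2 * Real.pi),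
          ENNReal.ofReal (A * Real.exp (-|(k : ℝ)|)) * G (s + w) := by
          refine setLIntegral_mono (by fun_prop) fun w hw => ?_
          simp only [Pi.mul_apply]
          gcongr
          refine ENNReal.ofReal_le_ofReal ?_
          rw [gaussianPDFReal]
          have hpi := Real.pi_pos
          have hpi3 := Real.pi_gt_three
          have h1 : |(k : ℝ)| ≤ |w| + Real.pi := by
            have hk : 2 * Real.pi * |(k : ℝ)| ≤ |w| + Real.pi := by
              rw [← abs_of_pos Real.two_pi_pos, ← abs_mul]
              simp only [ha, Set.mem_Ioc, zsmul_eq_mul] at hw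
              rw [abs_le]
              have := neg_abs_le w
              have := le_abs_self w
              constructor <;> nlinarith [hw.1, hw.2]
            nlinarith [abs_nonneg (k : ℝ)]
          have h2 : -(w - 0) ^ 2 / (2 * v) ≤ v / 2 - |w| := by
            rw [div_le_iff₀ (by positivity), sub_zero, ← sq_abs w]
            nlinarith [sq_nonneg (|w| - v)]
          calc (√(2 * Real.pi * v))⁻¹ * Real.exp (-(w - 0) ^ 2 / (2 * v))
              ≤ (√(2 * Real.pi * v))⁻¹ * Real.exp (v / 2 + Real.pi + -|(k : ℝ)|) := by
                gcongr
                linarith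
            _ = A * Real.exp (-|(k : ℝ)|) := by
                simp only [A]
                rw [Real.exp_add, Real.exp_add]; ring
      _ = ENNReal.ofReal (A * Real.exp (-|(k : ℝ)|)) *
            ∫⁻ w in Set.Ioc a (a + 2 * Real.pi), G (s + w) :=
          lintegral_const_mul _ (by fun_prop)
      _ = _ := by
          have hp' : Function.Periodic (fun w => G (s + w)) (2 * Real.pi) := fun w => by
            change G (s + (w + 2 * Real.pi)) = G (s + w)
            rw [← add_assoc]; exact hp _
          rw [setLIntegral_Ioc_of_periodic hp']
          simp_rw [add_comm s]
          rw [lintegral_uniformPhase_add hG hp, ENNReal.ofReal_mul hA.le,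
            ENNReal.ofReal_mul hA.le]
          ring
  refine (ENNReal.tsum_le_tsum hterm).trans (le_of_eq ?_)
  rw [ENNReal.tsum_mul_right, ← ENNReal.ofReal_tsum_of_nonneg (fun _ => (Real.exp_pos _).le) hsum,
    ← mul_assoc, ← ENNReal.ofReal_mul hS.le]
  congr 2
  ring

end Phase

/-! ### The circle average of a Gaussian -/

section Circle

/-- On a full period, a Gaussian in `sin x` is dominated by three Gaussians in `x`, centred at the zeros
`0`, `π`, `-π` of the sine. -/
theorem exp_neg_sin_sq_le {c x : ℝ} (hc : 0 ≤ c) (hx : x ∈ Set.Ioc (-Real.pi) Real.pi) :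
    Real.exp (-(c * Real.sin x ^ 2)) ≤ Real.exp (-(c * (2 / Real.pi) ^ 2) * x ^ 2) +
      Real.exp (-(c * (2 / Real.pi) ^ 2) * (x + -Real.pi) ^ 2) +
      Real.exp (-(c * (2 / Real.pi) ^ 2) * (x + Real.pi) ^ 2) := by
  have key : ∀ t : ℝ, |t| ≤ Real.pi / 2 → Real.sin t ^ 2 = Real.sin x ^ 2 →
      Real.exp (-(c * Real.sin x ^ 2)) ≤ Real.exp (-(c * (2 / Real.pi) ^ 2) * t ^ 2) := by
    intro t ht hts
    refine Real.exp_le_exp.2 ?_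
    have h1 := Real.mul_abs_le_abs_sin ht
    have h2 : (2 / Real.pi * |t|) ^ 2 ≤ |Real.sin t| ^ 2 :=
      pow_le_pow_left₀ (by have := Real.pi_pos; positivity) h1 2
    rw [mul_pow, sq_abs, sq_abs, hts] at h2
    have := mul_le_mul_of_nonneg_left h2 hc
    linarith
  have p1 := Real.exp_pos (-(c * (2 / Real.pi) ^ 2) * x ^ 2)
  have p2 := Real.exp_pos (-(c * (2 / Real.pi) ^ 2) * (x + -Real.pi) ^ 2)
  have p3 := Real.exp_pos (-(c * (2 / Real.pi) ^ 2) * (x + Real.pi) ^ 2)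
  obtain ⟨hx1, hx2⟩ := hx
  by_cases h1 : |x| ≤ Real.pi / 2
  · have := key x h1 rfl
    linarith
  · rcases le_total 0 x with h0 | h0
    · rw [abs_of_nonneg h0] at h1
      have := key (x + -Real.pi) (by rw [abs_le]; constructor <;> linarith)
        (by rw [← sub_eq_add_neg, Real.sin_sub_pi]; ring)
      linarith
    · rw [abs_of_nonpos h0] at h1
      have := key (x + Real.pi) (by rw [abs_le]; constructor <;> linarith)
        (by rw [Real.sin_add_pi]; ring)
      linarith

theorem lintegral_exp_neg_mul_sq {b : ℝ} (hb : 0 < b) (t : ℝ) :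
    ∫⁻ x : ℝ, ENNReal.ofReal (Real.exp (-b * (x + t) ^ 2)) =
      ENNReal.ofReal (√(Real.pi / b)) := by
  rw [lintegral_add_right_eq_self (fun x : ℝ => ENNReal.ofReal (Real.exp (-b * x ^ 2))) t,
    ← ofReal_integral_eq_lintegral_ofReal (integrable_exp_neg_mul_sq hb)
      (ae_of_all _ fun x => (Real.exp_pos _).le), integral_gaussian]

theorem lintegral_exp_neg_sin_sq_le {c : ℝ} (hc : 0 < c) :
    ∫⁻ x, ENNReal.ofReal (Real.exp (-(c * Real.sin x ^ 2))) ∂uniformPhase ≤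
      ENNReal.ofReal (2 / √c) := by
  have hpi := Real.pi_pos
  set b := c * (2 / Real.pi) ^ 2 with hb
  have hb0 : 0 < b := by positivity
  have h1 : ∫⁻ x in Set.Ioc (-Real.pi) Real.pi, ENNReal.ofReal (Real.exp (-(c * Real.sin x ^ 2))) ≤
      ENNReal.ofReal (3 * √(Real.pi / b)) := by
    calc _ ≤ ∫⁻ x in Set.Ioc (-Real.pi) Real.pi, (ENNReal.ofReal (Real.exp (-b * (x + 0) ^ 2)) +
          ENNReal.ofReal (Real.exp (-b * (x + -Real.pi) ^ 2)) +
          ENNReal.ofReal (Real.exp (-b * (x + Real.pi) ^ 2))) := by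
          refine setLIntegral_mono (by fun_prop) fun x hx => ?_
          rw [← ENNReal.ofReal_add (Real.exp_pos _).le (Real.exp_pos _).le,
            ← ENNReal.ofReal_add (by positivity) (Real.exp_pos _).le, add_zero]
          exact ENNReal.ofReal_le_ofReal (exp_neg_sin_sq_le hc.le hx)
      _ ≤ ∫⁻ x, (ENNReal.ofReal (Real.exp (-b * (x + 0) ^ 2)) +
          ENNReal.ofReal (Real.exp (-b * (x + -Real.pi) ^ 2)) +
          ENNReal.ofReal (Real.exp (-b * (x + Real.pi) ^ 2))) := setLIntegral_le_lintegral _ _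
      _ = _ := by
          rw [lintegral_add_left (by fun_prop), lintegral_add_left (by fun_prop),
            lintegral_exp_neg_mul_sq hb0, lintegral_exp_neg_mul_sq hb0,
            lintegral_exp_neg_mul_sq hb0, ← ENNReal.ofReal_add (by positivity) (by positivity),
            ← ENNReal.ofReal_add (by positivity) (by positivity)]
          congr 1; ring
  rw [lintegral_uniformPhase, ← ENNReal.ofReal_inv_of_pos Real.two_pi_pos]
  calc _ ≤ ENNReal.ofReal (2 * Real.pi)⁻¹ * ENNReal.ofReal (3 * √(Real.pi / b)) := by gcongr
    _ ≤ _ := by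
      rw [← ENNReal.ofReal_mul (by positivity)]
      refine ENNReal.ofReal_le_ofReal ?_
      have hsq : √(Real.pi / b) = Real.pi / 2 * √Real.pi / √c := by
        rw [Real.sqrt_eq_iff_mul_self_eq (by positivity) (by positivity), hb]
        have e1 := Real.mul_self_sqrt hc.le
        have e2 := Real.mul_self_sqrt hpi.le
        have : Real.pi / 2 * √Real.pi / √c * (Real.pi / 2 * √Real.pi / √c)
          = (Real.pi / 2) ^ 2 * (√Real.pi * √Real.pi) / (√c * √c) := by
            field_simp
        rw [this, e1, e2]
        field_simp
      have h4 : √Real.pi ≤ 2 := by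
        rw [Real.sqrt_le_left (by norm_num)]
        linarith [Real.pi_lt_four]
      rw [hsq]
      have hc' : 0 < √c := Real.sqrt_pos.2 hc
      rw [le_div_iff₀ hc']
      field_simp
      linarith

theorem norm_sub_exp_ge (r t : ℝ) : Real.sin t ^ 2 ≤ ‖(r : ℂ) - Complex.exp (Complex.I * t)‖ ^ 2 := by
  rw [← Complex.normSq_eq_norm_sq, Complex.normSq_apply, mul_comm Complex.I]
  simp only [Complex.sub_re, Complex.ofReal_re, Complex.exp_ofReal_mul_I_re, Complex.sub_im,
    Complex.ofReal_im, Complex.exp_ofReal_mul_I_im]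
  nlinarith [sq_nonneg (r - Real.cos t)]

theorem exp_I_mul_add_two_pi (x : ℝ) :
    Complex.exp (Complex.I * ((x + 2 * Real.pi : ℝ) : ℂ)) = Complex.exp (Complex.I * (x : ℂ)) := by
  push_cast
  rw [mul_add, mul_comm Complex.I (2 * (Real.pi : ℂ)), Complex.exp_periodic]

theorem norm_exp_I_mul (x : ℝ) : ‖Complex.exp (Complex.I * (x : ℂ))‖ = 1 := by
  rw [mul_comm]; exact Complex.norm_exp_ofReal_mul_I x

/-- The circle `a e^{jφ}` spends at most a `1 / (√κ |a|)` fraction of its length in the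
`1 / √κ`-neighbourhood of any point. -/
theorem lintegral_circle_gaussian_le {κ : ℝ} (hκ : 0 < κ) (y : ℂ) {a : ℂ} (ha : a ≠ 0) :
    ∫⁻ φ, ENNReal.ofReal (Real.exp (-(κ * ‖y - a * Complex.exp (Complex.I * (φ : ℝ))‖ ^ 2)))
      ∂uniformPhase ≤ ENNReal.ofReal (2 / (√κ * ‖a‖)) := by
  set w := y / a with hw
  have ha' : 0 < ‖a‖ := norm_pos_iff.2 ha
  have hper : Function.Periodic (fun φ : ℝ => ENNReal.ofReal
      (Real.exp (-(κ * ‖y - a * Complex.exp (Complex.I * (φ : ℝ))‖ ^ 2)))) (2 * Real.pi) := by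
    intro φ
    simp only [exp_I_mul_add_two_pi]
  rw [← lintegral_uniformPhase_add (by fun_prop) hper w.arg]
  calc _ ≤ ∫⁻ φ, ENNReal.ofReal (Real.exp (-(κ * ‖a‖ ^ 2 * Real.sin φ ^ 2))) ∂uniformPhase := by
        refine lintegral_mono fun φ => ENNReal.ofReal_le_ofReal (Real.exp_le_exp.2 ?_)
        have h1 : y - a * Complex.exp (Complex.I * ((φ + w.arg : ℝ) : ℂ)) =
            a * Complex.exp (Complex.I * w.arg) *
              ((‖w‖ : ℂ) - Complex.exp (Complex.I * φ)) := by
          have h2 : y = a * (‖w‖ * Complex.exp (Complex.I * w.arg)) := by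
            rw [mul_comm Complex.I, Complex.norm_mul_exp_arg_mul_I, hw]
            field_simp
          conv_lhs => rw [h2]
          push_cast
          rw [mul_add, Complex.exp_add]
          ring
        rw [h1, norm_mul, norm_mul, norm_exp_I_mul, mul_one, mul_pow]
        have := mul_le_mul_of_nonneg_left (norm_sub_exp_ge ‖w‖ φ)
          (by positivity : 0 ≤ κ * ‖a‖ ^ 2)
        linarith
    _ ≤ ENNReal.ofReal (2 / √(κ * ‖a‖ ^ 2)) := lintegral_exp_neg_sin_sq_le (by positivity)
    _ = _ := by rw [Real.sqrt_mul hκ.le, Real.sqrt_sq ha'.le]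

end Circle

/-! ### The complex Gaussian law -/

section ComplexGaussian

/-- The density of `complexGaussian s` with respect to the Lebesgue measure on `ℂ`. -/
noncomputable def complexGaussianDensity (s : ℝ) (z : ℂ) : ℝ :=
  (Real.pi * s)⁻¹ * Real.exp (-(s⁻¹ * ‖z‖ ^ 2))

@[fun_prop]
theorem measurable_complexGaussianDensity (s : ℝ) : Measurable (complexGaussianDensity s) := by
  unfold complexGaussianDensity
  fun_prop

theorem complexGaussian_eq_withDensity {s : ℝ≥0} (hs : s ≠ 0) :
    complexGaussian s =
      volume.withDensity fun z => ENNReal.ofReal (complexGaussianDensity s z) := by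
  have hs2 : s / 2 ≠ 0 := by simpa using hs
  have hspos : (0 : ℝ) < s := by exact_mod_cast pos_iff_ne_zero.2 hs
  rw [complexGaussian, gaussianReal_of_var_ne_zero _ hs2,
    prod_withDensity (measurable_gaussianPDF _ _) (measurable_gaussianPDF _ _)]
  ext A hA
  rw [Measure.map_apply (MeasurableEquiv.measurable _) hA,
    withDensity_apply _ (MeasurableEquiv.measurable _ hA), withDensity_apply _ hA]
  have hmp := Complex.volume_preserving_equiv_real_prod.symm
  rw [← hmp.setLIntegral_comp_preimage hA (by fun_prop)]
  refine setLIntegral_congr_fun (MeasurableEquiv.measurable _ hA) fun p _ => ?_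
  simp only [gaussianPDF]
  rw [← ENNReal.ofReal_mul (gaussianPDFReal_nonneg _ _ _)]
  congr 1
  have hn : ‖Complex.measurableEquivRealProd.symm p‖ ^ 2 = p.1 ^ 2 + p.2 ^ 2 := by
    rw [← Complex.normSq_eq_norm_sq, Complex.normSq_apply]
    simp only [Complex.measurableEquivRealProd_symm_apply]
    ring
  rw [complexGaussianDensity, hn, gaussianPDFReal, gaussianPDFReal]
  have hsq : √(2 * Real.pi * ((s / 2 : ℝ≥0) : ℝ)) * √(2 * Real.pi * ((s / 2 : ℝ≥0) : ℝ))
      = Real.pi * s := by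
    rw [Real.mul_self_sqrt (by have := Real.pi_pos; positivity)]
    push_cast; ring
  rw [← hsq, mul_inv, mul_mul_mul_comm, ← Real.exp_add]
  congr 2
  push_cast
  field_simp
  ring

theorem integral_pow_four_gaussianReal (v : ℝ≥0) :
    ∫ x, x ^ 4 ∂(gaussianReal 0 v) = v ^ 2 * ∫ x, x ^ 4 ∂(gaussianReal 0 1) := by
  have h := gaussianReal_map_const_mul (μ := 0) (v := 1) (√(v : ℝ))
  have hv : NNReal.mk (√(v : ℝ) ^ 2) (sq_nonneg _) * 1 = v := by
    ext; simp
  rw [mul_zero, hv] at h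
  rw [← h, integral_map (by fun_prop) (by fun_prop)]
  simp_rw [mul_pow]
  rw [integral_const_mul]
  congr 1
  rw [show √(v : ℝ) ^ 4 = (√(v : ℝ) ^ 2) ^ 2 by ring, Real.sq_sqrt v.coe_nonneg]

theorem integrable_pow_gaussianReal (v : ℝ≥0) (k : ℕ) :
    Integrable (fun x => x ^ k) (gaussianReal 0 v) := by
  have := (memLp_id_gaussianReal (μ := 0) (v := v) k).integrable_norm_pow'
  refine (integrable_norm_iff (by fun_prop)).1 ?_
  simpa using this

theorem integrable_complexGaussian_iff {s : ℝ≥0} {f : ℂ → ℝ} :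
    Integrable f (complexGaussian s) ↔
      Integrable (fun p : ℝ × ℝ => f (Complex.measurableEquivRealProd.symm p))
        ((gaussianReal 0 (s / 2)).prod (gaussianReal 0 (s / 2))) :=
  integrable_map_equiv _ _

theorem integral_complexGaussian {s : ℝ≥0} (f : ℂ → ℝ) :
    ∫ z, f z ∂(complexGaussian s) =
      ∫ p : ℝ × ℝ, f (Complex.measurableEquivRealProd.symm p)
        ∂((gaussianReal 0 (s / 2)).prod (gaussianReal 0 (s / 2))) :=
  integral_map_equiv _ _

theorem integrable_re_complexGaussian (s : ℝ≥0) : Integrable Complex.re (complexGaussian s) := by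
  rw [integrable_complexGaussian_iff]
  simpa using (integrable_pow_gaussianReal (s / 2) 1).comp_fst (gaussianReal 0 (s / 2))

theorem integrable_im_complexGaussian (s : ℝ≥0) : Integrable Complex.im (complexGaussian s) := by
  rw [integrable_complexGaussian_iff]
  simpa using (integrable_pow_gaussianReal (s / 2) 1).comp_snd (gaussianReal 0 (s / 2))

theorem integral_re_complexGaussian (s : ℝ≥0) : ∫ z, z.re ∂(complexGaussian s) = 0 := by
  rw [integral_complexGaussian]
  simp only [Complex.measurableEquivRealProd_symm_apply]
  rw [integral_fun_fst (fun x : ℝ => x)]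
  simp

theorem integral_im_complexGaussian (s : ℝ≥0) : ∫ z, z.im ∂(complexGaussian s) = 0 := by
  rw [integral_complexGaussian]
  simp only [Complex.measurableEquivRealProd_symm_apply]
  rw [integral_fun_snd (fun x : ℝ => x)]
  simp

theorem integral_sq_gaussianReal (v : ℝ≥0) : ∫ x, x ^ 2 ∂(gaussianReal 0 v) = v := by
  have h := variance_fun_id_gaussianReal (μ := 0) (v := v)
  rw [variance_of_integral_eq_zero (by fun_prop) (by simp)] at h
  exact h

theorem norm_sq_measurableEquivRealProd_symm (p : ℝ × ℝ) :
    ‖Complex.measurableEquivRealProd.symm p‖ ^ 2 = p.1 ^ 2 + p.2 ^ 2 := by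
  rw [← Complex.normSq_eq_norm_sq, Complex.normSq_apply]
  simp only [Complex.measurableEquivRealProd_symm_apply]
  ring

theorem integrable_norm_sq_complexGaussian (s : ℝ≥0) :
    Integrable (fun z => ‖z‖ ^ 2) (complexGaussian s) := by
  rw [integrable_complexGaussian_iff]
  simp_rw [norm_sq_measurableEquivRealProd_symm]
  exact ((integrable_pow_gaussianReal (s / 2) 2).comp_fst (gaussianReal 0 (s / 2))).add
    ((integrable_pow_gaussianReal (s / 2) 2).comp_snd (gaussianReal 0 (s / 2)))

theorem integral_norm_sq_complexGaussian (s : ℝ≥0) :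
    ∫ z, ‖z‖ ^ 2 ∂(complexGaussian s) = s := by
  rw [integral_complexGaussian]
  simp_rw [norm_sq_measurableEquivRealProd_symm]
  rw [integral_add ((integrable_pow_gaussianReal (s / 2) 2).comp_fst (gaussianReal 0 (s / 2)))
    ((integrable_pow_gaussianReal (s / 2) 2).comp_snd (gaussianReal 0 (s / 2))),
    integral_fun_fst (fun x : ℝ => x ^ 2), integral_fun_snd (fun x : ℝ => x ^ 2),
    integral_sq_gaussianReal]
  simp

theorem norm_pow_four_measurableEquivRealProd_symm_le (p : ℝ × ℝ) :
    ‖Complex.measurableEquivRealProd.symm p‖ ^ 4 ≤ 2 * p.1 ^ 4 + 2 * p.2 ^ 4 := by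
  have := norm_sq_measurableEquivRealProd_symm p
  rw [show ‖Complex.measurableEquivRealProd.symm p‖ ^ 4
    = (‖Complex.measurableEquivRealProd.symm p‖ ^ 2) ^ 2 by ring, this]
  nlinarith [sq_nonneg (p.1 ^ 2 - p.2 ^ 2)]

theorem integrable_pow_four_prod (v : ℝ≥0) :
    Integrable (fun p : ℝ × ℝ => 2 * p.1 ^ 4 + 2 * p.2 ^ 4)
      ((gaussianReal 0 v).prod (gaussianReal 0 v)) :=
  (((integrable_pow_gaussianReal v 4).comp_fst (gaussianReal 0 v)).const_mul 2).add
    (((integrable_pow_gaussianReal v 4).comp_snd (gaussianReal 0 v)).const_mul 2)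

theorem integrable_norm_pow_four_complexGaussian (s : ℝ≥0) :
    Integrable (fun z => ‖z‖ ^ 4) (complexGaussian s) := by
  rw [integrable_complexGaussian_iff]
  refine (integrable_pow_four_prod (s / 2)).mono' (by fun_prop) (ae_of_all _ fun p => ?_)
  rw [Real.norm_of_nonneg (by positivity)]
  exact norm_pow_four_measurableEquivRealProd_symm_le p

theorem integral_norm_pow_four_complexGaussian_le (s : ℝ≥0) :
    ∫ z, ‖z‖ ^ 4 ∂(complexGaussian s) ≤ s ^ 2 * ∫ x, x ^ 4 ∂(gaussianReal 0 1) := by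
  rw [integral_complexGaussian]
  refine (integral_mono (integrable_complexGaussian_iff.1
    (integrable_norm_pow_four_complexGaussian s)) (integrable_pow_four_prod (s / 2))
    norm_pow_four_measurableEquivRealProd_symm_le).trans (le_of_eq ?_)
  rw [integral_add
    (((integrable_pow_gaussianReal (s / 2) 4).comp_fst (gaussianReal 0 (s / 2))).const_mul 2)
    (((integrable_pow_gaussianReal (s / 2) 4).comp_snd (gaussianReal 0 (s / 2))).const_mul 2),
    integral_const_mul, integral_const_mul,
    integral_fun_fst (fun x : ℝ => x ^ 4), integral_fun_snd (fun x : ℝ => x ^ 4),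
    integral_pow_four_gaussianReal (s / 2)]
  simp only [probReal_univ, one_smul]
  push_cast
  ring

end ComplexGaussian

/-! ### Superadditivity of mutual information -/

section Superadditive

open InformationTheory

variable {A B A₁ B₁ A₂ B₂ : Type*} [MeasurableSpace A] [MeasurableSpace B] [MeasurableSpace A₁]
  [MeasurableSpace B₁] [MeasurableSpace A₂] [MeasurableSpace B₂]

theorem mutualInfo_eq_ofReal_integral {ρ : Measure (A × B)} [IsProbabilityMeasure ρ]
    (h : mutualInfo ρ ≠ ∞) :
    ρ ≪ ρ.fst.prod ρ.snd ∧ Integrable (llr ρ (ρ.fst.prod ρ.snd)) ρ ∧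
      0 ≤ ∫ p, llr ρ (ρ.fst.prod ρ.snd) p ∂ρ ∧
      mutualInfo ρ = ENNReal.ofReal (∫ p, llr ρ (ρ.fst.prod ρ.snd) p ∂ρ) := by
  obtain ⟨hac, hint⟩ := klDiv_ne_top_iff.1 h
  have h0 := integral_llr_add_sub_measure_univ_nonneg hac hint
  simp only [probReal_univ, add_sub_cancel_right] at h0
  refine ⟨hac, hint, h0, ?_⟩
  rw [mutualInfo, klDiv_of_ac_of_integrable hac hint]
  simp

theorem lintegral_rnDeriv_prod_le_one (ρ : Measure (A × B)) [IsProbabilityMeasure ρ] :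
    ∀ᵐ y ∂ρ.snd, ∫⁻ x, ρ.rnDeriv (ρ.fst.prod ρ.snd) (x, y) ∂ρ.fst ≤ 1 := by
  have hm := Measure.measurable_rnDeriv ρ (ρ.fst.prod ρ.snd)
  refine ae_le_of_forall_setLIntegral_le_of_sigmaFinite (g := fun _ => 1)
    (hm.lintegral_prod_left' ) ?_
  intro s hs _
  have h1 := Measure.withDensity_rnDeriv_le ρ (ρ.fst.prod ρ.snd) (Set.univ ×ˢ s)
  rw [withDensity_apply _ (MeasurableSet.univ.prod hs), ← Measure.prod_restrict,
    Measure.restrict_univ, lintegral_prod_symm' _ hm] at h1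
  refine h1.trans (le_of_eq ?_)
  rw [Set.univ_prod, ← Measure.snd_apply hs]
  simp

/-- Independent inputs: the information between whole input and whole output is at least the sum
of the information between the parts. -/
theorem mutualInfo_add_le {ρ : Measure (A × B)} [IsProbabilityMeasure ρ]
    {ρ₁ : Measure (A₁ × B₁)} [IsProbabilityMeasure ρ₁]
    {ρ₂ : Measure (A₂ × B₂)} [IsProbabilityMeasure ρ₂]
    {p₁ : A → A₁} {p₂ : A → A₂} {r₁ : B → B₁} {r₂ : B → B₂}
    (hp₁ : Measurable p₁) (hp₂ : Measurable p₂) (hr₁ : Measurable r₁) (hr₂ : Measurable r₂)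
    (hind : ρ.fst.map (fun x => (p₁ x, p₂ x)) = ρ₁.fst.prod ρ₂.fst)
    (h₁ : ρ.map (Prod.map p₁ r₁) = ρ₁) (h₂ : ρ.map (Prod.map p₂ r₂) = ρ₂)
    (hI₁ : mutualInfo ρ₁ ≠ ∞) (hI₂ : mutualInfo ρ₂ ≠ ∞) :
    mutualInfo ρ₁ + mutualInfo ρ₂ ≤ mutualInfo ρ := by
  obtain ⟨hac₁, hint₁, h0₁, hI₁'⟩ := mutualInfo_eq_ofReal_integral hI₁
  obtain ⟨hac₂, hint₂, h0₂, hI₂'⟩ := mutualInfo_eq_ofReal_integral hI₂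
  set ν₁ := ρ₁.fst.prod ρ₁.snd with hν₁
  set ν₂ := ρ₂.fst.prod ρ₂.snd with hν₂
  have hq₁ : Measurable (Prod.map p₁ r₁) := hp₁.prodMap hr₁
  have hq₂ : Measurable (Prod.map p₂ r₂) := hp₂.prodMap hr₂
  have hd₁ := Measure.measurable_rnDeriv ρ₁ ν₁
  have hd₂ := Measure.measurable_rnDeriv ρ₂ ν₂
  have hm₁ : MeasurePreserving (Prod.map p₁ r₁) ρ ρ₁ := ⟨hq₁, h₁⟩
  have hm₂ : MeasurePreserving (Prod.map p₂ r₂) ρ ρ₂ := ⟨hq₂, h₂⟩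
  have hF₁ : Integrable (fun p => llr ρ₁ ν₁ (Prod.map p₁ r₁ p)) ρ :=
    hm₁.integrable_comp_of_integrable hint₁
  have hF₂ : Integrable (fun p => llr ρ₂ ν₂ (Prod.map p₂ r₂ p)) ρ :=
    hm₂.integrable_comp_of_integrable hint₂
  have hi₁ : ∫ p, llr ρ₁ ν₁ (Prod.map p₁ r₁ p) ∂ρ = ∫ p, llr ρ₁ ν₁ p ∂ρ₁ := by
    rw [← integral_map hq₁.aemeasurable (measurable_llr ρ₁ ν₁).aestronglyMeasurable, h₁]
  have hi₂ : ∫ p, llr ρ₂ ν₂ (Prod.map p₂ r₂ p) ∂ρ = ∫ p, llr ρ₂ ν₂ p ∂ρ₂ := by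
    rw [← integral_map hq₂.aemeasurable (measurable_llr ρ₂ ν₂).aestronglyMeasurable, h₂]
  have hsnd₁ : ρ.snd.map r₁ = ρ₁.snd := by
    rw [← h₁, Measure.snd, Measure.snd, Measure.map_map hr₁ measurable_snd,
      Measure.map_map measurable_snd hq₁]
    rfl
  have hsnd₂ : ρ.snd.map r₂ = ρ₂.snd := by
    rw [← h₂, Measure.snd, Measure.snd, Measure.map_map hr₂ measurable_snd,
      Measure.map_map measurable_snd hq₂]
    rfl
  rw [hI₁', hI₂', ← ENNReal.ofReal_add h0₁ h0₂, ← hi₁, ← hi₂, ← integral_add hF₁ hF₂]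
  refine ofReal_integral_le_klDiv (hF₁.add hF₂)
    (g := fun p => ρ₁.rnDeriv ν₁ (p₁ p.1, r₁ p.2) * ρ₂.rnDeriv ν₂ (p₂ p.1, r₂ p.2))
    (by fun_prop) ?_ ?_
  · have e₁ := hm₁.quasiMeasurePreserving.ae (exp_llr_of_ac ρ₁ ν₁ hac₁)
    have e₂ := hm₂.quasiMeasurePreserving.ae (exp_llr_of_ac ρ₂ ν₂ hac₂)
    filter_upwards [e₁, e₂] with p hp1 hp2
    rw [Real.exp_add, hp1, hp2, ENNReal.ofReal_mul ENNReal.toReal_nonneg]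
    exact mul_le_mul' ENNReal.ofReal_toReal_le ENNReal.ofReal_toReal_le
  · rw [lintegral_prod_symm' _ (by fun_prop)]
    have a₁ := (MeasurePreserving.mk hr₁ hsnd₁).quasiMeasurePreserving.ae
      (lintegral_rnDeriv_prod_le_one ρ₁)
    have a₂ := (MeasurePreserving.mk hr₂ hsnd₂).quasiMeasurePreserving.ae
      (lintegral_rnDeriv_prod_le_one ρ₂)
    calc _ ≤ ∫⁻ _, 1 ∂ρ.snd := by
          refine lintegral_mono_ae ?_
          filter_upwards [a₁, a₂] with y hy1 hy2
          calc ∫⁻ x, ρ₁.rnDeriv ν₁ (p₁ x, r₁ y) * ρ₂.rnDeriv ν₂ (p₂ x, r₂ y) ∂ρ.fst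
              = ∫⁻ z, ρ₁.rnDeriv ν₁ (z.1, r₁ y) * ρ₂.rnDeriv ν₂ (z.2, r₂ y)
                  ∂(ρ₁.fst.prod ρ₂.fst) := by
                rw [← hind, lintegral_map (by fun_prop) (by fun_prop)]
            _ = (∫⁻ x, ρ₁.rnDeriv ν₁ (x, r₁ y) ∂ρ₁.fst) *
                  ∫⁻ x, ρ₂.rnDeriv ν₂ (x, r₂ y) ∂ρ₂.fst :=
                lintegral_prod_mul (f := fun x => ρ₁.rnDeriv ν₁ (x, r₁ y))
                  (g := fun x => ρ₂.rnDeriv ν₂ (x, r₂ y)) (by fun_prop) (by fun_prop)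
            _ ≤ 1 * 1 := mul_le_mul' hy1 hy2
            _ = 1 := one_mul 1
      _ = 1 := by simp

end Superadditive

/-! ### The law of the channel -/

section Channel

variable {n L : ℕ}

@[fun_prop]
theorem measurable_output_left (x : Fin n → ℂ) :
    Measurable fun ω : Noise n L => output x ω := by
  have := (measurable_output n L).snd.comp (measurable_const (a := x) |>.prodMk measurable_id)
  exact this

theorem lintegral_jointLaw (β noiseVar : ℝ) {μ : Measure (Fin n → ℂ)} [SFinite μ]
    {F : (Fin n → ℂ) × (Fin (n * L) → ℂ) → ℝ≥0∞} (hF : Measurable F) :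
    ∫⁻ p, F p ∂(jointLaw β noiseVar n L μ) =
      ∫⁻ x, ∫⁻ ω, F (x, output x ω) ∂(noiseLaw β noiseVar n L) ∂μ := by
  have hm : Measurable fun p : (Fin n → ℂ) × Noise n L => F (p.1, output p.1 p.2) :=
    hF.comp (measurable_output n L)
  rw [jointLaw, lintegral_map hF (measurable_output n L), lintegral_prod _ hm.aemeasurable]

instance (β noiseVar : ℝ) (μ : Measure (Fin n → ℂ)) [IsProbabilityMeasure μ] :
    IsProbabilityMeasure (jointLaw β noiseVar n L μ) :=
  Measure.isProbabilityMeasure_map (measurable_output n L).aemeasurable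

theorem fst_jointLaw (β noiseVar : ℝ) (μ : Measure (Fin n → ℂ)) [IsProbabilityMeasure μ] :
    (jointLaw β noiseVar n L μ).fst = μ := by
  rw [Measure.fst, jointLaw, Measure.map_map measurable_fst (measurable_output n L)]
  exact Measure.fst_prod

theorem lintegral_noiseLaw (β noiseVar : ℝ) {F : Noise n L → ℝ≥0∞} (hF : Measurable F) :
    ∫⁻ ω, F ω ∂(noiseLaw β noiseVar n L) =
      ∫⁻ θ, ∫⁻ W, ∫⁻ N, F (θ, W, N)
        ∂(Measure.pi fun _ : Fin (n * L) => complexGaussian (noiseVar / L).toNNReal)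
        ∂(Measure.pi fun _ : Fin (n * L) => gaussianReal 0 (2 * Real.pi * β / L).toNNReal)
        ∂uniformPhase := by
  rw [noiseLaw, lintegral_prod _ hF.aemeasurable]
  refine lintegral_congr fun θ => ?_
  rw [lintegral_prod _ (by fun_prop)]

theorem output_eq_add (x : Fin n → ℂ) (θ : ℝ) (W : Fin (n * L) → ℝ) (N : Fin (n * L) → ℂ) :
    output x (θ, W, N) = output x (θ, W, 0) + N := by
  ext k
  simp [output, phase]

/-- The embedding of the samples of the first `a` symbols among those of `a + b` symbols. -/
def leftSample (a b L : ℕ) (k : Fin (a * L)) : Fin ((a + b) * L) :=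
  Fin.cast (add_mul a b L).symm (Fin.castAdd (b * L) k)

/-- The embedding of the samples of the last `b` symbols among those of `a + b` symbols. -/
def rightSample (a b L : ℕ) (k : Fin (b * L)) : Fin ((a + b) * L) :=
  Fin.cast (add_mul a b L).symm (Fin.natAdd (a * L) k)

/-- The samples of `a + b` symbols are those of the first `a` and those of the last `b`. -/
def sampleEquiv (a b L : ℕ) : Fin (a * L) ⊕ Fin (b * L) ≃ Fin ((a + b) * L) :=
  finSumFinEquiv.trans (finCongr (add_mul a b L).symm)

theorem sampleEquiv_inl (a b L : ℕ) (k : Fin (a * L)) :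
    sampleEquiv a b L (Sum.inl k) = leftSample a b L k := rfl

theorem sampleEquiv_inr (a b L : ℕ) (k : Fin (b * L)) :
    sampleEquiv a b L (Sum.inr k) = rightSample a b L k := rfl

theorem measurePreserving_split {E : Type*} [MeasurableSpace E] (μ : Measure E) [SigmaFinite μ]
    (a b L : ℕ) :
    MeasurePreserving (fun w : Fin ((a + b) * L) → E =>
        (fun i => w (leftSample a b L i), fun j => w (rightSample a b L j)))
      (Measure.pi fun _ => μ)
      ((Measure.pi fun _ : Fin (a * L) => μ).prod (Measure.pi fun _ : Fin (b * L) => μ)) := by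
  have h1 := (measurePreserving_piCongrLeft (fun _ : Fin ((a + b) * L) => μ)
    (sampleEquiv a b L)).symm
  have h2 := measurePreserving_sumPiEquivProdPi (fun _ : Fin (a * L) ⊕ Fin (b * L) => μ)
  exact h2.comp h1

theorem divNat_leftSample (a b : ℕ) (k : Fin (a * L)) :
    (leftSample a b L k).divNat = Fin.castAdd b k.divNat := by
  ext; simp [leftSample, Fin.divNat]

theorem divNat_rightSample (a b : ℕ) (k : Fin (b * L)) :
    (rightSample a b L k).divNat = Fin.natAdd a k.divNat := by
  have hL : 0 < L := Nat.pos_of_ne_zero fun h => by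
    subst h; exact absurd k.2 (by simp)
  ext
  simp only [rightSample, Fin.coe_divNat, Fin.val_cast, Fin.val_natAdd]
  rw [add_comm, Nat.add_mul_div_right _ _ hL, add_comm]

theorem phase_leftSample (a b : ℕ) (ω : Noise (a + b) L) (k : Fin (a * L)) :
    phase ω (leftSample a b L k) =
      phase (n := a) (L := L) (ω.1, fun i => ω.2.1 (leftSample a b L i), 0) k := by
  simp only [phase]
  congr 1
  rw [← Finset.filter_gt_eq_Iio, ← Finset.filter_gt_eq_Iio, Finset.sum_filter, Finset.sum_filter,
    ← (sampleEquiv a b L).sum_comp, Fintype.sum_sum_type]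
  simp only [sampleEquiv_inl, sampleEquiv_inr]
  have : ∀ j : Fin (b * L), ¬ rightSample a b L j < leftSample a b L k := by
    intro j h
    simp only [rightSample, leftSample, Fin.lt_def, Fin.val_cast, Fin.val_natAdd,
      Fin.val_castAdd] at h
    omega
  have h2 : ∀ j : Fin (a * L), leftSample a b L j < leftSample a b L k ↔ j < k := fun j => Iff.rfl
  simp [this, h2]

theorem phase_rightSample (a b : ℕ) (ω : Noise (a + b) L) (k : Fin (b * L)) :
    phase ω (rightSample a b L k) =
      phase (n := b) (L := L) (ω.1 + ∑ i, ω.2.1 (leftSample a b L i),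
        fun i => ω.2.1 (rightSample a b L i), 0) k := by
  simp only [phase]
  rw [add_assoc]
  congr 1
  rw [← Finset.filter_gt_eq_Iio, ← Finset.filter_gt_eq_Iio, Finset.sum_filter, Finset.sum_filter,
    ← (sampleEquiv a b L).sum_comp, Fintype.sum_sum_type]
  simp only [sampleEquiv_inl, sampleEquiv_inr]
  have : ∀ j : Fin (a * L), leftSample a b L j < rightSample a b L k := by
    intro j
    simp only [rightSample, leftSample, Fin.lt_def, Fin.val_cast, Fin.val_natAdd,
      Fin.val_castAdd]
    omega
  have h2 : ∀ j : Fin (b * L), rightSample a b L j < rightSample a b L k ↔ j < k := fun j => by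
    simp only [rightSample, Fin.lt_def, Fin.val_cast, Fin.val_natAdd]
    omega
  simp [this, h2]

theorem output_add_two_pi (x : Fin n → ℂ) (θ : ℝ) (u : (Fin (n * L) → ℝ) × (Fin (n * L) → ℂ)) :
    output x (θ + 2 * Real.pi, u) = output x (θ, u) := by
  ext k
  simp only [output, phase]
  rw [add_right_comm, exp_I_mul_add_two_pi]

theorem output_leftSample (a b : ℕ) (x₁ : Fin a → ℂ) (x₂ : Fin b → ℂ) (ω : Noise (a + b) L) :
    (fun k => output (Fin.append x₁ x₂) ω (leftSample a b L k)) =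
      output x₁ (ω.1, fun i => ω.2.1 (leftSample a b L i),
        fun i => ω.2.2 (leftSample a b L i)) := by
  ext k
  rw [output, output, divNat_leftSample, Fin.append_left, phase_leftSample]
  rfl

theorem output_rightSample (a b : ℕ) (x₁ : Fin a → ℂ) (x₂ : Fin b → ℂ) (ω : Noise (a + b) L) :
    (fun k => output (Fin.append x₁ x₂) ω (rightSample a b L k)) =
      output x₂ (ω.1 + ∑ i, ω.2.1 (leftSample a b L i), fun i => ω.2.1 (rightSample a b L i),
        fun i => ω.2.2 (rightSample a b L i)) := by
  ext k
  rw [output, output, divNat_rightSample, Fin.append_right, phase_rightSample]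
  rfl

theorem lintegral_noise_leftSample (β noiseVar : ℝ) (a b : ℕ) (x₁ : Fin a → ℂ) (x₂ : Fin b → ℂ)
    {F : (Fin (a * L) → ℂ) → ℝ≥0∞} (hF : Measurable F) :
    ∫⁻ ω, F (fun k => output (Fin.append x₁ x₂) ω (leftSample a b L k))
        ∂(noiseLaw β noiseVar (a + b) L) =
      ∫⁻ ω, F (output x₁ ω) ∂(noiseLaw β noiseVar a L) := by
  simp_rw [output_leftSample]
  have hW := measurePreserving_fst.comp
    (measurePreserving_split (gaussianReal 0 (2 * Real.pi * β / L).toNNReal) a b L)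
  have hN := measurePreserving_fst.comp
    (measurePreserving_split (complexGaussian (noiseVar / L).toNNReal) a b L)
  have := (MeasurePreserving.id uniformPhase).prod (hW.prod hN)
  exact this.lintegral_comp (f := fun ω : Noise a L => F (output x₁ ω)) (by fun_prop)

/-- The phase that the first block hands over to the second one is again uniform on the circle. -/
theorem lintegral_noise_rightSample (β noiseVar : ℝ) (a b : ℕ) (x₁ : Fin a → ℂ) (x₂ : Fin b → ℂ)
    {F : (Fin (b * L) → ℂ) → ℝ≥0∞} (hF : Measurable F) :
    ∫⁻ ω, F (fun k => output (Fin.append x₁ x₂) ω (rightSample a b L k))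
        ∂(noiseLaw β noiseVar (a + b) L) =
      ∫⁻ ω, F (output x₂ ω) ∂(noiseLaw β noiseVar b L) := by
  simp_rw [output_rightSample]
  have hW := measurePreserving_snd.comp
    (measurePreserving_split (gaussianReal 0 (2 * Real.pi * β / L).toNNReal) a b L)
  have hN := measurePreserving_snd.comp
    (measurePreserving_split (complexGaussian (noiseVar / L).toNNReal) a b L)
  have hm : Measurable fun ω : Noise b L => F (output x₂ ω) := by fun_prop
  have hshift : Measurable fun ω : Noise (a + b) L =>
      ((ω.1 + ∑ i, ω.2.1 (leftSample a b L i), fun i => ω.2.1 (rightSample a b L i),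
        fun i => ω.2.2 (rightSample a b L i)) : Noise b L) := by
    fun_prop
  have hm' := hm.comp hshift
  simp only [Function.comp_def] at hm'
  have hinner : ∀ u : (Fin ((a + b) * L) → ℝ) × (Fin ((a + b) * L) → ℂ),
      ∫⁻ θ, F (output x₂ (θ + ∑ i, u.1 (leftSample a b L i), fun i => u.1 (rightSample a b L i),
        fun i => u.2 (rightSample a b L i))) ∂uniformPhase =
      ∫⁻ θ, F (output x₂ (θ, fun i => u.1 (rightSample a b L i),
        fun i => u.2 (rightSample a b L i))) ∂uniformPhase := fun u =>
    lintegral_uniformPhase_add (G := fun θ => F (output x₂ (θ,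
      fun i => u.1 (rightSample a b L i), fun i => u.2 (rightSample a b L i))))
      (by fun_prop) (fun θ => congrArg F (output_add_two_pi x₂ θ _)) _
  have hΨ := hm.lintegral_prod_left' (μ := uniformPhase)
  have hpres := (hW.prod hN).lintegral_comp hΨ
  rw [noiseLaw, lintegral_prod_symm' _ hm', noiseLaw, lintegral_prod_symm' _ hm, ← hpres]
  exact lintegral_congr hinner

theorem measurable_append (a b : ℕ) :
    Measurable fun p : (Fin a → ℂ) × (Fin b → ℂ) => Fin.append p.1 p.2 := by
  refine measurable_pi_lambda _ fun i => ?_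
  refine Fin.addCases (fun j => ?_) (fun j => ?_) i
  · simp only [Fin.append_left]; fun_prop
  · simp only [Fin.append_right]; fun_prop

theorem mutualInfo_jointLaw_add_le (β noiseVar : ℝ) (a b L : ℕ) (μ₁ : Measure (Fin a → ℂ))
    (μ₂ : Measure (Fin b → ℂ)) [IsProbabilityMeasure μ₁] [IsProbabilityMeasure μ₂]
    (h₁ : mutualInfo (jointLaw β noiseVar a L μ₁) ≠ ∞)
    (h₂ : mutualInfo (jointLaw β noiseVar b L μ₂) ≠ ∞) :
    mutualInfo (jointLaw β noiseVar a L μ₁) + mutualInfo (jointLaw β noiseVar b L μ₂) ≤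
      mutualInfo (jointLaw β noiseVar (a + b) L
        ((μ₁.prod μ₂).map fun p => Fin.append p.1 p.2)) := by
  have hap := measurable_append a b
  have : IsProbabilityMeasure ((μ₁.prod μ₂).map fun p => Fin.append p.1 p.2) :=
    Measure.isProbabilityMeasure_map hap.aemeasurable
  have hp₁ : Measurable fun x : Fin (a + b) → ℂ => fun i => x (Fin.castAdd b i) := by fun_prop
  have hp₂ : Measurable fun x : Fin (a + b) → ℂ => fun i => x (Fin.natAdd a i) := by fun_prop
  have hr₁ : Measurable fun y : Fin ((a + b) * L) → ℂ => fun i => y (leftSample a b L i) := by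
    fun_prop
  have hr₂ : Measurable fun y : Fin ((a + b) * L) → ℂ => fun i => y (rightSample a b L i) := by
    fun_prop
  refine mutualInfo_add_le hp₁ hp₂ hr₁ hr₂ ?_ ?_ ?_ h₁ h₂
  · rw [fst_jointLaw, fst_jointLaw, fst_jointLaw, Measure.map_map (hp₁.prodMk hp₂) hap]
    convert Measure.map_id
    ext p <;> simp
  · refine Measure.ext_of_lintegral _ fun F hF => ?_
    have hF' := hF.comp (hp₁.prodMap hr₁)
    simp only [Function.comp_def] at hF'
    rw [lintegral_map hF (hp₁.prodMap hr₁), lintegral_jointLaw _ _ hF',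
      lintegral_map _ hap, lintegral_jointLaw _ _ hF]
    · simp only [Prod.map_apply, Fin.append_left]
      have : ∀ p : (Fin a → ℂ) × (Fin b → ℂ),
          ∫⁻ ω, F (p.1, fun i => output (Fin.append p.1 p.2) ω (leftSample a b L i))
            ∂(noiseLaw β noiseVar (a + b) L) =
          ∫⁻ ω, F (p.1, output p.1 ω) ∂(noiseLaw β noiseVar a L) := fun p =>
        lintegral_noise_leftSample β noiseVar a b p.1 p.2 (F := fun y => F (p.1, y)) (by fun_prop)
      simp_rw [this]
      exact measurePreserving_fst.lintegral_comp
        (hF.comp (measurable_output a L)).lintegral_prod_right'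
    · exact (hF'.comp (measurable_output _ L)).lintegral_prod_right'
  · refine Measure.ext_of_lintegral _ fun F hF => ?_
    have hF' := hF.comp (hp₂.prodMap hr₂)
    simp only [Function.comp_def] at hF'
    rw [lintegral_map hF (hp₂.prodMap hr₂), lintegral_jointLaw _ _ hF',
      lintegral_map _ hap, lintegral_jointLaw _ _ hF]
    · simp only [Prod.map_apply, Fin.append_right]
      have : ∀ p : (Fin a → ℂ) × (Fin b → ℂ),
          ∫⁻ ω, F (p.2, fun i => output (Fin.append p.1 p.2) ω (rightSample a b L i))
            ∂(noiseLaw β noiseVar (a + b) L) =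
          ∫⁻ ω, F (p.2, output p.2 ω) ∂(noiseLaw β noiseVar b L) := fun p =>
        lintegral_noise_rightSample β noiseVar a b p.1 p.2 (F := fun y => F (p.2, y)) (by fun_prop)
      simp_rw [this]
      exact measurePreserving_snd.lintegral_comp
        (hF.comp (measurable_output b L)).lintegral_prod_right'
    · exact (hF'.comp (measurable_output _ L)).lintegral_prod_right'

end Channel

/-! ### Upper bounds on the mutual information -/

section UpperBound

variable {n L : ℕ}

theorem measurePreserving_additiveNoise (β noiseVar : ℝ) (k : Fin (n * L)) :
    MeasurePreserving (fun ω : Noise n L => ω.2.2 k) (noiseLaw β noiseVar n L)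
      (complexGaussian (noiseVar / L).toNNReal) :=
  (measurePreserving_eval (fun _ : Fin (n * L) => complexGaussian (noiseVar / L).toNNReal) k).comp
    (measurePreserving_snd.comp measurePreserving_snd)

theorem measurePreserving_phaseIncrement (β noiseVar : ℝ) (k : Fin (n * L)) :
    MeasurePreserving (fun ω : Noise n L => ω.2.1 k) (noiseLaw β noiseVar n L)
      (gaussianReal 0 (2 * Real.pi * β / L).toNNReal) :=
  (measurePreserving_eval
    (fun _ : Fin (n * L) => gaussianReal 0 (2 * Real.pi * β / L).toNNReal) k).comp
    (measurePreserving_fst.comp measurePreserving_snd)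

theorem lintegral_norm_sq_complexGaussian (s : ℝ≥0) :
    ∫⁻ z, ENNReal.ofReal (‖z‖ ^ 2) ∂(complexGaussian s) = s := by
  rw [← ofReal_integral_eq_lintegral_ofReal (integrable_norm_sq_complexGaussian s)
    (ae_of_all _ fun z => by positivity), integral_norm_sq_complexGaussian, ENNReal.ofReal_coe_nnreal]

theorem lintegral_norm_sq_additiveNoise {noiseVar : ℝ} (β : ℝ) (k : Fin (n * L)) :
    ∫⁻ ω, ENNReal.ofReal (‖ω.2.2 k‖ ^ 2) ∂(noiseLaw β noiseVar n L) =
      ENNReal.ofReal (noiseVar / L) := by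
  rw [(measurePreserving_additiveNoise β noiseVar k).lintegral_comp
    (f := fun z => ENNReal.ofReal (‖z‖ ^ 2)) (by fun_prop), lintegral_norm_sq_complexGaussian]
  rfl

theorem sum_divNat {M : Type*} [AddCommMonoid M] (φ : Fin n → M) :
    ∑ k : Fin (n * L), φ k.divNat = L • ∑ m, φ m := by
  rw [← finProdFinEquiv.sum_comp, Fintype.sum_prod_type]
  have : ∀ (x : Fin n) (y : Fin L), (finProdFinEquiv (x, y)).divNat = x := fun x y =>
    congrArg Prod.fst (finProdFinEquiv.symm_apply_apply (x, y))
  simp [this, Finset.smul_sum]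

theorem sum_lintegral_le_of_mem_admissibleInputs {P : ℝ} {μ : Measure (Fin n → ℂ)}
    (hμ : μ ∈ admissibleInputs n P) :
    ∑ m : Fin n, ∫⁻ x, ENNReal.ofReal (‖x m‖ ^ 2) ∂μ ≤ n * ENNReal.ofReal P := by
  have h := hμ.2
  have he : ∀ z : ℂ, ENNReal.ofReal (‖z‖ ^ 2) = ‖z‖ₑ ^ 2 := fun z => by
    rw [ENNReal.ofReal_pow (norm_nonneg _), ofReal_norm]
  simp_rw [he]
  rcases Nat.eq_zero_or_pos n with h0 | h0
  · subst h0; simp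
  · have h1 : (n : ℝ≥0∞) ≠ 0 := by exact_mod_cast h0.ne'
    calc _ = (n : ℝ≥0∞) * ((n : ℝ≥0∞)⁻¹ * ∑ m : Fin n, ∫⁻ x, ‖x m‖ₑ ^ 2 ∂μ) := by
          rw [← mul_assoc, ENNReal.mul_inv_cancel h1 (ENNReal.natCast_ne_top n), one_mul]
      _ ≤ _ := by gcongr

theorem lintegral_mul_swap {Y T U : Type*} [MeasurableSpace Y] [MeasurableSpace T]
    [MeasurableSpace U] (κ : Measure Y) (τ : Measure T) (υ : Measure U) [SFinite κ] [SFinite τ]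
    [SFinite υ] {F : Y → ℝ≥0∞} {G : Y × T × U → ℝ≥0∞} (hF : Measurable F) (hG : Measurable G) :
    ∫⁻ t, ∫⁻ u, ∫⁻ y, F y * G (y, t, u) ∂κ ∂υ ∂τ =
      ∫⁻ y, F y * ∫⁻ t, ∫⁻ u, G (y, t, u) ∂υ ∂τ ∂κ := by
  have hFG : Measurable fun p : Y × T × U => F p.1 * G p := (hF.comp measurable_fst).mul hG
  calc ∫⁻ t, ∫⁻ u, ∫⁻ y, F y * G (y, t, u) ∂κ ∂υ ∂τ
      = ∫⁻ p, ∫⁻ y, F y * G (y, p) ∂κ ∂(τ.prod υ) := by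
        rw [lintegral_prod _ hFG.lintegral_prod_left'.aemeasurable]
    _ = ∫⁻ y, ∫⁻ p, F y * G (y, p) ∂(τ.prod υ) ∂κ :=
        lintegral_lintegral_swap (hFG.comp measurable_swap).aemeasurable
    _ = _ := by
        refine lintegral_congr fun y => ?_
        have hy : Measurable fun p : T × U => G (y, p) :=
          hG.comp (measurable_const.prodMk measurable_id)
        rw [lintegral_const_mul _ hy, lintegral_prod _ hy.aemeasurable]

/-- The mutual information is bounded by the mean of any `f ≥ 0` such that the channel density,
averaged over the phase, is at most `exp f` times a product of probability densities `q`. -/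
theorem mutualInfo_jointLaw_le {β noiseVar : ℝ} (hN : 0 < noiseVar) (hL : 0 < L)
    {μ : Measure (Fin n → ℂ)} [IsProbabilityMeasure μ] {q : ℂ → ℝ≥0∞} (hq : Measurable q)
    (hq1 : ∫⁻ z, q z ≤ 1) {f : (Fin n → ℂ) × (Fin (n * L) → ℂ) → ℝ} (hf : Measurable f)
    (hf0 : ∀ p, 0 ≤ f p)
    (hD : ∀ x y, ∫⁻ θ, ∫⁻ W, ∏ k : Fin (n * L),
        ENNReal.ofReal (complexGaussianDensity (noiseVar / L) (y k - output x (θ, W, 0) k))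
          ∂(Measure.pi fun _ : Fin (n * L) => gaussianReal 0 (2 * Real.pi * β / L).toNNReal)
          ∂uniformPhase
        ≤ ENNReal.ofReal (Real.exp (f (x, y))) * ∏ k, q (y k)) :
    mutualInfo (jointLaw β noiseVar n L μ) ≤
      ∫⁻ x, ∫⁻ ω, ENNReal.ofReal (f (x, output x ω)) ∂(noiseLaw β noiseVar n L) ∂μ := by
  have hs : 0 < noiseVar / L := by positivity
  have hs0 : (noiseVar / L).toNNReal ≠ 0 := by simpa using hs
  have hscoe : (((noiseVar / L).toNNReal : ℝ≥0) : ℝ) = noiseVar / L := Real.coe_toNNReal _ hs.le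
  set s := noiseVar / L with hsdef
  have : IsFiniteMeasure ((volume : Measure ℂ).withDensity q) :=
    isFiniteMeasure_withDensity (hq1.trans_lt ENNReal.one_lt_top).ne
  set Q : Measure (Fin (n * L) → ℂ) := Measure.pi fun _ => volume.withDensity q with hQ
  have hQ1 : Q Set.univ ≤ 1 := by
    rw [hQ, Measure.pi_univ]
    refine Finset.prod_le_one' fun k _ => ?_
    rwa [withDensity_apply _ MeasurableSet.univ, setLIntegral_univ]
  have hmq : Measurable fun y : Fin (n * L) → ℂ => ∏ k, q (y k) :=
    Finset.measurable_prod _ fun k _ => hq.comp (measurable_pi_apply k)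
  have hQd : Q = volume.withDensity fun y => ∏ k, q (y k) := by
    rw [hQ, pi_withDensity _ _ hq]; rfl
  set g : ℂ → ℝ≥0∞ := fun z => ENNReal.ofReal (complexGaussianDensity s z) with hg
  have hgm : Measurable g := by fun_prop
  have hNd : (Measure.pi fun _ : Fin (n * L) => complexGaussian s.toNNReal) =
      volume.withDensity fun y => ∏ k, g (y k) := by
    have h1 : complexGaussian s.toNNReal = volume.withDensity g := by
      rw [complexGaussian_eq_withDensity hs0, hscoe]
    have h2 : IsProbabilityMeasure ((volume : Measure ℂ).withDensity g) := by
      rw [← h1]; infer_instance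
    rw [h1, pi_withDensity _ _ hgm]; rfl
  have hmg : Measurable fun y : Fin (n * L) → ℂ => ∏ k, g (y k) :=
    Finset.measurable_prod _ fun k _ => hgm.comp (measurable_pi_apply k)
  rw [← lintegral_jointLaw (F := fun p => ENNReal.ofReal (f p)) β noiseVar (by fun_prop)]
  refine mutualInfo_le_lintegral Q hQ1 hf hf0 ?_
  rw [fst_jointLaw, Measure.le_iff]
  intro A hA
  set F : (Fin n → ℂ) × (Fin (n * L) → ℂ) → ℝ≥0∞ := A.indicator 1 with hFdef
  have hF : Measurable F := measurable_one.indicator hA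
  have hsig : Measurable fun p : (Fin n → ℂ) × ℝ × (Fin (n * L) → ℝ) =>
      output p.1 ((p.2.1, p.2.2, 0) : Noise n L) := by
    have h0 : Measurable fun p : (Fin n → ℂ) × ℝ × (Fin (n * L) → ℝ) =>
      ((p.1, (p.2.1, p.2.2, 0)) : (Fin n → ℂ) × Noise n L) := by fun_prop
    exact ((measurable_output n L).comp h0).snd
  have hLHS : jointLaw β noiseVar n L μ A = ∫⁻ x, ∫⁻ y, F (x, y) * ∫⁻ θ, ∫⁻ W,
      ∏ k : Fin (n * L), g (y k - output x (θ, W, 0) k)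
          ∂(Measure.pi fun _ : Fin (n * L) => gaussianReal 0 (2 * Real.pi * β / L).toNNReal)
          ∂uniformPhase ∂volume ∂μ := by
    rw [← lintegral_indicator_one hA, lintegral_jointLaw _ _ hF]
    refine lintegral_congr fun x => ?_
    have hFx : Measurable fun ω : Noise n L => F (x, output x ω) :=
      hF.comp (measurable_const.prodMk (measurable_output_left x))
    rw [lintegral_noiseLaw _ _ hFx]
    have hsigx : Measurable fun p : ℝ × (Fin (n * L) → ℝ) =>
        output x ((p.1, p.2, 0) : Noise n L) := hsig.comp (measurable_const.prodMk measurable_id)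
    have hjoint : Measurable fun p : (Fin (n * L) → ℂ) × ℝ × (Fin (n * L) → ℝ) =>
        ∏ k, g (p.1 k - output x ((p.2.1, p.2.2, 0) : Noise n L) k) := by
      have : Measurable fun p : (Fin (n * L) → ℂ) × ℝ × (Fin (n * L) → ℝ) =>
        p.1 - output x ((p.2.1, p.2.2, 0) : Noise n L) :=
        measurable_fst.sub (hsigx.comp measurable_snd)
      exact hmg.comp this
    have h1 : ∀ θ W, ∫⁻ N, F (x, output x (θ, W, N))
        ∂(Measure.pi fun _ : Fin (n * L) => complexGaussian s.toNNReal) =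
        ∫⁻ y, F (x, y) * ∏ k, g (y k - output x (θ, W, 0) k) := by
      intro θ W
      have hm1 : Measurable fun N : Fin (n * L) → ℂ => F (x, output x (θ, W, 0) + N) := by
        fun_prop
      have hadd : ∀ N : Fin (n * L) → ℂ, F (x, output x (θ, W, N)) =
          F (x, output x (θ, W, 0) + N) := fun N => by rw [output_eq_add x θ W N]
      rw [lintegral_congr hadd, hNd, lintegral_withDensity_eq_lintegral_mul _ hmg hm1,
        ← lintegral_add_left_eq_self (fun y => F (x, y) * ∏ k, g (y k - output x (θ, W, 0) k))
          (output x (θ, W, 0))]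
      refine lintegral_congr fun N => ?_
      rw [Pi.mul_apply, mul_comm]
      simp only [Pi.add_apply, add_sub_cancel_left]
    refine (lintegral_congr fun θ => lintegral_congr fun W => h1 θ W).trans ?_
    exact lintegral_mul_swap volume uniformPhase _ (F := fun y => F (x, y))
      (hF.comp (measurable_const.prodMk measurable_id)) hjoint
  have hRHS : ((μ.prod Q).withDensity fun p => ENNReal.ofReal (Real.exp (f p))) A =
      ∫⁻ x, ∫⁻ y, F (x, y) * (ENNReal.ofReal (Real.exp (f (x, y))) * ∏ k, q (y k)) ∂volume ∂μ := by
    have hm2 : Measurable fun p : (Fin n → ℂ) × (Fin (n * L) → ℂ) =>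
      A.indicator (fun p => ENNReal.ofReal (Real.exp (f p))) p :=
      Measurable.indicator (by fun_prop) hA
    rw [withDensity_apply _ hA, ← lintegral_indicator hA, lintegral_prod _ hm2.aemeasurable]
    refine lintegral_congr fun x => ?_
    have hm3 : Measurable fun y : Fin (n * L) → ℂ =>
      A.indicator (fun p => ENNReal.ofReal (Real.exp (f p))) (x, y) := by fun_prop
    rw [hQd, lintegral_withDensity_eq_lintegral_mul _ hmq hm3]
    refine lintegral_congr fun y => ?_
    by_cases h : (x, y) ∈ A
    · simp [hFdef, h, mul_comm]
    · simp [hFdef, h]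
  rw [hLHS, hRHS]
  gcongr with x y
  exact hD x y

theorem norm_output_sub_le (x : Fin n → ℂ) (ω : Noise n L) (k : Fin (n * L)) :
    |‖output x ω k‖ - ‖x k.divNat‖ / L| ≤ ‖ω.2.2 k‖ := by
  have h1 : ‖x k.divNat * (1 / (L : ℂ)) * Complex.exp (Complex.I * (phase ω k : ℂ))‖
      = ‖x k.divNat‖ / L := by
    rw [norm_mul, norm_exp_I_mul, norm_mul, norm_div]
    simp [div_eq_mul_inv]
  rw [← h1]
  refine (abs_norm_sub_norm_le _ _).trans (le_of_eq ?_)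
  simp [output]

theorem norm_output_sq_le (x : Fin n → ℂ) (ω : Noise n L) (k : Fin (n * L)) :
    ‖output x ω k‖ ^ 2 ≤ 2 * (‖x k.divNat‖ ^ 2 / L ^ 2) + 2 * ‖ω.2.2 k‖ ^ 2 := by
  have h := (abs_le.1 (norm_output_sub_le x ω k)).2
  have h1 : ‖output x ω k‖ ≤ ‖x k.divNat‖ / L + ‖ω.2.2 k‖ := by linarith
  have h2 := pow_le_pow_left₀ (norm_nonneg _) h1 2
  rw [← div_pow]
  nlinarith [sq_nonneg (‖x k.divNat‖ / L - ‖ω.2.2 k‖)]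

theorem lintegral_norm_output_sq_le {β noiseVar : ℝ} (x : Fin n → ℂ) (k : Fin (n * L)) :
    ∫⁻ ω, ENNReal.ofReal (‖output x ω k‖ ^ 2) ∂(noiseLaw β noiseVar n L) ≤
      2 * ENNReal.ofReal (‖x k.divNat‖ ^ 2 / L ^ 2) + 2 * ENNReal.ofReal (noiseVar / L) := by
  calc _ ≤ ∫⁻ ω, (2 * ENNReal.ofReal (‖x k.divNat‖ ^ 2 / L ^ 2) +
        2 * ENNReal.ofReal (‖ω.2.2 k‖ ^ 2)) ∂(noiseLaw β noiseVar n L) := by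
        refine lintegral_mono fun ω => ?_
        refine (ENNReal.ofReal_le_ofReal (norm_output_sq_le x ω k)).trans (le_of_eq ?_)
        rw [ENNReal.ofReal_add (by positivity) (by positivity), ENNReal.ofReal_mul (by norm_num),
          ENNReal.ofReal_mul (by norm_num)]
        simp
    _ = _ := by
        rw [lintegral_add_left (by fun_prop), lintegral_const, measure_univ, mul_one,
          lintegral_const_mul _ (by fun_prop), lintegral_norm_sq_additiveNoise]

theorem sum_lintegral_norm_output_sq_le {β noiseVar P : ℝ} (hL : 0 < L) {μ : Measure (Fin n → ℂ)}
    (hμ : μ ∈ admissibleInputs n P) :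
    ∑ k : Fin (n * L), ∫⁻ x, ∫⁻ ω, ENNReal.ofReal (‖output x ω k‖ ^ 2)
        ∂(noiseLaw β noiseVar n L) ∂μ ≤
      n * (2 * ENNReal.ofReal P + 2 * ENNReal.ofReal noiseVar) := by
  have := hμ.1
  have hL' : (0 : ℝ) < L := by exact_mod_cast hL
  have hL1 : (1 : ℝ) ≤ L := by exact_mod_cast hL
  calc _ ≤ ∑ k : Fin (n * L), (2 * ∫⁻ x, ENNReal.ofReal (‖x k.divNat‖ ^ 2 / L ^ 2) ∂μ +
        2 * ENNReal.ofReal (noiseVar / L)) := by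
        refine Finset.sum_le_sum fun k _ => ?_
        refine (lintegral_mono fun x => lintegral_norm_output_sq_le x k).trans (le_of_eq ?_)
        rw [lintegral_add_left (by fun_prop), lintegral_const_mul _ (by fun_prop)]
        simp
    _ = L * (∑ m : Fin n, 2 * ∫⁻ x, ENNReal.ofReal (‖x m‖ ^ 2 / L ^ 2) ∂μ) +
          n * (2 * (L * ENNReal.ofReal (noiseVar / L))) := by
        rw [Finset.sum_add_distrib,
          sum_divNat (fun m => 2 * ∫⁻ x, ENNReal.ofReal (‖x m‖ ^ 2 / L ^ 2) ∂μ)]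
        simp only [nsmul_eq_mul, Finset.sum_const, Finset.card_univ, Fintype.card_fin]
        push_cast
        ring
    _ = 2 * (ENNReal.ofReal ((L : ℝ) * ((L : ℝ) ^ 2)⁻¹) *
          (∑ m : Fin n, ∫⁻ x, ENNReal.ofReal (‖x m‖ ^ 2) ∂μ)) +
          n * (2 * ENNReal.ofReal noiseVar) := by
        have h1 : ∀ m : Fin n, ∫⁻ x, ENNReal.ofReal (‖x m‖ ^ 2 / L ^ 2) ∂μ =
            ENNReal.ofReal ((L : ℝ) ^ 2)⁻¹ * ∫⁻ x, ENNReal.ofReal (‖x m‖ ^ 2) ∂μ := by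
          intro m
          rw [← lintegral_const_mul _ (by fun_prop)]
          refine lintegral_congr fun x => ?_
          rw [← ENNReal.ofReal_mul (by positivity)]
          congr 1; rw [div_eq_inv_mul]
        simp_rw [h1]
        rw [← Finset.mul_sum, ← Finset.mul_sum, ENNReal.ofReal_mul hL'.le, ENNReal.ofReal_natCast]
        congr 1
        · ring
        · rw [← ENNReal.ofReal_natCast L, ← ENNReal.ofReal_mul hL'.le]
          congr 3
          field_simp
    _ ≤ 2 * (1 * (n * ENNReal.ofReal P)) + n * (2 * ENNReal.ofReal noiseVar) := by
        gcongr
        · rw [← ENNReal.ofReal_one]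
          refine ENNReal.ofReal_le_ofReal ?_
          rw [← div_eq_mul_inv, div_le_one (by positivity)]
          nlinarith
        · exact sum_lintegral_le_of_mem_admissibleInputs hμ
    _ = _ := by ring

end UpperBound

/-! ### Existence of the capacity -/

section Capacity

variable {n L : ℕ}

theorem complexGaussianDensity_le {s : ℝ} (hs : 0 < s) (z : ℂ) :
    complexGaussianDensity s z ≤ (Real.pi * s)⁻¹ := by
  have := Real.pi_pos
  rw [complexGaussianDensity]
  refine mul_le_of_le_one_right (by positivity) (Real.exp_le_one_iff.2 ?_)
  have : 0 ≤ s⁻¹ * ‖z‖ ^ 2 := by positivity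
  linarith

theorem lintegral_complexGaussianDensity {s : ℝ} (hs : 0 < s) :
    ∫⁻ z, ENNReal.ofReal (complexGaussianDensity s z) = 1 := by
  have hs0 : s.toNNReal ≠ 0 := by simpa using hs
  have h := complexGaussian_eq_withDensity hs0
  rw [Real.coe_toNNReal _ hs.le] at h
  rw [← setLIntegral_univ, ← withDensity_apply _ MeasurableSet.univ, ← h, measure_univ]

/-- Comparison with i.i.d. Gaussian outputs. The linear growth in `n` is all that matters here. -/
theorem mutualInfo_jointLaw_le_linear {β noiseVar P : ℝ} (hN : 0 < noiseVar) (hL : 0 < L)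
    {μ : Measure (Fin n → ℂ)} (hμ : μ ∈ admissibleInputs n P) :
    mutualInfo (jointLaw β noiseVar n L μ) ≤
      n * (ENNReal.ofReal (noiseVar / L)⁻¹ * (2 * ENNReal.ofReal P + 2 * ENNReal.ofReal noiseVar)) := by
  have := hμ.1
  have hs : 0 < noiseVar / L := by positivity
  set s := noiseVar / L with hsdef
  have hpi := Real.pi_pos
  refine (mutualInfo_jointLaw_le (q := fun z => ENNReal.ofReal (complexGaussianDensity s z))
    (f := fun p => ∑ k, s⁻¹ * ‖p.2 k‖ ^ 2) hN hL (by fun_prop)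
    (lintegral_complexGaussianDensity hs).le (by fun_prop)
    (fun p => Finset.sum_nonneg fun k _ => by positivity) ?_).trans ?_
  · intro x y
    have hR : ENNReal.ofReal (Real.exp (∑ k, s⁻¹ * ‖y k‖ ^ 2)) *
        ∏ k, ENNReal.ofReal (complexGaussianDensity s (y k)) =
        ∏ _k : Fin (n * L), ENNReal.ofReal (Real.pi * s)⁻¹ := by
      rw [Real.exp_sum, ENNReal.ofReal_prod_of_nonneg fun _ _ => (Real.exp_pos _).le,
        ← Finset.prod_mul_distrib]
      refine Finset.prod_congr rfl fun k _ => ?_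
      rw [← ENNReal.ofReal_mul (Real.exp_pos _).le, complexGaussianDensity, mul_left_comm,
        ← Real.exp_add]
      simp
    calc _ ≤ ∫⁻ _ : ℝ, ∫⁻ _ : Fin (n * L) → ℝ, ∏ _k : Fin (n * L), ENNReal.ofReal (Real.pi * s)⁻¹
          ∂(Measure.pi fun _ : Fin (n * L) => gaussianReal 0 (2 * Real.pi * β / L).toNNReal)
          ∂uniformPhase := by
          gcongr
          exact complexGaussianDensity_le hs _
      _ = _ := by rw [hR, lintegral_const, lintegral_const]; simp
  · have h1 : ∀ x, ∫⁻ ω : Noise n L, ENNReal.ofReal (∑ k, s⁻¹ * ‖output x ω k‖ ^ 2)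
        ∂(noiseLaw β noiseVar n L) = ∑ k, ENNReal.ofReal s⁻¹ *
          ∫⁻ ω : Noise n L, ENNReal.ofReal (‖output x ω k‖ ^ 2) ∂(noiseLaw β noiseVar n L) := by
      intro x
      have h2 : ∀ ω : Noise n L, ENNReal.ofReal (∑ k, s⁻¹ * ‖output x ω k‖ ^ 2) =
          ∑ k, ENNReal.ofReal s⁻¹ * ENNReal.ofReal (‖output x ω k‖ ^ 2) := by
        intro ω
        rw [ENNReal.ofReal_sum_of_nonneg fun k _ => by positivity]
        exact Finset.sum_congr rfl fun k _ => ENNReal.ofReal_mul (by positivity)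
      simp_rw [h2]
      rw [lintegral_finsetSum _ fun k _ => by fun_prop]
      exact Finset.sum_congr rfl fun k _ => lintegral_const_mul _ (by fun_prop)
    simp_rw [h1]
    have hmk : ∀ k, Measurable fun x : Fin n → ℂ =>
        ∫⁻ ω : Noise n L, ENNReal.ofReal (‖output x ω k‖ ^ 2) ∂(noiseLaw β noiseVar n L) := by
      intro k
      have : Measurable fun p : (Fin n → ℂ) × Noise n L =>
          ENNReal.ofReal (‖output p.1 p.2 k‖ ^ 2) :=
        (by fun_prop : Measurable fun y : Fin (n * L) → ℂ => ENNReal.ofReal (‖y k‖ ^ 2)).comp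
          (measurable_output n L).snd
      exact this.lintegral_prod_right'
    rw [lintegral_finsetSum _ fun k _ => (hmk k).const_mul _]
    simp_rw [fun k => lintegral_const_mul (μ := μ) (ENNReal.ofReal s⁻¹) (hmk k)]
    rw [← Finset.mul_sum]
    calc _ ≤ ENNReal.ofReal s⁻¹ * (n * (2 * ENNReal.ofReal P + 2 * ENNReal.ofReal noiseVar)) := by
          gcongr
          exact sum_lintegral_norm_output_sq_le hL hμ
      _ = _ := by ring

theorem admissibleInputs_nonempty (n : ℕ) (P : ℝ) : (admissibleInputs n P).Nonempty :=
  ⟨Measure.dirac 0, inferInstance, by simp⟩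

theorem map_append_mem_admissibleInputs {a b : ℕ} {P : ℝ} {μ₁ : Measure (Fin a → ℂ)}
    {μ₂ : Measure (Fin b → ℂ)} (h₁ : μ₁ ∈ admissibleInputs a P) (h₂ : μ₂ ∈ admissibleInputs b P) :
    ((μ₁.prod μ₂).map fun p => Fin.append p.1 p.2) ∈ admissibleInputs (a + b) P := by
  have := h₁.1
  have := h₂.1
  have hap := measurable_append a b
  refine ⟨Measure.isProbabilityMeasure_map hap.aemeasurable, ?_⟩
  rcases Nat.eq_zero_or_pos (a + b) with h0 | h0
  · obtain ⟨rfl, rfl⟩ := Nat.add_eq_zero_iff.1 h0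
    simp
  have h1 : ((a + b : ℕ) : ℝ≥0∞) ≠ 0 := by exact_mod_cast h0.ne'
  have he : ∀ z : ℂ, ‖z‖ₑ ^ 2 = ENNReal.ofReal (‖z‖ ^ 2) := fun z => by
    rw [ENNReal.ofReal_pow (norm_nonneg _), ofReal_norm]
  have hs₁ := sum_lintegral_le_of_mem_admissibleInputs h₁
  have hs₂ := sum_lintegral_le_of_mem_admissibleInputs h₂
  rw [ENNReal.inv_mul_le_iff h1 (ENNReal.natCast_ne_top _), Fin.sum_univ_add]
  have e1 : ∀ m : Fin a, ∫⁻ x, ‖x (Fin.castAdd b m)‖ₑ ^ 2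
      ∂((μ₁.prod μ₂).map fun p => Fin.append p.1 p.2) = ∫⁻ x, ENNReal.ofReal (‖x m‖ ^ 2) ∂μ₁ := by
    intro m
    rw [lintegral_map (by fun_prop) hap]
    simp only [Fin.append_left, he]
    exact measurePreserving_fst.lintegral_comp (f := fun x : Fin a → ℂ => ENNReal.ofReal (‖x m‖ ^ 2))
      (by fun_prop)
  have e2 : ∀ m : Fin b, ∫⁻ x, ‖x (Fin.natAdd a m)‖ₑ ^ 2
      ∂((μ₁.prod μ₂).map fun p => Fin.append p.1 p.2) = ∫⁻ x, ENNReal.ofReal (‖x m‖ ^ 2) ∂μ₂ := by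
    intro m
    rw [lintegral_map (by fun_prop) hap]
    simp only [Fin.append_right, he]
    exact measurePreserving_snd.lintegral_comp (f := fun x : Fin b → ℂ => ENNReal.ofReal (‖x m‖ ^ 2))
      (by fun_prop)
  simp_rw [e1, e2]
  push_cast
  rw [add_mul]
  exact add_le_add hs₁ hs₂

/-- The limit that defines the capacity exists and is finite, by Fekete's lemma: the optimal
information is superadditive in the number of symbols, because the phase at the beginning of a block
is uniform and independent inputs may be concatenated. -/
theorem tendsto_blockRate {β noiseVar : ℝ} (hN : 0 < noiseVar) (hL : 0 < L) (P : ℝ) :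
    ∃ c : ℝ, Tendsto (blockRate β noiseVar L P) atTop (𝓝 (ENNReal.ofReal c)) := by
  set S : ℕ → ℝ≥0∞ := fun n =>
    ⨆ μ ∈ admissibleInputs n P, mutualInfo (jointLaw β noiseVar n L μ) with hS
  set K : ℝ≥0∞ :=
    ENNReal.ofReal (noiseVar / L)⁻¹ * (2 * ENNReal.ofReal P + 2 * ENNReal.ofReal noiseVar) with hK
  have hKtop : K ≠ ∞ := by
    refine ENNReal.mul_ne_top ENNReal.ofReal_ne_top (ENNReal.add_ne_top.2 ⟨?_, ?_⟩) <;>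
    exact ENNReal.mul_ne_top (by simp) ENNReal.ofReal_ne_top
  have hSK : ∀ n, S n ≤ n * K := fun n =>
    iSup₂_le fun μ hμ => mutualInfo_jointLaw_le_linear hN hL hμ
  have hStop : ∀ n, S n ≠ ∞ := fun n =>
    ((hSK n).trans_lt (ENNReal.mul_lt_top (ENNReal.natCast_lt_top n) hKtop.lt_top)).ne
  have hadd : ∀ a b, S a + S b ≤ S (a + b) := by
    intro a b
    refine ENNReal.biSup_add_biSup_le (admissibleInputs_nonempty a P)
      (admissibleInputs_nonempty b P) fun μ₁ h₁ μ₂ h₂ => ?_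
    have := h₁.1
    have := h₂.1
    refine (mutualInfo_jointLaw_add_le β noiseVar a b L μ₁ μ₂ ?_ ?_).trans ?_
    · exact ne_top_of_le_ne_top (hStop a)
        (le_iSup₂ (f := fun μ (_ : μ ∈ admissibleInputs a P) =>
          mutualInfo (jointLaw β noiseVar a L μ)) μ₁ h₁)
    · exact ne_top_of_le_ne_top (hStop b)
        (le_iSup₂ (f := fun μ (_ : μ ∈ admissibleInputs b P) =>
          mutualInfo (jointLaw β noiseVar b L μ)) μ₂ h₂)
    · exact le_iSup₂ (f := fun μ (_ : μ ∈ admissibleInputs (a + b) P) =>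
          mutualInfo (jointLaw β noiseVar (a + b) L μ)) _ (map_append_mem_admissibleInputs h₁ h₂)
  have hsub : Subadditive fun n => -(S n).toReal := by
    intro a b
    have := ENNReal.toReal_mono (hStop (a + b)) (hadd a b)
    rw [ENNReal.toReal_add (hStop a) (hStop b)] at this
    linarith
  have hbdd : BddBelow (Set.range fun n : ℕ => -(S n).toReal / n) := by
    refine ⟨-K.toReal, ?_⟩
    rintro _ ⟨n, rfl⟩
    rcases Nat.eq_zero_or_pos n with h0 | h0
    · subst h0; simp
    · have hn : (0 : ℝ) < n := by exact_mod_cast h0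
      have := ENNReal.toReal_mono (ENNReal.mul_ne_top (ENNReal.natCast_ne_top n) hKtop) (hSK n)
      rw [ENNReal.toReal_mul, ENNReal.toReal_natCast] at this
      simp only
      rw [le_div_iff₀ hn]
      linarith
  have hlim := (hsub.tendsto_lim hbdd).neg
  have hrate : ∀ n : ℕ, 0 < n →
      blockRate β noiseVar L P n = ENNReal.ofReal (-(-(S n).toReal / n)) := by
    intro n h0
    have hn : (0 : ℝ) < n := by exact_mod_cast h0
    rw [blockRate, neg_div, neg_neg, ENNReal.ofReal_div_of_pos hn, ENNReal.ofReal_toReal (hStop n),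
      ENNReal.ofReal_natCast, ENNReal.div_eq_inv_mul]
  refine ⟨-hsub.lim, (ENNReal.tendsto_ofReal hlim).congr' ?_⟩
  filter_upwards [eventually_gt_atTop 0] with n hn
  exact (hrate n hn).symm

theorem tendsto_capacity {β noiseVar : ℝ} (hN : 0 < noiseVar) (hL : 0 < L) (snr : ℝ) :
    Tendsto (blockRate β noiseVar L (snr * noiseVar)) atTop (𝓝 (capacity β noiseVar L snr)) ∧
      capacity β noiseVar L snr ≠ ∞ := by
  obtain ⟨c, hc⟩ := tendsto_blockRate (β := β) hN hL (snr * noiseVar)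
  have : capacity β noiseVar L snr = ENNReal.ofReal c := hc.limUnder_eq
  rw [this]
  exact ⟨hc, ENNReal.ofReal_ne_top⟩

end Capacity

/-! ### The capacity with one sample per symbol: upper bound -/

section OneSample

variable {n L : ℕ}

theorem sum_Iio_succ_cons {m : ℕ} (w : ℝ) (W : Fin m → ℝ) (k : Fin m) :
    ∑ i ∈ Finset.Iio k.succ, (Fin.cons w W : Fin (m + 1) → ℝ) i = w + ∑ i ∈ Finset.Iio k, W i := by
  rw [← Finset.filter_gt_eq_Iio, ← Finset.filter_gt_eq_Iio, Finset.sum_filter, Finset.sum_filter,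
    Fin.sum_univ_succ]
  simp [Fin.succ_lt_succ_iff]

/-- The joint law on the torus of the phases of the Wiener process has a bounded density with respect
to the uniform law, with a bound that is exponential in the number of samples. -/
theorem lintegral_phase_prod_le {v : ℝ≥0} {C : ℝ}
    (hC : ∀ G : ℝ → ℝ≥0∞, Measurable G → Function.Periodic G (2 * Real.pi) → ∀ s : ℝ,
      ∫⁻ w, G (s + w) ∂(gaussianReal 0 v) ≤ ENNReal.ofReal C * ∫⁻ x, G x ∂uniformPhase)
    {m : ℕ} {G : Fin m → ℝ → ℝ≥0∞} (hG : ∀ k, Measurable (G k))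
    (hp : ∀ k, Function.Periodic (G k) (2 * Real.pi)) :
    ∫⁻ θ, ∫⁻ W, ∏ k, G k (θ + ∑ i ∈ Finset.Iio k, W i)
        ∂(Measure.pi fun _ : Fin m => gaussianReal 0 v) ∂uniformPhase ≤
      ENNReal.ofReal C ^ m * ∏ k, ∫⁻ x, G k x ∂uniformPhase := by
  induction m with
  | zero => simp
  | succ m ih =>
    have hmeas : Measurable fun p : ℝ × (Fin m → ℝ) =>
        ∏ k : Fin m, G k.succ (p.1 + ∑ i ∈ Finset.Iio k, p.2 i) :=
      Finset.measurable_prod _ fun k _ => (hG k.succ).comp (by fun_prop)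
    set J : ℝ → ℝ≥0∞ := fun θ => ∫⁻ W, ∏ k : Fin m, G k.succ (θ + ∑ i ∈ Finset.Iio k, W i)
      ∂(Measure.pi fun _ : Fin m => gaussianReal 0 v) with hJ
    have hJm : Measurable J := hmeas.lintegral_prod_right'
    have hJp : Function.Periodic J (2 * Real.pi) := by
      intro θ
      refine lintegral_congr fun W => Finset.prod_congr rfl fun k _ => ?_
      rw [add_right_comm]
      exact hp k.succ _
    have hstep : ∀ θ : ℝ, ∫⁻ W, ∏ k, G k (θ + ∑ i ∈ Finset.Iio k, W i)
        ∂(Measure.pi fun _ : Fin (m + 1) => gaussianReal 0 v) =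
        G 0 θ * ∫⁻ w, J (θ + w) ∂(gaussianReal 0 v) := by
      intro θ
      have hms : Measurable fun W : Fin (m + 1) → ℝ =>
          ∏ k, G k (θ + ∑ i ∈ Finset.Iio k, W i) :=
        Finset.measurable_prod _ fun k _ => (hG k).comp (by fun_prop)
      rw [lintegral_pi_succ _ hms, ← lintegral_const_mul _ (by fun_prop)]
      refine lintegral_congr fun w => ?_
      have hmw : Measurable fun W : Fin m → ℝ =>
          ∏ k : Fin m, G k.succ (θ + w + ∑ i ∈ Finset.Iio k, W i) :=
        hmeas.comp (measurable_const.prodMk measurable_id)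
      simp only [hJ]
      rw [← lintegral_const_mul _ hmw]
      refine lintegral_congr fun W => ?_
      rw [Fin.prod_univ_succ]
      refine congrArg₂ (· * ·) ?_ (Finset.prod_congr rfl fun k _ => ?_)
      · have h0 : Finset.Iio (0 : Fin (m + 1)) = ∅ := by ext i; simp
        rw [h0, Finset.sum_empty, add_zero]
      · rw [sum_Iio_succ_cons, add_assoc]
    simp_rw [hstep]
    calc ∫⁻ θ, G 0 θ * ∫⁻ w, J (θ + w) ∂(gaussianReal 0 v) ∂uniformPhase
        ≤ ∫⁻ θ, G 0 θ * (ENNReal.ofReal C * ∫⁻ x, J x ∂uniformPhase) ∂uniformPhase := by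
          gcongr with θ
          exact hC J hJm hJp θ
      _ = (∫⁻ θ, G 0 θ ∂uniformPhase) * (ENNReal.ofReal C * ∫⁻ x, J x ∂uniformPhase) :=
          lintegral_mul_const _ (hG 0)
      _ ≤ (∫⁻ θ, G 0 θ ∂uniformPhase) * (ENNReal.ofReal C * (ENNReal.ofReal C ^ m *
            ∏ k : Fin m, ∫⁻ x, G k.succ x ∂uniformPhase)) := by
          gcongr
          exact ih (fun k => hG k.succ) fun k => hp k.succ
      _ = _ := by
          rw [Fin.prod_univ_succ]
          ring

/-- The density of a Gaussian variable centred at a uniformly random point of a circle of radius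
`|a|` is of order at most `1 / (1 + |a|)`. -/
theorem lintegral_circle_density_le {s : ℝ} (hs : 0 < s) (y a : ℂ) :
    ∫⁻ φ, ENNReal.ofReal (complexGaussianDensity s (y - a * Complex.exp (Complex.I * (φ : ℝ))))
      ∂uniformPhase ≤ ENNReal.ofReal ((Real.pi * s)⁻¹ * (1 + 2 * √s) / (1 + ‖a‖)) := by
  have hpi := Real.pi_pos
  have h1 : ∫⁻ φ, ENNReal.ofReal (complexGaussianDensity s
      (y - a * Complex.exp (Complex.I * (φ : ℝ)))) ∂uniformPhase ≤
      ENNReal.ofReal (Real.pi * s)⁻¹ := by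
    calc _ ≤ ∫⁻ _ : ℝ, ENNReal.ofReal (Real.pi * s)⁻¹ ∂uniformPhase := by
          gcongr
          exact complexGaussianDensity_le hs _
      _ = _ := by simp
  have hs' : 0 < √s := Real.sqrt_pos.2 hs
  rcases eq_or_ne a 0 with rfl | ha
  · refine h1.trans (ENNReal.ofReal_le_ofReal ?_)
    simp only [norm_zero, add_zero, div_one]
    refine le_mul_of_one_le_right (by positivity) ?_
    linarith
  · have ha' : 0 < ‖a‖ := norm_pos_iff.2 ha
    have h2 : ∫⁻ φ, ENNReal.ofReal (complexGaussianDensity s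
        (y - a * Complex.exp (Complex.I * (φ : ℝ)))) ∂uniformPhase ≤
        ENNReal.ofReal ((Real.pi * s)⁻¹ * (2 * √s / ‖a‖)) := by
      have : ∀ φ : ℝ, ENNReal.ofReal (complexGaussianDensity s
          (y - a * Complex.exp (Complex.I * (φ : ℝ)))) = ENNReal.ofReal (Real.pi * s)⁻¹ *
          ENNReal.ofReal (Real.exp (-(s⁻¹ * ‖y - a * Complex.exp (Complex.I * (φ : ℝ))‖ ^ 2))) :=
        fun φ => by rw [complexGaussianDensity, ENNReal.ofReal_mul (by positivity)]
      simp_rw [this]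
      rw [lintegral_const_mul _ (by fun_prop), ENNReal.ofReal_mul (by positivity)]
      gcongr
      refine (lintegral_circle_gaussian_le (inv_pos.2 hs) y ha).trans (le_of_eq ?_)
      rw [Real.sqrt_inv]
      congr 1
      field_simp
    rcases le_total (1 : ℝ) (2 * √s / ‖a‖) with h | h
    · refine h1.trans (ENNReal.ofReal_le_ofReal ?_)
      rw [mul_div_assoc]
      refine le_mul_of_one_le_right (by positivity) ?_
      rw [le_div_iff₀ ha'] at h
      rw [le_div_iff₀ (by positivity)]
      linarith
    · refine h2.trans (ENNReal.ofReal_le_ofReal ?_)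
      rw [mul_div_assoc (Real.pi * s)⁻¹]
      refine mul_le_mul_of_nonneg_left ?_ (by positivity)
      rw [div_le_one ha'] at h
      rw [div_le_div_iff₀ ha' (by positivity : 0 < 1 + ‖a‖)]
      nlinarith

/-- The output density used to bound the capacity with one sample per symbol: its modulus is nearly
half-Gaussian with power `P`, and its phase is uniform. -/
noncomputable def radialDensity (P : ℝ) (y : ℂ) : ℝ :=
  (2 * Real.pi * √(2 * Real.pi * P))⁻¹ / (1 + ‖y‖) * Real.exp (-(2 * P)⁻¹ * ‖y‖ ^ 2)

@[fun_prop]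
theorem measurable_radialDensity (P : ℝ) : Measurable (radialDensity P) := by
  unfold radialDensity
  fun_prop

theorem lintegral_radialDensity_le {P : ℝ} (hP : 0 < P) :
    ∫⁻ y, ENNReal.ofReal (radialDensity P y) ≤ 1 := by
  have hpi := Real.pi_pos
  set c := (2 * Real.pi * √(2 * Real.pi * P))⁻¹ with hc
  have hc0 : 0 < c := by positivity
  rw [← Complex.lintegral_comp_polarCoord_symm]
  calc ∫⁻ p in polarCoord.target, ENNReal.ofReal p.1 •
        ENNReal.ofReal (radialDensity P (Complex.polarCoord.symm p))
      ≤ ∫⁻ p in polarCoord.target, ENNReal.ofReal c *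
          ENNReal.ofReal (Real.exp (-(2 * P)⁻¹ * p.1 ^ 2)) := by
        refine setLIntegral_mono (by fun_prop) fun p hp => ?_
        have hp1 : 0 < p.1 := hp.1
        have hn : ‖Complex.polarCoord.symm p‖ = p.1 := by
          rw [Complex.norm_polarCoord_symm, abs_of_pos hp1]
        rw [smul_eq_mul, ← ENNReal.ofReal_mul hp1.le, ← ENNReal.ofReal_mul hc0.le, radialDensity,
          hn, ← hc]
        refine ENNReal.ofReal_le_ofReal ?_
        rw [← mul_assoc]
        refine mul_le_mul_of_nonneg_right ?_ (Real.exp_pos _).le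
        rw [mul_div_assoc', div_le_iff₀ (by positivity)]
        nlinarith
    _ ≤ ∫⁻ p in Set.univ ×ˢ Set.Ioo (-Real.pi) Real.pi, ENNReal.ofReal c *
          ENNReal.ofReal (Real.exp (-(2 * P)⁻¹ * (p.1 + 0) ^ 2)) := by
        simp only [add_zero]
        refine lintegral_mono_set fun p hp => ⟨trivial, hp.2⟩
    _ = ENNReal.ofReal c * (ENNReal.ofReal (√(Real.pi / (2 * P)⁻¹)) *
          ENNReal.ofReal (2 * Real.pi)) := by
        rw [Measure.volume_eq_prod, ← Measure.prod_restrict, lintegral_const_mul _ (by fun_prop),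
          lintegral_prod _ (by fun_prop)]
        congr 1
        simp only [lintegral_const, Measure.restrict_apply_univ, Real.volume_Ioo,
          Measure.restrict_univ]
        rw [lintegral_mul_const _ (by fun_prop),
          lintegral_exp_neg_mul_sq (inv_pos.2 (by positivity : (0 : ℝ) < 2 * P))]
        congr 2
        ring
    _ ≤ 1 := by
        rw [← ENNReal.ofReal_mul (by positivity), ← ENNReal.ofReal_mul hc0.le,
          ← ENNReal.ofReal_one]
        refine ENNReal.ofReal_le_ofReal (le_of_eq ?_)
        have : Real.pi / (2 * P)⁻¹ = 2 * Real.pi * P := by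
          rw [div_inv_eq_mul]; ring
        rw [this, hc]
        field_simp

/-- The log-ratio between the channel density `K / (1 + |x|)` and the reference output density. The
term `|‖y‖ - ‖x‖|` pays for replacing `1 + |x|` by `1 + |y|`. -/
theorem radialDensity_bound {P K c : ℝ} (hP : 0 < P)
    (hc : K * (2 * Real.pi * √(2 * Real.pi)) ≤ Real.exp c) (x y : ℂ) :
    K / (1 + ‖x‖) ≤ Real.exp (c + 1 / 2 * Real.log P + |‖y‖ - ‖x‖| + (2 * P)⁻¹ * ‖y‖ ^ 2) *
      radialDensity P y := by
  have hpi := Real.pi_pos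
  have hPs : Real.exp (1 / 2 * Real.log P) = √P := by
    rw [Real.sqrt_eq_rpow, Real.rpow_def_of_pos hP, mul_comm]
  have hsqrt : √(2 * Real.pi * P) = √(2 * Real.pi) * √P := Real.sqrt_mul (by positivity) P
  have hP' : 0 < √P := Real.sqrt_pos.2 hP
  have hx : 0 < 1 + ‖x‖ := by positivity
  have hy : 0 < 1 + ‖y‖ := by positivity
  have h1 : 1 + ‖y‖ ≤ Real.exp |‖y‖ - ‖x‖| * (1 + ‖x‖) := by
    have h2 := Real.add_one_le_exp |‖y‖ - ‖x‖|
    have h3 := le_abs_self (‖y‖ - ‖x‖)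
    have h4 : (|‖y‖ - ‖x‖| + 1) * (1 + ‖x‖) ≤ Real.exp |‖y‖ - ‖x‖| * (1 + ‖x‖) :=
      mul_le_mul_of_nonneg_right h2 hx.le
    nlinarith [abs_nonneg (‖y‖ - ‖x‖), norm_nonneg x]
  have hE : Real.exp ((2 * P)⁻¹ * ‖y‖ ^ 2) * Real.exp (-(2 * P)⁻¹ * ‖y‖ ^ 2) = 1 := by
    rw [← Real.exp_add]; simp
  have hrw : Real.exp (c + 1 / 2 * Real.log P + |‖y‖ - ‖x‖| + (2 * P)⁻¹ * ‖y‖ ^ 2) *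
      radialDensity P y =
      Real.exp c * (Real.exp |‖y‖ - ‖x‖| / (1 + ‖y‖)) / (2 * Real.pi * √(2 * Real.pi)) := by
    rw [radialDensity, Real.exp_add, Real.exp_add, Real.exp_add, hPs, hsqrt]
    calc _ = Real.exp c * (Real.exp |‖y‖ - ‖x‖| / (1 + ‖y‖)) *
          (√P * (2 * Real.pi * (√(2 * Real.pi) * √P))⁻¹) *
          (Real.exp ((2 * P)⁻¹ * ‖y‖ ^ 2) * Real.exp (-(2 * P)⁻¹ * ‖y‖ ^ 2)) := by ring
      _ = _ := by
        rw [hE]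
        field_simp
  rw [hrw, le_div_iff₀ (by positivity)]
  have h5 : 1 / (1 + ‖x‖) ≤ Real.exp |‖y‖ - ‖x‖| / (1 + ‖y‖) := by
    rw [div_le_div_iff₀ hx hy]; linarith
  calc K / (1 + ‖x‖) * (2 * Real.pi * √(2 * Real.pi))
      = K * (2 * Real.pi * √(2 * Real.pi)) * (1 / (1 + ‖x‖)) := by ring
    _ ≤ Real.exp c * (1 / (1 + ‖x‖)) := by gcongr
    _ ≤ _ := by gcongr

end OneSample

section OneSampleCapacity

variable {n : ℕ}

/-- The channel density with one sample per symbol, averaged over the phases, decays like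
`∏ 1 / (1 + |x_k|)`: only the modulus of the input survives. -/
theorem lintegral_density_one_le {noiseVar C v : ℝ} (hN : 0 < noiseVar) (hC0 : 0 < C)
    (hC : ∀ G : ℝ → ℝ≥0∞, Measurable G → Function.Periodic G (2 * Real.pi) → ∀ s : ℝ,
      ∫⁻ w, G (s + w) ∂(gaussianReal 0 v.toNNReal) ≤
        ENNReal.ofReal C * ∫⁻ x, G x ∂uniformPhase)
    (x : Fin n → ℂ) (y : Fin (n * 1) → ℂ) :
    ∫⁻ θ, ∫⁻ W, ∏ k : Fin (n * 1),
        ENNReal.ofReal (complexGaussianDensity noiseVar (y k - output x (θ, W, 0) k))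
          ∂(Measure.pi fun _ : Fin (n * 1) => gaussianReal 0 v.toNNReal) ∂uniformPhase ≤
      ∏ k : Fin (n * 1), ENNReal.ofReal
        (C * ((Real.pi * noiseVar)⁻¹ * (1 + 2 * √noiseVar)) / (1 + ‖x k.divNat‖)) := by
  have hpi := Real.pi_pos
  set G : Fin (n * 1) → ℝ → ℝ≥0∞ := fun k φ => ENNReal.ofReal (complexGaussianDensity noiseVar
    (y k - x k.divNat * Complex.exp (Complex.I * (φ : ℂ)))) with hG
  have hout : ∀ θ W (k : Fin (n * 1)),
      ENNReal.ofReal (complexGaussianDensity noiseVar (y k - output x (θ, W, 0) k)) =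
        G k (θ + ∑ i ∈ Finset.Iio k, W i) := by
    intro θ W k
    simp [hG, output, phase]
  simp_rw [hout]
  refine (lintegral_phase_prod_le hC (G := G) (fun k => by fun_prop) fun k φ => ?_).trans ?_
  · simp only [hG]
    rw [exp_I_mul_add_two_pi]
  · calc ENNReal.ofReal C ^ (n * 1) * ∏ k, ∫⁻ φ, G k φ ∂uniformPhase
        = ∏ k, ENNReal.ofReal C * ∫⁻ φ, G k φ ∂uniformPhase := by
          rw [Finset.prod_mul_distrib]; simp
      _ ≤ _ := by
          refine Finset.prod_le_prod' fun k _ => ?_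
          rw [mul_div_assoc, ENNReal.ofReal_mul hC0.le]
          gcongr
          exact lintegral_circle_density_le hN _ _

theorem exists_mutualInfo_one_le {β noiseVar : ℝ} (hβ : 0 < β) (hN : 0 < noiseVar) :
    ∃ C : ℝ, ∀ (P : ℝ) (n : ℕ) (μ : Measure (Fin n → ℂ)), 1 ≤ P → μ ∈ admissibleInputs n P →
      mutualInfo (jointLaw β noiseVar n 1 μ) ≤ n * ENNReal.ofReal (1 / 2 * Real.log P + C) := by
  have hpi := Real.pi_pos
  have hv : (2 * Real.pi * β / ((1 : ℕ) : ℝ)).toNNReal ≠ 0 := by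
    simp only [ne_eq, Real.toNNReal_eq_zero, not_le]; positivity
  obtain ⟨C₀, hC₀, hC⟩ := exists_lintegral_gaussianReal_le hv
  set K := C₀ * ((Real.pi * noiseVar)⁻¹ * (1 + 2 * √noiseVar)) with hK
  set c := K * (2 * Real.pi * √(2 * Real.pi)) with hc
  have hc0 : 0 ≤ c := by positivity
  have hcexp : K * (2 * Real.pi * √(2 * Real.pi)) ≤ Real.exp c := by
    have := Real.add_one_le_exp c
    linarith
  refine ⟨c + 2 + 2 * noiseVar, fun P n μ hP hμ => ?_⟩
  have := hμ.1
  have hP0 : 0 < P := by linarith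
  have hlog : 0 ≤ Real.log P := Real.log_nonneg hP
  set f : (Fin n → ℂ) × (Fin (n * 1) → ℂ) → ℝ := fun p => ∑ k : Fin (n * 1),
    (c + 1 / 2 * Real.log P + |‖p.2 k‖ - ‖p.1 k.divNat‖| + (2 * P)⁻¹ * ‖p.2 k‖ ^ 2) with hf
  refine (mutualInfo_jointLaw_le (q := fun y => ENNReal.ofReal (radialDensity P y)) (f := f)
    hN one_pos (by fun_prop) (lintegral_radialDensity_le hP0) (by fun_prop)
    (fun p => Finset.sum_nonneg fun k _ => by positivity) ?_).trans ?_
  · intro x y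
    simp only [Nat.cast_one, div_one] at hC ⊢
    refine (lintegral_density_one_le hN hC₀ hC x y).trans ?_
    rw [hf, Real.exp_sum, ENNReal.ofReal_prod_of_nonneg fun _ _ => (Real.exp_pos _).le,
      ← Finset.prod_mul_distrib]
    refine Finset.prod_le_prod' fun k _ => ?_
    rw [← ENNReal.ofReal_mul (Real.exp_pos _).le]
    exact ENNReal.ofReal_le_ofReal (radialDensity_bound hP0 hcexp _ _)
  · have hfle : ∀ (x : Fin n → ℂ) (ω : Noise n 1), ENNReal.ofReal (f (x, output x ω)) ≤
        ∑ k : Fin (n * 1), (ENNReal.ofReal (c + 1 / 2 * Real.log P + 1) +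
          ENNReal.ofReal (‖ω.2.2 k‖ ^ 2) +
          ENNReal.ofReal (2 * P)⁻¹ * ENNReal.ofReal (‖output x ω k‖ ^ 2)) := by
      intro x ω
      rw [hf, ENNReal.ofReal_sum_of_nonneg fun k _ => by positivity]
      refine Finset.sum_le_sum fun k _ => ?_
      rw [← ENNReal.ofReal_mul (by positivity), ← ENNReal.ofReal_add (by positivity) (by positivity),
        ← ENNReal.ofReal_add (by positivity) (by positivity)]
      refine ENNReal.ofReal_le_ofReal ?_
      have h := norm_output_sub_le x ω k
      simp only [Nat.cast_one, div_one] at h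
      nlinarith [sq_nonneg (‖ω.2.2 k‖ - 1)]
    have hmk : ∀ k, Measurable fun p : (Fin n → ℂ) × Noise n 1 =>
        ENNReal.ofReal (‖output p.1 p.2 k‖ ^ 2) := fun k =>
      (by fun_prop : Measurable fun y : Fin (n * 1) → ℂ => ENNReal.ofReal (‖y k‖ ^ 2)).comp
        (measurable_output n 1).snd
    have hmk' : ∀ k, Measurable fun x : Fin n → ℂ =>
        ∫⁻ ω, ENNReal.ofReal (‖output x ω k‖ ^ 2) ∂(noiseLaw β noiseVar n 1) := fun k =>
      (hmk k).lintegral_prod_right'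
    calc ∫⁻ x, ∫⁻ ω, ENNReal.ofReal (f (x, output x ω)) ∂(noiseLaw β noiseVar n 1) ∂μ
        ≤ ∫⁻ x, ∑ k : Fin (n * 1), (ENNReal.ofReal (c + 1 / 2 * Real.log P + 1) +
            ENNReal.ofReal noiseVar + ENNReal.ofReal (2 * P)⁻¹ *
            ∫⁻ ω, ENNReal.ofReal (‖output x ω k‖ ^ 2) ∂(noiseLaw β noiseVar n 1)) ∂μ := by
          refine lintegral_mono fun x => ?_
          refine (lintegral_mono fun ω => hfle x ω).trans (le_of_eq ?_)
          rw [lintegral_finsetSum _ fun k _ => by fun_prop]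
          refine Finset.sum_congr rfl fun k _ => ?_
          rw [lintegral_add_left (by fun_prop), lintegral_add_left (by fun_prop), lintegral_const,
            measure_univ, mul_one, lintegral_const_mul _ (by fun_prop),
            lintegral_norm_sq_additiveNoise]
          simp
      _ = n * (ENNReal.ofReal (c + 1 / 2 * Real.log P + 1) + ENNReal.ofReal noiseVar) +
            ENNReal.ofReal (2 * P)⁻¹ * ∑ k : Fin (n * 1), ∫⁻ x,
              ∫⁻ ω, ENNReal.ofReal (‖output x ω k‖ ^ 2) ∂(noiseLaw β noiseVar n 1) ∂μ := by
          rw [lintegral_finsetSum _ fun k _ => by have := hmk' k; fun_prop, Finset.mul_sum]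
          have h1 : ∀ k : Fin (n * 1), ∫⁻ x, (ENNReal.ofReal (c + 1 / 2 * Real.log P + 1) +
              ENNReal.ofReal noiseVar + ENNReal.ofReal (2 * P)⁻¹ *
              ∫⁻ ω, ENNReal.ofReal (‖output x ω k‖ ^ 2) ∂(noiseLaw β noiseVar n 1)) ∂μ =
              (ENNReal.ofReal (c + 1 / 2 * Real.log P + 1) + ENNReal.ofReal noiseVar) +
                ENNReal.ofReal (2 * P)⁻¹ * ∫⁻ x, ∫⁻ ω, ENNReal.ofReal (‖output x ω k‖ ^ 2)
                  ∂(noiseLaw β noiseVar n 1) ∂μ := by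
            intro k
            rw [lintegral_add_left (by fun_prop), lintegral_const, measure_univ, mul_one,
              lintegral_const_mul _ (hmk' k)]
          simp_rw [h1]
          rw [Finset.sum_add_distrib, Finset.sum_const, Finset.card_univ, Fintype.card_fin,
            nsmul_eq_mul]
          simp only [Nat.mul_one]
      _ ≤ n * (ENNReal.ofReal (c + 1 / 2 * Real.log P + 1) + ENNReal.ofReal noiseVar) +
            ENNReal.ofReal (2 * P)⁻¹ * (n * (2 * ENNReal.ofReal P + 2 * ENNReal.ofReal noiseVar)) := by
          gcongr
          exact sum_lintegral_norm_output_sq_le one_pos hμ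
      _ = n * ENNReal.ofReal ((c + 1 / 2 * Real.log P + 1) + noiseVar +
            (2 * P)⁻¹ * (2 * P + 2 * noiseVar)) := by
          have hsplit : ∀ A : ℝ, 0 ≤ A →
              ENNReal.ofReal (A + noiseVar + (2 * P)⁻¹ * (2 * P + 2 * noiseVar)) =
                ENNReal.ofReal A + ENNReal.ofReal noiseVar +
                  ENNReal.ofReal (2 * P)⁻¹ * (2 * ENNReal.ofReal P + 2 * ENNReal.ofReal noiseVar) := by
            intro A hA
            rw [ENNReal.ofReal_add (by positivity) (by positivity), ENNReal.ofReal_add hA hN.le,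
              ENNReal.ofReal_mul (by positivity),
              ENNReal.ofReal_add (by positivity) (by positivity),
              ENNReal.ofReal_mul (by norm_num : (0 : ℝ) ≤ 2),
              ENNReal.ofReal_mul (by norm_num : (0 : ℝ) ≤ 2), ENNReal.ofReal_ofNat]
          rw [hsplit _ (by positivity)]
          ring
      _ ≤ _ := by
          refine mul_le_mul' le_rfl (ENNReal.ofReal_le_ofReal ?_)
          have h1 : (2 * P)⁻¹ * (2 * P + 2 * noiseVar) = 1 + P⁻¹ * noiseVar := by
            field_simp
          have h2 : P⁻¹ * noiseVar ≤ 1 * noiseVar := by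
            gcongr
            exact inv_le_one_of_one_le₀ hP
          rw [h1]
          linarith

theorem exists_capacity_one_le {β noiseVar : ℝ} (hβ : 0 < β) (hN : 0 < noiseVar) :
    ∃ C : ℝ, ∀ snr : ℝ, 1 ≤ snr * noiseVar →
      capacity β noiseVar 1 snr ≤ ENNReal.ofReal (1 / 2 * Real.log (snr * noiseVar) + C) := by
  obtain ⟨C, hC⟩ := exists_mutualInfo_one_le hβ hN
  refine ⟨C, fun snr hsnr => ?_⟩
  refine le_of_tendsto (tendsto_capacity hN one_pos snr).1 ?_
  filter_upwards [eventually_gt_atTop 0] with n hn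
  have hn0 : (n : ℝ≥0∞) ≠ 0 := by exact_mod_cast hn.ne'
  rw [blockRate, ENNReal.inv_mul_le_iff hn0 (ENNReal.natCast_ne_top n)]
  exact iSup₂_le fun μ hμ => hC _ n μ hsnr hμ

end OneSampleCapacity

/-! ### The input law and the decoding metric for the lower bound -/

section Metric

/-- The uniform law on `[P/2, P]`. -/
noncomputable def powerLaw (P : ℝ) : Measure ℝ := volume[|Set.Icc (P / 2) P]

/-- The law of an input symbol `√U e^{jΦ}` with independent `U` uniform on `[P/2, P]` and `Φ` uniform
on `[-π, π)`. -/
noncomputable def symbolLaw (P : ℝ) : Measure ℂ :=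
  ((powerLaw P).prod uniformPhase).map
    fun p => (√p.1 : ℂ) * Complex.exp (Complex.I * (p.2 : ℂ))

theorem isProbabilityMeasure_powerLaw {P : ℝ} (hP : 0 < P) : IsProbabilityMeasure (powerLaw P) := by
  refine cond_isProbabilityMeasure_of_finite ?_ ?_
  · simp only [Real.volume_Icc, ne_eq, ENNReal.ofReal_eq_zero, not_le]; linarith
  · simp [Real.volume_Icc]

theorem measurable_symbol :
    Measurable fun p : ℝ × ℝ => (√p.1 : ℂ) * Complex.exp (Complex.I * (p.2 : ℂ)) := by
  fun_prop

theorem isProbabilityMeasure_symbolLaw {P : ℝ} (hP : 0 < P) :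
    IsProbabilityMeasure (symbolLaw P) := by
  have := isProbabilityMeasure_powerLaw hP
  exact Measure.isProbabilityMeasure_map measurable_symbol.aemeasurable

theorem lintegral_powerLaw {P : ℝ} (hP : 0 < P) (F : ℝ → ℝ≥0∞) :
    ∫⁻ u, F u ∂(powerLaw P) = ENNReal.ofReal (2 / P) * ∫⁻ u in Set.Icc (P / 2) P, F u := by
  rw [powerLaw, ProbabilityTheory.cond, lintegral_smul_measure, Real.volume_Icc, smul_eq_mul,
    ← ENNReal.ofReal_inv_of_pos (by linarith)]
  congr 2
  field_simp
  ring

theorem lintegral_symbolLaw {P : ℝ} (hP : 0 < P) {F : ℂ → ℝ≥0∞} (hF : Measurable F) :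
    ∫⁻ x, F x ∂(symbolLaw P) = ENNReal.ofReal (2 / P) * ∫⁻ u in Set.Icc (P / 2) P,
      ∫⁻ φ, F ((√u : ℂ) * Complex.exp (Complex.I * (φ : ℝ))) ∂uniformPhase := by
  have := isProbabilityMeasure_powerLaw hP
  have hm := hF.comp measurable_symbol
  simp only [Function.comp_def] at hm
  rw [symbolLaw, lintegral_map hF measurable_symbol, lintegral_prod _ hm.aemeasurable,
    lintegral_powerLaw hP]

theorem ae_symbolLaw {P : ℝ} (hP : 0 < P) :
    ∀ᵐ x ∂(symbolLaw P), ‖x‖ ^ 2 ∈ Set.Icc (P / 2) P := by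
  have := isProbabilityMeasure_powerLaw hP
  have hset : MeasurableSet {x : ℂ | ‖x‖ ^ 2 ∈ Set.Icc (P / 2) P} :=
    (by fun_prop : Measurable fun x : ℂ => ‖x‖ ^ 2) measurableSet_Icc
  rw [symbolLaw, ae_map_iff measurable_symbol.aemeasurable hset]
  have h : ∀ᵐ u ∂(powerLaw P), u ∈ Set.Icc (P / 2) P := ae_cond_mem measurableSet_Icc
  have h' : ∀ᵐ p ∂((powerLaw P).prod uniformPhase), p.1 ∈ Set.Icc (P / 2) P :=
    Measure.quasiMeasurePreserving_fst.ae h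
  filter_upwards [h'] with p hp
  have h0 : 0 ≤ p.1 := le_trans (by linarith) hp.1
  rw [norm_mul, norm_exp_I_mul, mul_one, Complex.norm_real, Real.norm_of_nonneg (Real.sqrt_nonneg _),
    Real.sq_sqrt h0]
  exact hp

/-- The squared error of an estimate `T` of the power `|x|²`, in units of its typical variance. -/
noncomputable def powerPenalty (noiseVar P T : ℝ) (x : ℂ) : ℝ :=
  (2 * noiseVar * P)⁻¹ * (‖x‖ ^ 2 - T) ^ 2

/-- The squared distance between the observed direction of the first sample `y` of a symbol `x` and
the direction predicted from the last sample `y'` of the preceding symbol `x'`, weighted with the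
precision `κ`. -/
noncomputable def phasePenalty (κ : ℝ) (L : ℕ) (y' y x' x : ℂ) : ℝ :=
  κ * ‖y * L / ‖x‖ - Complex.exp (Complex.I * (Complex.arg (y' / x') : ℝ)) * (x / ‖x‖)‖ ^ 2

theorem powerPenalty_nonneg {noiseVar P : ℝ} (hN : 0 < noiseVar) (hP : 0 < P) (T : ℝ) (x : ℂ) :
    0 ≤ powerPenalty noiseVar P T x := by
  unfold powerPenalty; positivity

theorem phasePenalty_nonneg {κ : ℝ} (hκ : 0 < κ) (L : ℕ) (y' y x' x : ℂ) :
    0 ≤ phasePenalty κ L y' y x' x := by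
  unfold phasePenalty; positivity

theorem measurable_phasePenalty {α : Type*} [MeasurableSpace α] (κ : ℝ) (L : ℕ)
    {y' y x' x : α → ℂ} (hy' : Measurable y') (hy : Measurable y) (hx' : Measurable x')
    (hx : Measurable x) :
    Measurable fun a => phasePenalty κ L (y' a) (y a) (x' a) (x a) := by
  unfold phasePenalty
  have h : Measurable fun a => Complex.arg (y' a / x' a) :=
    Complex.measurable_arg.comp (hy'.div hx')
  fun_prop

/-- The normalization of the decoding metric: the first two terms are the information carried by the
modulus and by the phase, up to the penalties. -/
noncomputable def metricConst (noiseVar P κ : ℝ) : ℝ :=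
  1 / 2 * Real.log P + 1 / 2 * Real.log κ - Real.log (4 * √(2 * Real.pi * noiseVar))

/-- `metricConst` is the logarithm of the inverse of the product of the density `2 / P` of `|x|²` and the
two widths in `lintegral_metric_le_one`. -/
theorem exp_metricConst {noiseVar P κ : ℝ} (hN : 0 < noiseVar) (hP : 0 < P) (hκ : 0 < κ) :
    Real.exp (metricConst noiseVar P κ) * (2 / P * (√(2 * Real.pi * noiseVar * P) * (2 / √κ))) = 1 := by
  have hpi := Real.pi_pos
  have hs : ∀ t : ℝ, 0 < t → Real.exp (1 / 2 * Real.log t) = √t := fun t ht => by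
    rw [Real.sqrt_eq_rpow, Real.rpow_def_of_pos ht, mul_comm]
  rw [metricConst, Real.exp_sub, Real.exp_add, hs P hP, hs κ hκ, Real.exp_log (by positivity),
    Real.sqrt_mul (by positivity) P]
  have h1 : 0 < √P := Real.sqrt_pos.2 hP
  have h2 : 0 < √κ := Real.sqrt_pos.2 hκ
  have h3 : √P * √P = P := Real.mul_self_sqrt hP.le
  field_simp
  nlinarith

/-- The power penalty integrates over `|x|²`, which has density `2 / P`, to a width of order `√P`, and the
phase penalty integrates over the uniform phase to a width of order `1 / √κ`. -/
theorem lintegral_metric_le_one {noiseVar P κ : ℝ} (hN : 0 < noiseVar) (hP : 0 < P) (hκ : 0 < κ)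
    (L : ℕ) (T : ℝ) (y' y x' : ℂ) :
    ∫⁻ x, ENNReal.ofReal (Real.exp (metricConst noiseVar P κ -
      (powerPenalty noiseVar P T x + phasePenalty κ L y' y x' x))) ∂(symbolLaw P) ≤ 1 := by
  have hpi := Real.pi_pos
  have hmph : Measurable fun x => phasePenalty κ L y' y x' x :=
    measurable_phasePenalty κ L measurable_const measurable_const measurable_const measurable_id
  have hmpw : Measurable fun x => powerPenalty noiseVar P T x := by
    unfold powerPenalty; fun_prop
  set c := metricConst noiseVar P κ with hc
  rw [lintegral_symbolLaw hP (by fun_prop)]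
  have hinner : ∀ u ∈ Set.Icc (P / 2) P,
      ∫⁻ φ, ENNReal.ofReal (Real.exp (c - (powerPenalty noiseVar P T
        ((√u : ℂ) * Complex.exp (Complex.I * (φ : ℝ))) + phasePenalty κ L y' y x'
        ((√u : ℂ) * Complex.exp (Complex.I * (φ : ℝ)))))) ∂uniformPhase ≤
      ENNReal.ofReal (Real.exp c * (2 / √κ)) *
        ENNReal.ofReal (Real.exp (-(2 * noiseVar * P)⁻¹ * (u + -T) ^ 2)) := by
    intro u hu
    have hu0 : 0 < u := lt_of_lt_of_le (by linarith) hu.1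
    have hsu : 0 < √u := Real.sqrt_pos.2 hu0
    set e := Complex.exp (Complex.I * (Complex.arg (y' / x') : ℝ)) with he
    have he0 : e ≠ 0 := Complex.exp_ne_zero _
    have he1 : ‖e‖ = 1 := norm_exp_I_mul _
    have hpt : ∀ φ : ℝ, ENNReal.ofReal (Real.exp (c - (powerPenalty noiseVar P T
        ((√u : ℂ) * Complex.exp (Complex.I * (φ : ℝ))) + phasePenalty κ L y' y x'
        ((√u : ℂ) * Complex.exp (Complex.I * (φ : ℝ)))))) =
        ENNReal.ofReal (Real.exp c * Real.exp (-(2 * noiseVar * P)⁻¹ * (u + -T) ^ 2)) *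
        ENNReal.ofReal (Real.exp (-(κ * ‖y * L / (√u : ℂ) -
          e * Complex.exp (Complex.I * (φ : ℝ))‖ ^ 2))) := by
      intro φ
      have hn : ‖(√u : ℂ) * Complex.exp (Complex.I * (φ : ℝ))‖ = √u := by
        rw [norm_mul, norm_exp_I_mul, mul_one, Complex.norm_real, Real.norm_of_nonneg hsu.le]
      rw [powerPenalty, phasePenalty, hn, Real.sq_sqrt hu0.le, ← ENNReal.ofReal_mul (by positivity),
        ← Real.exp_add, ← Real.exp_add]
      have hsu' : (√u : ℂ) ≠ 0 := by exact_mod_cast hsu.ne'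
      rw [mul_div_cancel_left₀ _ hsu', ← he]
      congr 2
      ring
    simp_rw [hpt]
    rw [lintegral_const_mul _ (by fun_prop)]
    calc _ ≤ ENNReal.ofReal (Real.exp c * Real.exp (-(2 * noiseVar * P)⁻¹ * (u + -T) ^ 2)) *
          ENNReal.ofReal (2 / (√κ * ‖e‖)) := by
          gcongr
          exact lintegral_circle_gaussian_le hκ _ he0
      _ = _ := by
          rw [he1, mul_one, ← ENNReal.ofReal_mul (by positivity),
            ← ENNReal.ofReal_mul (by positivity)]
          congr 1; ring
  calc _ ≤ ENNReal.ofReal (2 / P) * ∫⁻ u in Set.Icc (P / 2) P,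
        ENNReal.ofReal (Real.exp c * (2 / √κ)) *
        ENNReal.ofReal (Real.exp (-(2 * noiseVar * P)⁻¹ * (u + -T) ^ 2)) := by
        exact mul_le_mul' le_rfl (setLIntegral_mono (by fun_prop) hinner)
    _ ≤ ENNReal.ofReal (2 / P) * ∫⁻ u, ENNReal.ofReal (Real.exp c * (2 / √κ)) *
        ENNReal.ofReal (Real.exp (-(2 * noiseVar * P)⁻¹ * (u + -T) ^ 2)) := by
        exact mul_le_mul' le_rfl (setLIntegral_le_lintegral _ _)
    _ = ENNReal.ofReal (Real.exp c * (2 / P * (√(2 * Real.pi * noiseVar * P) * (2 / √κ)))) := by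
        rw [lintegral_const_mul _ (by fun_prop),
          lintegral_exp_neg_mul_sq (inv_pos.2 (by positivity)), ← ENNReal.ofReal_mul (by positivity),
          ← ENNReal.ofReal_mul (by positivity)]
        have : Real.pi / (2 * noiseVar * P)⁻¹ = 2 * Real.pi * noiseVar * P := by
          rw [div_inv_eq_mul]; ring
        rw [this]
        congr 1; ring
    _ = 1 := by rw [exp_metricConst hN hP hκ, ENNReal.ofReal_one]

end Metric

/-! ### The penalties of the decoding metric -/

section Penalty

variable {n L : ℕ}

/-- The fourth moment of the standard Gaussian law. -/
noncomputable def gaussianFourthMoment : ℝ := ∫ x, x ^ 4 ∂(gaussianReal 0 1)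

theorem gaussianFourthMoment_nonneg : 0 ≤ gaussianFourthMoment :=
  integral_nonneg fun x => by positivity

/-- The noise-dependent part of `ℓ |b + z|²`, with `c = ℓ b`. -/
noncomputable def noisePower (c : ℂ) (ℓ : ℝ) (z : ℂ) : ℝ :=
  2 * (c.re * z.re + c.im * z.im) + ℓ * ‖z‖ ^ 2

@[fun_prop]
theorem measurable_noisePower (c : ℂ) (ℓ : ℝ) : Measurable (noisePower c ℓ) := by
  unfold noisePower; fun_prop

theorem integral_noisePower (c : ℂ) (ℓ : ℝ) (s : ℝ≥0) :
    ∫ z, noisePower c ℓ z ∂(complexGaussian s) = ℓ * s := by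
  unfold noisePower
  have h1 := (integrable_re_complexGaussian s).const_mul c.re
  have h2 := (integrable_im_complexGaussian s).const_mul c.im
  have h12 : Integrable (fun z : ℂ => 2 * (c.re * z.re + c.im * z.im)) (complexGaussian s) :=
    (h1.add h2).const_mul 2
  rw [integral_add h12 ((integrable_norm_sq_complexGaussian s).const_mul ℓ),
    integral_const_mul, integral_add h1 h2, integral_const_mul, integral_const_mul,
    integral_const_mul, integral_re_complexGaussian, integral_im_complexGaussian,
    integral_norm_sq_complexGaussian]
  ring

theorem noisePower_sq_le (c : ℂ) (ℓ : ℝ) (z : ℂ) :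
    noisePower c ℓ z ^ 2 ≤ 8 * ‖c‖ ^ 2 * ‖z‖ ^ 2 + 2 * ℓ ^ 2 * ‖z‖ ^ 4 := by
  have h1 : ‖c‖ ^ 2 = c.re ^ 2 + c.im ^ 2 := by
    rw [← Complex.normSq_eq_norm_sq, Complex.normSq_apply]; ring
  have h2 : ‖z‖ ^ 2 = z.re ^ 2 + z.im ^ 2 := by
    rw [← Complex.normSq_eq_norm_sq, Complex.normSq_apply]; ring
  have h3 : (c.re * z.re + c.im * z.im) ^ 2 ≤ ‖c‖ ^ 2 * ‖z‖ ^ 2 := by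
    rw [h1, h2]; nlinarith [sq_nonneg (c.re * z.im - c.im * z.re)]
  have h4 : ‖z‖ ^ 4 = (‖z‖ ^ 2) ^ 2 := by ring
  rw [noisePower, h4]
  nlinarith [sq_nonneg (2 * (c.re * z.re + c.im * z.im) - ℓ * ‖z‖ ^ 2)]

theorem integrable_noisePower_bound (c : ℂ) (ℓ : ℝ) (s : ℝ≥0) :
    Integrable (fun z => 8 * ‖c‖ ^ 2 * ‖z‖ ^ 2 + 2 * ℓ ^ 2 * ‖z‖ ^ 4) (complexGaussian s) :=
  ((integrable_norm_sq_complexGaussian s).const_mul (8 * ‖c‖ ^ 2)).add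
    ((integrable_norm_pow_four_complexGaussian s).const_mul (2 * ℓ ^ 2))

theorem memLp_noisePower (c : ℂ) (ℓ : ℝ) (s : ℝ≥0) :
    MemLp (noisePower c ℓ) 2 (complexGaussian s) := by
  rw [memLp_two_iff_integrable_sq (by fun_prop)]
  refine (integrable_noisePower_bound c ℓ s).mono' (by fun_prop) (ae_of_all _ fun z => ?_)
  rw [Real.norm_of_nonneg (sq_nonneg _)]
  exact noisePower_sq_le c ℓ z

theorem variance_noisePower_le (c : ℂ) (ℓ : ℝ) (s : ℝ≥0) :
    Var[noisePower c ℓ; complexGaussian s] ≤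
      8 * ‖c‖ ^ 2 * s + 2 * ℓ ^ 2 * (s ^ 2 * gaussianFourthMoment) := by
  refine (variance_le_expectation_sq (by fun_prop)).trans ?_
  have h := integral_mono ((memLp_noisePower c ℓ s).integrable_sq)
    (integrable_noisePower_bound c ℓ s) (noisePower_sq_le c ℓ)
  refine (le_of_eq rfl).trans (h.trans ?_)
  rw [integral_add ((integrable_norm_sq_complexGaussian s).const_mul (8 * ‖c‖ ^ 2))
    ((integrable_norm_pow_four_complexGaussian s).const_mul (2 * ℓ ^ 2)), integral_const_mul,
    integral_const_mul, integral_norm_sq_complexGaussian]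
  gcongr
  exact integral_norm_pow_four_complexGaussian_le s

/-- The estimate of the power `|x_k|²` from the energy of the samples of symbol `k`. -/
noncomputable def powerEstimate (noiseVar : ℝ) (y : Fin (n * L) → ℂ) (k : Fin n) : ℝ :=
  L * ∑ i : Fin (n * L), (if i.divNat = k then ‖y i‖ ^ 2 else 0) - L * noiseVar

theorem measurable_powerEstimate (noiseVar : ℝ) (k : Fin n) :
    Measurable fun y : Fin (n * L) → ℂ => powerEstimate noiseVar y k := by
  unfold powerEstimate
  refine Measurable.sub_const (Measurable.const_mul (Finset.measurable_sum _ fun i _ => ?_) _) _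
  split_ifs <;> fun_prop

theorem norm_noiseless_output (x : Fin n → ℂ) (θ : ℝ) (W : Fin (n * L) → ℝ) (k : Fin (n * L)) :
    ‖output x (θ, W, 0) k‖ = ‖x k.divNat‖ / L := by
  have h := norm_output_sub_le x ((θ, W, 0) : Noise n L) k
  simp only [Pi.zero_apply, norm_zero, abs_nonpos_iff] at h
  linarith

theorem mul_norm_add_sq (ℓ : ℝ) (b z : ℂ) :
    ℓ * ‖b + z‖ ^ 2 = ℓ * ‖b‖ ^ 2 + noisePower (ℓ * b) ℓ z := by
  rw [noisePower, ← Complex.normSq_eq_norm_sq, ← Complex.normSq_eq_norm_sq,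
    ← Complex.normSq_eq_norm_sq, Complex.normSq_apply, Complex.normSq_apply, Complex.normSq_apply]
  simp only [Complex.add_re, Complex.add_im, Complex.re_ofReal_mul, Complex.im_ofReal_mul]
  ring

theorem sum_ite_divNat (k : Fin n) (a : ℝ) :
    ∑ i : Fin (n * L), (if i.divNat = k then a else 0) = L * a := by
  rw [sum_divNat (fun m => if m = k then a else 0)]
  simp

/-- The noise energy in the power estimate has fluctuations of variance `O(L)`, and its
interference with the signal contributes a variance of order `|x_k|²`. -/
theorem lintegral_powerEstimate_le {noiseVar : ℝ} (hN : 0 < noiseVar) (hL : 0 < L) (x : Fin n → ℂ)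
    (k : Fin n) (θ : ℝ) (W : Fin (n * L) → ℝ) :
    ∫⁻ N, ENNReal.ofReal ((‖x k‖ ^ 2 - powerEstimate noiseVar (output x (θ, W, N)) k) ^ 2)
        ∂(Measure.pi fun _ : Fin (n * L) => complexGaussian (noiseVar / L).toNNReal) ≤
      ENNReal.ofReal (8 * ‖x k‖ ^ 2 * noiseVar + 2 * L * noiseVar ^ 2 * gaussianFourthMoment) := by
  have hL' : (0 : ℝ) < L := by exact_mod_cast hL
  have hs : (((noiseVar / L).toNNReal : ℝ≥0) : ℝ) = noiseVar / L :=
    Real.coe_toNNReal _ (by positivity)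
  set s := (noiseVar / L).toNNReal with hsdef
  set b : Fin (n * L) → ℂ := output x (θ, W, 0) with hb
  set X : Fin (n * L) → ℂ → ℝ := fun i z =>
    if i.divNat = k then noisePower ((L : ℝ) * b i) L z else 0 with hX
  have hXmem : ∀ i, MemLp (X i) 2 (complexGaussian s) := by
    intro i
    by_cases h : i.divNat = k
    · simp only [hX, h, if_true]; exact memLp_noisePower _ _ _
    · simp only [hX, h, if_false]; exact MemLp.zero
  set S : (Fin (n * L) → ℂ) → ℝ := ∑ i, fun N => X i (N i) with hS
  set μN := Measure.pi fun _ : Fin (n * L) => complexGaussian s with hμN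
  have hSmem : MemLp S 2 μN := by
    refine memLp_finsetSum' _ fun i _ => ?_
    exact (hXmem i).comp_measurePreserving
      (measurePreserving_eval (fun _ : Fin (n * L) => complexGaussian s) i)
  have hbn : ∀ i, ‖b i‖ = ‖x i.divNat‖ / L := fun i => norm_noiseless_output x θ W i
  have hmean : ∫ N, S N ∂μN = L * noiseVar := by
    have h1 : ∀ i, ∫ N, X i (N i) ∂μN = if i.divNat = k then noiseVar else 0 := by
      intro i
      rw [hμN, integral_comp_eval (μ := fun _ : Fin (n * L) => complexGaussian s) (f := X i)
        (hXmem i).1]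
      by_cases h : i.divNat = k
      · simp only [hX, h, if_true]
        rw [integral_noisePower, hs]
        field_simp
      · simp [hX, h]
    simp only [hS, Finset.sum_apply]
    rw [integral_finsetSum _ fun i _ => ?_, Finset.sum_congr rfl fun i _ => h1 i, sum_ite_divNat]
    exact ((hXmem i).comp_measurePreserving
      (measurePreserving_eval (fun _ : Fin (n * L) => complexGaussian s) i)).integrable one_le_two
  have hT : ∀ N, powerEstimate noiseVar (output x (θ, W, N)) k =
      ‖x k‖ ^ 2 + (S N - L * noiseVar) := by
    intro N
    have h1 : ∀ i : Fin (n * L), L * (if i.divNat = k then ‖output x (θ, W, N) i‖ ^ 2 else 0) =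
        (if i.divNat = k then (‖x k‖ ^ 2 / L) else 0) + X i (N i) := by
      intro i
      by_cases h : i.divNat = k
      · simp only [hX, h, if_true]
        rw [output_eq_add, Pi.add_apply, ← hb, mul_norm_add_sq, hbn, h]
        congr 1
        field_simp
      · simp [hX, h]
    rw [powerEstimate, Finset.mul_sum, Finset.sum_congr rfl fun i _ => h1 i,
      Finset.sum_add_distrib, sum_ite_divNat]
    simp only [hS, Finset.sum_apply]
    field_simp
    ring
  have hvar : Var[S; μN] ≤ 8 * ‖x k‖ ^ 2 * noiseVar + 2 * L * noiseVar ^ 2 * gaussianFourthMoment := by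
    rw [hS, hμN, variance_sum_pi hXmem]
    calc _ ≤ ∑ i : Fin (n * L), (if i.divNat = k then (8 * ‖x k‖ ^ 2 * (noiseVar / L) +
          2 * L ^ 2 * ((noiseVar / L) ^ 2 * gaussianFourthMoment)) else 0) := by
          refine Finset.sum_le_sum fun i _ => ?_
          by_cases h : i.divNat = k
          · simp only [hX, h, if_true]
            refine (variance_noisePower_le _ _ _).trans (le_of_eq ?_)
            rw [hs, norm_mul, Complex.norm_real, Real.norm_of_nonneg hL'.le, hbn, h]
            congr 3
            field_simp
          · simp only [hX, h, if_false]
            exact (variance_zero (μ := complexGaussian s)).le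
      _ = _ := by
          rw [sum_ite_divNat]
          field_simp
  calc _ = ∫⁻ N, ENNReal.ofReal ((S N - ∫ N, S N ∂μN) ^ 2) ∂μN := by
        refine lintegral_congr fun N => ?_
        rw [hT, hmean]
        congr 1; ring
    _ = eVar[S; μN] := (evariance_eq_lintegral_ofReal _ _).symm
    _ = ENNReal.ofReal (Var[S; μN]) := (ofReal_variance hSmem).symm
    _ ≤ _ := ENNReal.ofReal_le_ofReal hvar

/-- The first sample of symbol `k`. -/
def firstSample (hL : 0 < L) (k : Fin n) : Fin (n * L) :=
  ⟨k * L, Nat.mul_lt_mul_of_pos_right k.2 hL⟩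

/-- The last sample before symbol `k`; for the first symbol, by convention, the first sample. -/
def previousSample (hL : 0 < L) (k : Fin n) : Fin (n * L) :=
  ⟨k * L - 1, (Nat.sub_le _ _).trans_lt (Nat.mul_lt_mul_of_pos_right k.2 hL)⟩

theorem divNat_firstSample (hL : 0 < L) (k : Fin n) : (firstSample hL k).divNat = k := by
  ext; simp [firstSample, hL]

theorem divNat_previousSample (hL : 0 < L) (k : Fin n) (hk : k.val ≠ 0) :
    (previousSample hL k).divNat = ⟨k - 1, (Nat.sub_le _ _).trans_lt k.2⟩ := by
  ext
  simp only [previousSample, Fin.coe_divNat]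
  obtain ⟨j, hj⟩ := Nat.exists_eq_succ_of_ne_zero hk
  rw [hj, Nat.succ_sub_one, Nat.div_eq_iff hL, Nat.succ_mul]
  omega

theorem phase_firstSample (hL : 0 < L) (k : Fin n) (hk : k.val ≠ 0) (ω : Noise n L) :
    phase ω (firstSample hL k) =
      phase ω (previousSample hL k) + ω.2.1 (previousSample hL k) := by
  have hpos : 0 < k.val * L := Nat.mul_pos (Nat.pos_of_ne_zero hk) hL
  have h : Finset.Iio (firstSample hL k) =
      insert (previousSample hL k) (Finset.Iio (previousSample hL k)) := by
    ext i
    simp only [firstSample, previousSample, Finset.mem_Iio, Finset.mem_insert, Fin.lt_def, Fin.ext_iff]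
    omega
  rw [phase, phase, h, Finset.sum_insert (by simp)]
  ring

/-- The direction of `a` is at most twice as far from a point of the unit circle as `a` itself. -/
theorem norm_sub_exp_arg_le (a : ℂ) (θ : ℝ) :
    ‖Complex.exp (Complex.I * (θ : ℂ)) - Complex.exp (Complex.I * (a.arg : ℂ))‖ ≤
      2 * ‖a - Complex.exp (Complex.I * (θ : ℂ))‖ := by
  set E := Complex.exp (Complex.I * (θ : ℂ)) with hE
  have h1 : ‖a - Complex.exp (Complex.I * (a.arg : ℂ))‖ = |‖a‖ - 1| := by
    have : a - Complex.exp (Complex.I * (a.arg : ℂ)) =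
        ((‖a‖ - 1 : ℝ) : ℂ) * Complex.exp (Complex.I * (a.arg : ℂ)) := by
      have h0 := Complex.norm_mul_exp_arg_mul_I a
      rw [mul_comm] at h0
      rw [mul_comm Complex.I]
      push_cast
      linear_combination -h0
    rw [this, norm_mul, norm_exp_I_mul, mul_one, Complex.norm_real, Real.norm_eq_abs]
  have h2 : |‖a‖ - 1| ≤ ‖a - E‖ := by
    have := abs_norm_sub_norm_le a E
    rwa [hE, norm_exp_I_mul] at this
  calc _ ≤ ‖E - a‖ + ‖a - Complex.exp (Complex.I * (a.arg : ℂ))‖ := norm_sub_le_norm_sub_add_norm_sub _ _ _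
    _ ≤ _ := by rw [h1, norm_sub_rev]; linarith

theorem norm_exp_sub_exp_le (θ w : ℝ) :
    ‖Complex.exp (Complex.I * ((θ + w : ℝ) : ℂ)) - Complex.exp (Complex.I * (θ : ℂ))‖ ≤ |w| := by
  have : Complex.exp (Complex.I * ((θ + w : ℝ) : ℂ)) - Complex.exp (Complex.I * (θ : ℂ)) =
      Complex.exp (Complex.I * (θ : ℂ)) * (Complex.exp (Complex.I * (w : ℂ)) - 1) := by
    push_cast
    rw [mul_add, Complex.exp_add]; ring
  rw [this, norm_mul, norm_exp_I_mul, one_mul]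
  exact Real.norm_exp_I_mul_ofReal_sub_one_le

/-- The phase penalty at the actual input is controlled by the phase increment `w` between the two
samples and by their additive noises. -/
theorem phasePenalty_le {κ : ℝ} (hκ : 0 < κ) (hL : 0 < L) {x x' : ℂ} (hx : x ≠ 0) (hx' : x' ≠ 0)
    (θ w : ℝ) (N N' : ℂ) :
    phasePenalty κ L (x' * (1 / (L : ℂ)) * Complex.exp (Complex.I * (θ : ℂ)) + N')
        (x * (1 / (L : ℂ)) * Complex.exp (Complex.I * ((θ + w : ℝ) : ℂ)) + N) x' x ≤
      κ * (3 * w ^ 2 + 3 * (L ^ 2 * ‖N‖ ^ 2 / ‖x‖ ^ 2) + 12 * (L ^ 2 * ‖N'‖ ^ 2 / ‖x'‖ ^ 2)) := by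
  have hL' : (0 : ℝ) < L := by exact_mod_cast hL
  have hLc : (L : ℂ) ≠ 0 := by exact_mod_cast hL.ne'
  have hnx : 0 < ‖x‖ := norm_pos_iff.2 hx
  have hnx' : 0 < ‖x'‖ := norm_pos_iff.2 hx'
  have hnxc : (‖x‖ : ℂ) ≠ 0 := by exact_mod_cast hnx.ne'
  set E := Complex.exp (Complex.I * (θ : ℂ)) with hE
  set E' := Complex.exp (Complex.I * ((θ + w : ℝ) : ℂ)) with hE'
  set a := E + N' * L / x' with ha
  set e := Complex.exp (Complex.I * (a.arg : ℂ)) with he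
  set u := x / ‖x‖ with hu
  have hun : ‖u‖ = 1 := by
    rw [hu, norm_div, Complex.norm_real, norm_norm, div_self hnx.ne']
  have harg : Complex.arg ((x' * (1 / (L : ℂ)) * E + N') / x') = a.arg := by
    have : (x' * (1 / (L : ℂ)) * E + N') / x' = ((1 / L : ℝ) : ℂ) * a := by
      rw [ha]; push_cast; field_simp
    rw [this, Complex.arg_real_mul _ (by positivity)]
  have hdec : (x * (1 / (L : ℂ)) * E' + N) * L / ‖x‖ - e * u =
      u * (E' - E) + N * L / ‖x‖ + u * (E - e) := by
    rw [hu]; field_simp; ring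
  have h1 : ‖E' - E‖ ≤ |w| := norm_exp_sub_exp_le θ w
  have h2 : ‖N * L / ‖x‖‖ = L * ‖N‖ / ‖x‖ := by
    rw [norm_div, norm_mul, Complex.norm_natCast, Complex.norm_real, norm_norm, mul_comm]
  have h3 : ‖E - e‖ ≤ 2 * (L * ‖N'‖ / ‖x'‖) := by
    refine (norm_sub_exp_arg_le a θ).trans (le_of_eq ?_)
    rw [← hE, ha, add_sub_cancel_left, norm_div, norm_mul, Complex.norm_natCast, mul_comm (‖N'‖)]
  have h4 : ‖u * (E' - E) + N * L / ‖x‖ + u * (E - e)‖ ≤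
      |w| + L * ‖N‖ / ‖x‖ + 2 * (L * ‖N'‖ / ‖x'‖) := by
    refine (norm_add₃_le).trans ?_
    rw [norm_mul, norm_mul, hun, one_mul, one_mul, h2]
    linarith
  rw [phasePenalty, harg, ← he, ← hu, hdec]
  refine mul_le_mul_of_nonneg_left ?_ hκ.le
  refine (pow_le_pow_left₀ (norm_nonneg _) h4 2).trans ?_
  rw [← sq_abs w, ← mul_pow, ← mul_pow, ← div_pow, ← div_pow]
  generalize |w| = p
  generalize L * ‖N‖ / ‖x‖ = q
  generalize L * ‖N'‖ / ‖x'‖ = r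
  nlinarith [sq_nonneg (p - q), sq_nonneg (p - 2 * r), sq_nonneg (q - 2 * r)]

/-- A bound for the first symbol, which has no preceding sample to predict its phase from. -/
theorem phasePenalty_le_crude {κ : ℝ} (hκ : 0 < κ) (hL : 0 < L) {x : ℂ} (hx : x ≠ 0) (x' y' : ℂ)
    (θ : ℝ) (N : ℂ) :
    phasePenalty κ L y' (x * (1 / (L : ℂ)) * Complex.exp (Complex.I * (θ : ℂ)) + N) x' x ≤
      κ * (8 + 2 * (L ^ 2 * ‖N‖ ^ 2 / ‖x‖ ^ 2)) := by
  have hLc : (L : ℂ) ≠ 0 := by exact_mod_cast hL.ne'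
  have hnx : 0 < ‖x‖ := norm_pos_iff.2 hx
  have hnxc : (‖x‖ : ℂ) ≠ 0 := by exact_mod_cast hnx.ne'
  set E := Complex.exp (Complex.I * (θ : ℂ)) with hE
  set e := Complex.exp (Complex.I * (Complex.arg (y' / x') : ℂ)) with he
  set u := x / ‖x‖ with hu
  have hun : ‖u‖ = 1 := by
    rw [hu, norm_div, Complex.norm_real, norm_norm, div_self hnx.ne']
  have hEn : ‖E‖ = 1 := norm_exp_I_mul θ
  have hen : ‖e‖ = 1 := norm_exp_I_mul _
  have hdec : (x * (1 / (L : ℂ)) * E + N) * L / ‖x‖ - e * u = u * E + N * L / ‖x‖ + -(e * u) := by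
    rw [hu]; field_simp; ring
  have h2 : ‖N * L / ‖x‖‖ = L * ‖N‖ / ‖x‖ := by
    rw [norm_div, norm_mul, Complex.norm_natCast, Complex.norm_real, norm_norm, mul_comm]
  have h4 : ‖u * E + N * L / ‖x‖ + -(e * u)‖ ≤ 2 + L * ‖N‖ / ‖x‖ := by
    refine (norm_add₃_le).trans ?_
    rw [norm_neg, norm_mul, norm_mul, hun, hEn, hen, h2]
    linarith
  rw [phasePenalty, ← he, ← hu, hdec]
  refine mul_le_mul_of_nonneg_left ?_ hκ.le
  refine (pow_le_pow_left₀ (norm_nonneg _) h4 2).trans ?_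
  rw [← mul_pow, ← div_pow]
  generalize L * ‖N‖ / ‖x‖ = q
  nlinarith [sq_nonneg (q - 2)]

end Penalty

/-! ### A lower bound on the capacity for every oversampling factor -/

section LowerBound

variable {n L : ℕ}

/-- The symbol that precedes symbol `k`; the first symbol is preceded, by convention, by `1`. -/
noncomputable def previousSymbol (x : Fin n → ℂ) (k : Fin n) : ℂ :=
  (Fin.cons 1 x : Fin (n + 1) → ℂ) k.castSucc

theorem previousSymbol_eq (x : Fin n → ℂ) (k : Fin n) (hk : k.val ≠ 0) :
    previousSymbol x k = x ⟨k - 1, (Nat.sub_le _ _).trans_lt k.2⟩ := by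
  have h : k.castSucc = Fin.succ ⟨k - 1, (Nat.sub_le _ _).trans_lt k.2⟩ := by
    ext; simp; omega
  rw [previousSymbol, h, Fin.cons_succ]

@[fun_prop]
theorem measurable_previousSymbol (k : Fin n) :
    Measurable fun x : Fin n → ℂ => previousSymbol x k := by
  by_cases hk : k.val = 0
  · have h : ∀ x : Fin n → ℂ, previousSymbol x k = 1 := by
      intro x
      obtain ⟨m, rfl⟩ : ∃ m, n = m + 1 := ⟨n - 1, by have := k.2; omega⟩
      obtain rfl : k = 0 := Fin.ext hk
      rfl
    simp_rw [h]
    exact measurable_const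
  · simp_rw [fun x : Fin n → ℂ => previousSymbol_eq x k hk]
    fun_prop

/-- The penalty of symbol `k` in the decoding metric. -/
noncomputable def symbolPenalty (noiseVar P κ : ℝ) (hL : 0 < L) (y : Fin (n * L) → ℂ) (k : Fin n)
    (x' x : ℂ) : ℝ :=
  powerPenalty noiseVar P (powerEstimate noiseVar y k) x +
    phasePenalty κ L (y (previousSample hL k)) (y (firstSample hL k)) x' x

theorem symbolPenalty_nonneg {noiseVar P κ : ℝ} (hN : 0 < noiseVar) (hP : 0 < P) (hκ : 0 < κ)
    (hL : 0 < L) (y : Fin (n * L) → ℂ) (k : Fin n) (x' x : ℂ) :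
    0 ≤ symbolPenalty noiseVar P κ hL y k x' x :=
  add_nonneg (powerPenalty_nonneg hN hP _ _) (phasePenalty_nonneg hκ _ _ _ _ _)

theorem measurable_symbolPenalty {α : Type*} [MeasurableSpace α] (noiseVar P κ : ℝ) (hL : 0 < L)
    (k : Fin n) {y : α → Fin (n * L) → ℂ} {x' x : α → ℂ} (hy : Measurable y) (hx' : Measurable x')
    (hx : Measurable x) :
    Measurable fun a => symbolPenalty noiseVar P κ hL (y a) k (x' a) (x a) := by
  unfold symbolPenalty
  refine Measurable.add ?_ ?_
  · unfold powerPenalty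
    have := (measurable_powerEstimate noiseVar k).comp hy
    simp only [Function.comp_def] at this
    fun_prop
  · exact measurable_phasePenalty κ L ((measurable_pi_apply _).comp hy)
      ((measurable_pi_apply _).comp hy) hx' hx

theorem lintegral_powerPenalty_le {noiseVar P : ℝ} (β : ℝ) (hN : 0 < noiseVar) (hP : 0 < P)
    (hL : 0 < L) {x : Fin n → ℂ} (k : Fin n) (hx : ‖x k‖ ^ 2 ≤ P) :
    ∫⁻ ω, ENNReal.ofReal (powerPenalty noiseVar P (powerEstimate noiseVar (output x ω) k) (x k))
        ∂(noiseLaw β noiseVar n L) ≤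
      ENNReal.ofReal (4 + L * gaussianFourthMoment * noiseVar / P) := by
  have hM := gaussianFourthMoment_nonneg
  have hm := (measurable_powerEstimate (L := L) noiseVar k).comp (measurable_output_left x)
  simp only [Function.comp_def] at hm
  rw [lintegral_noiseLaw _ _ (by unfold powerPenalty; fun_prop)]
  have hin : ∀ (θ : ℝ) (W : Fin (n * L) → ℝ),
      ∫⁻ N, ENNReal.ofReal (powerPenalty noiseVar P
          (powerEstimate noiseVar (output x ((θ, W, N) : Noise n L)) k) (x k))
        ∂(Measure.pi fun _ : Fin (n * L) => complexGaussian (noiseVar / L).toNNReal) ≤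
      ENNReal.ofReal (4 + L * gaussianFourthMoment * noiseVar / P) := by
    intro θ W
    simp_rw [powerPenalty, ENNReal.ofReal_mul (by positivity : 0 ≤ (2 * noiseVar * P)⁻¹)]
    rw [lintegral_const_mul' _ _ ENNReal.ofReal_ne_top]
    refine (mul_le_mul_right (lintegral_powerEstimate_le hN hL x k θ W) _).trans ?_
    rw [← ENNReal.ofReal_mul (by positivity)]
    refine ENNReal.ofReal_le_ofReal ?_
    have h : (2 * noiseVar * P)⁻¹ *
        (8 * ‖x k‖ ^ 2 * noiseVar + 2 * L * noiseVar ^ 2 * gaussianFourthMoment) =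
        4 * (‖x k‖ ^ 2 / P) + L * gaussianFourthMoment * noiseVar / P := by
      field_simp; ring
    rw [h]
    have := div_le_one_of_le₀ hx hP.le
    linarith
  calc _ ≤ ∫⁻ _ : ℝ, ∫⁻ _ : Fin (n * L) → ℝ,
        ENNReal.ofReal (4 + L * gaussianFourthMoment * noiseVar / P)
        ∂(Measure.pi fun _ : Fin (n * L) => gaussianReal 0 (2 * Real.pi * β / L).toNNReal)
        ∂uniformPhase := lintegral_mono fun θ => lintegral_mono fun W => hin θ W
    _ = _ := by simp

theorem phasePenalty_output_le {P κ : ℝ} (hP : 0 < P) (hκ : 0 < κ) (hL : 0 < L) {x : Fin n → ℂ}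
    (hx : ∀ m, P / 2 ≤ ‖x m‖ ^ 2) (k : Fin n) (ω : Noise n L) :
    phasePenalty κ L (output x ω (previousSample hL k)) (output x ω (firstSample hL k))
        (previousSymbol x k) (x k) ≤
      κ * (if k.val = 0 then 8 else 0) + (κ * 3) * ω.2.1 (previousSample hL k) ^ 2 +
        (κ * (6 * L ^ 2 / P)) * ‖ω.2.2 (firstSample hL k)‖ ^ 2 +
        (κ * (24 * L ^ 2 / P)) * ‖ω.2.2 (previousSample hL k)‖ ^ 2 := by
  have hpos : ∀ m, 0 < ‖x m‖ ^ 2 := fun m => lt_of_lt_of_le (by linarith) (hx m)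
  have hne : ∀ m, x m ≠ 0 := fun m h => by have := hpos m; simp [h] at this
  have hdiv : ∀ m (t : ℝ), 0 ≤ t → t / ‖x m‖ ^ 2 ≤ 2 * t / P := by
    intro m t ht
    rw [div_le_div_iff₀ (hpos m) hP]
    nlinarith [hx m]
  have h1 := hdiv k (L ^ 2 * ‖ω.2.2 (firstSample hL k)‖ ^ 2) (by positivity)
  have hq : 0 ≤ 24 * (L ^ 2 : ℝ) / P * ‖ω.2.2 (previousSample hL k)‖ ^ 2 := by positivity
  have hq' : 0 ≤ (L ^ 2 : ℝ) * ‖ω.2.2 (firstSample hL k)‖ ^ 2 / P := by positivity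
  by_cases hk : k.val = 0
  · have hy : output x ω (firstSample hL k) = x k * (1 / (L : ℂ)) *
        Complex.exp (Complex.I * (phase ω (firstSample hL k) : ℂ)) + ω.2.2 (firstSample hL k) := by
      rw [output, divNat_firstSample]
    rw [if_pos hk, hy]
    refine (phasePenalty_le_crude hκ hL (hne k) _ _ _ _).trans ?_
    have : 8 + 2 * (L ^ 2 * ‖ω.2.2 (firstSample hL k)‖ ^ 2 / ‖x k‖ ^ 2) ≤
        8 + 3 * ω.2.1 (previousSample hL k) ^ 2 +
          6 * L ^ 2 / P * ‖ω.2.2 (firstSample hL k)‖ ^ 2 +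
          24 * L ^ 2 / P * ‖ω.2.2 (previousSample hL k)‖ ^ 2 := by
      have h6 : 6 * (L ^ 2 : ℝ) / P * ‖ω.2.2 (firstSample hL k)‖ ^ 2 =
        6 * ((L ^ 2 : ℝ) * ‖ω.2.2 (firstSample hL k)‖ ^ 2 / P) := by ring
      rw [mul_div_assoc 2] at h1
      nlinarith [sq_nonneg (ω.2.1 (previousSample hL k))]
    refine (mul_le_mul_of_nonneg_left this hκ.le).trans (le_of_eq (by ring))
  · rw [if_neg hk, output, output, divNat_firstSample, divNat_previousSample hL k hk,
      previousSymbol_eq x k hk, phase_firstSample hL k hk ω]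
    refine (phasePenalty_le hκ hL (hne k) (hne _) _ _ _ _).trans ?_
    have h2 := hdiv ⟨k - 1, (Nat.sub_le _ _).trans_lt k.2⟩
      (L ^ 2 * ‖ω.2.2 (previousSample hL k)‖ ^ 2) (by positivity)
    refine (mul_le_mul_of_nonneg_left (add_le_add (add_le_add_right
      (mul_le_mul_of_nonneg_left h1 (by norm_num)) _)
      (mul_le_mul_of_nonneg_left h2 (by norm_num))) hκ.le).trans (le_of_eq (by ring))

theorem lintegral_phasePenalty_le {β noiseVar P κ : ℝ} (hβ : 0 < β) (hN : 0 < noiseVar) (hP : 0 < P)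
    (hκ : 0 < κ) (hL : 0 < L) {x : Fin n → ℂ} (hx : ∀ m, P / 2 ≤ ‖x m‖ ^ 2) (k : Fin n) :
    ∫⁻ ω, ENNReal.ofReal (phasePenalty κ L (output x ω (previousSample hL k))
        (output x ω (firstSample hL k)) (previousSymbol x k) (x k)) ∂(noiseLaw β noiseVar n L) ≤
      ENNReal.ofReal (κ * (if k.val = 0 then 8 else 0) +
        κ * (6 * Real.pi * β / L + 30 * L * noiseVar / P)) := by
  have hL' : (0 : ℝ) < L := by exact_mod_cast hL
  have hpi := Real.pi_pos
  have h0 : (0 : ℝ) ≤ κ * (if k.val = 0 then 8 else 0) := by split_ifs <;> positivity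
  have hW : ∫⁻ ω : Noise n L, ENNReal.ofReal (ω.2.1 (previousSample hL k) ^ 2)
      ∂(noiseLaw β noiseVar n L) = ENNReal.ofReal (2 * Real.pi * β / L) := by
    have hint : Integrable (fun w : ℝ => w ^ 2) (gaussianReal 0 (2 * Real.pi * β / L).toNNReal) :=
      integrable_pow_gaussianReal _ 2
    rw [(measurePreserving_phaseIncrement β noiseVar (previousSample hL k)).lintegral_comp
      (f := fun w => ENNReal.ofReal (w ^ 2)) (by fun_prop),
      ← ofReal_integral_eq_lintegral_ofReal hint (ae_of_all _ fun w => sq_nonneg w),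
      integral_sq_gaussianReal, Real.coe_toNNReal _ (by positivity)]
  calc _ ≤ ∫⁻ ω : Noise n L, (ENNReal.ofReal (κ * (if k.val = 0 then 8 else 0)) +
          ENNReal.ofReal (κ * 3) * ENNReal.ofReal (ω.2.1 (previousSample hL k) ^ 2) +
          ENNReal.ofReal (κ * (6 * L ^ 2 / P)) *
            ENNReal.ofReal (‖ω.2.2 (firstSample hL k)‖ ^ 2) +
          ENNReal.ofReal (κ * (24 * L ^ 2 / P)) *
            ENNReal.ofReal (‖ω.2.2 (previousSample hL k)‖ ^ 2)) ∂(noiseLaw β noiseVar n L) := by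
        refine lintegral_mono fun ω => ?_
        refine (ENNReal.ofReal_le_ofReal (phasePenalty_output_le hP hκ hL hx k ω)).trans ?_
        rw [ENNReal.ofReal_add (by positivity) (by positivity),
          ENNReal.ofReal_add (by positivity) (by positivity),
          ENNReal.ofReal_add h0 (by positivity),
          ENNReal.ofReal_mul (by positivity : 0 ≤ κ * 3),
          ENNReal.ofReal_mul (by positivity : 0 ≤ κ * (6 * (L : ℝ) ^ 2 / P)),
          ENNReal.ofReal_mul (by positivity : 0 ≤ κ * (24 * (L : ℝ) ^ 2 / P))]
    _ = ENNReal.ofReal (κ * (if k.val = 0 then 8 else 0)) +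
          ENNReal.ofReal (κ * 3) * ENNReal.ofReal (2 * Real.pi * β / L) +
          ENNReal.ofReal (κ * (6 * L ^ 2 / P)) * ENNReal.ofReal (noiseVar / L) +
          ENNReal.ofReal (κ * (24 * L ^ 2 / P)) * ENNReal.ofReal (noiseVar / L) := by
        rw [lintegral_add_right _ (by fun_prop), lintegral_add_right _ (by fun_prop),
          lintegral_add_right _ (by fun_prop), lintegral_const_mul _ (by fun_prop),
          lintegral_const_mul _ (by fun_prop), lintegral_const_mul _ (by fun_prop), hW,
          lintegral_norm_sq_additiveNoise, lintegral_norm_sq_additiveNoise]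
        simp
    _ = _ := by
        rw [← ENNReal.ofReal_mul (by positivity), ← ENNReal.ofReal_mul (by positivity),
          ← ENNReal.ofReal_mul (by positivity), ← ENNReal.ofReal_add h0 (by positivity),
          ← ENNReal.ofReal_add (by positivity) (by positivity),
          ← ENNReal.ofReal_add (by positivity) (by positivity)]
        congr 1
        field_simp
        ring

theorem pi_symbolLaw_mem_admissibleInputs {P : ℝ} (hP : 0 < P) (n : ℕ) :
    (Measure.pi fun _ : Fin n => symbolLaw P) ∈ admissibleInputs n P := by
  have := isProbabilityMeasure_symbolLaw hP
  refine ⟨inferInstance, ?_⟩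
  have h1 : ∀ m : Fin n, ∫⁻ x, ‖x m‖ₑ ^ 2 ∂(Measure.pi fun _ : Fin n => symbolLaw P) ≤
      ENNReal.ofReal P := by
    intro m
    rw [(measurePreserving_eval (fun _ : Fin n => symbolLaw P) m).lintegral_comp
      (f := fun z => ‖z‖ₑ ^ 2) (by fun_prop)]
    calc _ ≤ ∫⁻ _, ENNReal.ofReal P ∂(symbolLaw P) := by
          refine lintegral_mono_ae ?_
          filter_upwards [ae_symbolLaw hP] with z hz
          rw [← ofReal_norm, ← ENNReal.ofReal_pow (norm_nonneg _)]
          exact ENNReal.ofReal_le_ofReal hz.2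
      _ = _ := by simp
  calc _ ≤ (n : ℝ≥0∞)⁻¹ * ∑ _m : Fin n, ENNReal.ofReal P := by gcongr; exact h1 _
    _ = (n : ℝ≥0∞)⁻¹ * n * ENNReal.ofReal P := by simp [mul_assoc]
    _ ≤ 1 * ENNReal.ofReal P := by gcongr; exact ENNReal.inv_mul_le_one _
    _ = _ := one_mul _

/-- With independent inputs, the decoding metric is a normalized likelihood ratio for every output:
the penalty of a symbol involves the inputs only through this symbol and its predecessor. -/
theorem lintegral_exp_symbolPenalty_le_one {noiseVar P κ : ℝ} (hN : 0 < noiseVar) (hP : 0 < P)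
    (hκ : 0 < κ) (hL : 0 < L) (y : Fin (n * L) → ℂ) :
    ∫⁻ x, ENNReal.ofReal (Real.exp (n * metricConst noiseVar P κ -
        ∑ k, symbolPenalty noiseVar P κ hL y k (previousSymbol x k) (x k)))
      ∂(Measure.pi fun _ : Fin n => symbolLaw P) ≤ 1 := by
  have := isProbabilityMeasure_symbolLaw hP
  refine le_trans (le_of_eq (lintegral_congr fun x => ?_)) (lintegral_chain_le_one (symbolLaw P)
    (g := fun k x' x => ENNReal.ofReal (Real.exp (metricConst noiseVar P κ -
      symbolPenalty noiseVar P κ hL y k x' x))) (fun k => ?_) (fun k x' => ?_) 1)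
  · rw [← ENNReal.ofReal_prod_of_nonneg fun _ _ => (Real.exp_pos _).le, ← Real.exp_sum,
      Finset.sum_sub_distrib]
    simp [previousSymbol]
  · have := measurable_symbolPenalty noiseVar P κ hL k
      (measurable_const (a := y) (β := ℂ × ℂ)) measurable_fst measurable_snd
    fun_prop
  · exact lintegral_metric_le_one hN hP hκ L _ _ _ x'

/-- The mean of the total penalty consists of a multiple of `n` and a boundary term from the first
symbol. -/
theorem lintegral_jointLaw_symbolPenalty_le {β noiseVar P κ : ℝ} (hβ : 0 < β) (hN : 0 < noiseVar)
    (hP : 0 < P) (hκ : 0 < κ) (hL : 0 < L) :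
    ∫⁻ p, ENNReal.ofReal (∑ k, symbolPenalty noiseVar P κ hL p.2 k (previousSymbol p.1 k) (p.1 k))
        ∂(jointLaw β noiseVar n L (Measure.pi fun _ : Fin n => symbolLaw P)) ≤
      ENNReal.ofReal (n * (4 + L * gaussianFourthMoment * noiseVar / P +
        κ * (6 * Real.pi * β / L + 30 * L * noiseVar / P)) + κ * 8) := by
  have := isProbabilityMeasure_symbolLaw hP
  have hL' : (0 : ℝ) < L := by exact_mod_cast hL
  have hpi := Real.pi_pos
  have hM := gaussianFourthMoment_nonneg
  have hmeas : ∀ k : Fin n, Measurable fun p : (Fin n → ℂ) × (Fin (n * L) → ℂ) =>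
      symbolPenalty noiseVar P κ hL p.2 k (previousSymbol p.1 k) (p.1 k) := fun k =>
    measurable_symbolPenalty noiseVar P κ hL k measurable_snd (by fun_prop) (by fun_prop)
  set A := 4 + L * gaussianFourthMoment * noiseVar / P with hA
  set B := κ * (6 * Real.pi * β / L + 30 * L * noiseVar / P) with hB
  have hA0 : 0 ≤ A := by positivity
  have hB0 : 0 ≤ B := by positivity
  have hI : ∀ k : Fin n, (0 : ℝ) ≤ κ * (if k.val = 0 then 8 else 0) := fun k => by
    split_ifs <;> positivity
  have hx : ∀ᵐ x ∂(Measure.pi fun _ : Fin n => symbolLaw P),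
      ∀ m, ‖x m‖ ^ 2 ∈ Set.Icc (P / 2) P :=
    ae_all_iff.2 fun m =>
      (measurePreserving_eval (fun _ : Fin n => symbolLaw P) m).quasiMeasurePreserving.ae
        (ae_symbolLaw hP)
  rw [lintegral_jointLaw _ _ (by fun_prop)]
  have hsum : ∑ k : Fin n, (κ * (if k.val = 0 then (8 : ℝ) else 0)) ≤ κ * 8 := by
    rw [← Finset.mul_sum]
    refine mul_le_mul_of_nonneg_left ?_ hκ.le
    rcases n with _ | m
    · simp
    · rw [Fin.sum_univ_succ]; simp
  calc _ ≤ ∫⁻ _, ENNReal.ofReal (n * (A + B) + κ * 8)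
        ∂(Measure.pi fun _ : Fin n => symbolLaw P) := by
        refine lintegral_mono_ae ?_
        filter_upwards [hx] with x hx
        have hm : ∀ k : Fin n, Measurable fun ω : Noise n L => ENNReal.ofReal
            (symbolPenalty noiseVar P κ hL (output x ω) k (previousSymbol x k) (x k)) := fun k =>
          (measurable_symbolPenalty noiseVar P κ hL k (measurable_output_left x) measurable_const
            measurable_const).ennreal_ofReal
        simp_rw [ENNReal.ofReal_sum_of_nonneg
          fun k _ => symbolPenalty_nonneg hN hP hκ hL _ k _ _]
        rw [lintegral_finsetSum _ fun k _ => hm k]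
        calc _ ≤ ∑ k : Fin n, ENNReal.ofReal (A + (κ * (if k.val = 0 then 8 else 0) + B)) := by
              refine Finset.sum_le_sum fun k _ => ?_
              have hmp := measurable_phasePenalty κ L
                ((measurable_pi_apply (previousSample hL k)).comp (measurable_output_left x))
                ((measurable_pi_apply (firstSample hL k)).comp (measurable_output_left x))
                (measurable_const (a := previousSymbol x k)) (measurable_const (a := x k))
              simp only [Function.comp_def] at hmp
              simp_rw [symbolPenalty, ENNReal.ofReal_add (powerPenalty_nonneg hN hP _ _)
                (phasePenalty_nonneg hκ _ _ _ _ _)]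
              rw [lintegral_add_right _ hmp.ennreal_ofReal,
                ENNReal.ofReal_add hA0 (add_nonneg (hI k) hB0)]
              exact add_le_add (lintegral_powerPenalty_le β hN hP hL k (hx k).2)
                (lintegral_phasePenalty_le hβ hN hP hκ hL (fun m => (hx m).1) k)
          _ = ENNReal.ofReal (∑ k : Fin n, (A + (κ * (if k.val = 0 then 8 else 0) + B))) :=
              (ENNReal.ofReal_sum_of_nonneg fun k _ =>
                add_nonneg hA0 (add_nonneg (hI k) hB0)).symm
          _ ≤ _ := by
              clear_value A B
              refine ENNReal.ofReal_le_ofReal ?_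
              rw [Finset.sum_add_distrib, Finset.sum_add_distrib]
              simp only [Finset.sum_const, Finset.card_univ, Fintype.card_fin, nsmul_eq_mul]
              linarith
    _ = _ := by simp

theorem le_blockRate {β noiseVar P κ : ℝ} (hβ : 0 < β) (hN : 0 < noiseVar) (hP : 0 < P)
    (hκ : 0 < κ) (hL : 0 < L) (hn : 0 < n) :
    ENNReal.ofReal (metricConst noiseVar P κ - (4 + L * gaussianFourthMoment * noiseVar / P +
        κ * (6 * Real.pi * β / L + 30 * L * noiseVar / P)) - κ * 8 / n) ≤
      blockRate β noiseVar L P n := by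
  have := isProbabilityMeasure_symbolLaw hP
  have hL' : (0 : ℝ) < L := by exact_mod_cast hL
  have hn' : (0 : ℝ) < n := by exact_mod_cast hn
  have hpi := Real.pi_pos
  have hM := gaussianFourthMoment_nonneg
  set μ := Measure.pi fun _ : Fin n => symbolLaw P with hμ
  set A := 4 + L * gaussianFourthMoment * noiseVar / P +
    κ * (6 * Real.pi * β / L + 30 * L * noiseVar / P) with hA
  have hA0 : 0 ≤ A := by positivity
  set h : (Fin n → ℂ) × (Fin (n * L) → ℂ) → ℝ := fun p =>
    ∑ k, symbolPenalty noiseVar P κ hL p.2 k (previousSymbol p.1 k) (p.1 k) with hh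
  have hmeas : Measurable h := Finset.measurable_fun_sum _ fun k _ =>
    measurable_symbolPenalty noiseVar P κ hL k measurable_snd (by fun_prop) (by fun_prop)
  have hkey : ENNReal.ofReal (n * metricConst noiseVar P κ - (n * A + κ * 8)) ≤
      mutualInfo (jointLaw β noiseVar n L μ) := by
    refine ofReal_sub_le_klDiv hmeas
      (fun p => Finset.sum_nonneg fun k _ => symbolPenalty_nonneg hN hP hκ hL _ k _ _)
      (by positivity) (lintegral_jointLaw_symbolPenalty_le hβ hN hP hκ hL) ?_
    rw [fst_jointLaw, lintegral_prod_symm _ (by fun_prop)]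
    calc _ ≤ ∫⁻ _, 1 ∂(jointLaw β noiseVar n L μ).snd :=
          lintegral_mono fun y => lintegral_exp_symbolPenalty_le_one hN hP hκ hL y
      _ = 1 := by simp
  calc _ = (n : ℝ≥0∞)⁻¹ *
        ENNReal.ofReal (n * metricConst noiseVar P κ - (n * A + κ * 8)) := by
        rw [← ENNReal.ofReal_natCast, ← ENNReal.ofReal_inv_of_pos hn',
          ← ENNReal.ofReal_mul (by positivity)]
        congr 1
        field_simp
        ring
    _ ≤ _ := by
        unfold blockRate
        gcongr
        exact hkey.trans (le_iSup₂ (f := fun μ _ => mutualInfo (jointLaw β noiseVar n L μ)) μ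
          (pi_symbolLaw_mem_admissibleInputs hP n))

/-- The achievable rate for a free phase precision `κ`. The boundary term of the first symbol disappears
in the limit `n → ∞`. -/
theorem le_capacity {β noiseVar snr κ : ℝ} (hβ : 0 < β) (hN : 0 < noiseVar) (hsnr : 0 < snr)
    (hκ : 0 < κ) (hL : 0 < L) :
    ENNReal.ofReal (metricConst noiseVar (snr * noiseVar) κ - (4 + L * gaussianFourthMoment / snr +
        κ * (6 * Real.pi * β / L + 30 * L / snr))) ≤ capacity β noiseVar L snr := by
  have hP : 0 < snr * noiseVar := by positivity
  have hlim : Tendsto (fun n : ℕ => ENNReal.ofReal (metricConst noiseVar (snr * noiseVar) κ -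
      (4 + L * gaussianFourthMoment / snr + κ * (6 * Real.pi * β / L + 30 * L / snr)) -
        κ * 8 / n)) atTop (𝓝 (ENNReal.ofReal (metricConst noiseVar (snr * noiseVar) κ -
      (4 + L * gaussianFourthMoment / snr + κ * (6 * Real.pi * β / L + 30 * L / snr)) - 0))) :=
    ENNReal.tendsto_ofReal (tendsto_const_nhds.sub
      (tendsto_const_nhds.div_atTop tendsto_natCast_atTop_atTop))
  rw [sub_zero] at hlim
  refine le_of_tendsto_of_tendsto hlim (tendsto_capacity hN hL snr).1 ?_
  filter_upwards [eventually_gt_atTop 0] with n hn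
  have h := le_blockRate (n := n) hβ hN hP hκ hL hn
  rwa [mul_div_mul_right _ _ hN.ne', mul_div_mul_right _ _ hN.ne'] at h

end LowerBound

/-! ### The capacity pre-logs -/

section PreLog

/-- A capacity lower bound `a log SNR - C` gives the lower bound `a` on the pre-log. -/
theorem le_liminf_div_log {f : ℝ → ℝ≥0∞} {a C : ℝ}
    (h : ∀ᶠ t in atTop, ENNReal.ofReal (a * Real.log t - C) ≤ f t) :
    (a : EReal) ≤ liminf (fun t => (f t : EReal) / (Real.log t : EReal)) atTop := by
  have hlim : Tendsto (fun t => ((a - C / Real.log t : ℝ) : EReal)) atTop (𝓝 (a : EReal)) := by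
    have : Tendsto (fun t => a - C / Real.log t) atTop (𝓝 (a - 0)) :=
      tendsto_const_nhds.sub (tendsto_const_nhds.div_atTop Real.tendsto_log_atTop)
    rw [sub_zero] at this
    exact (continuous_coe_real_ereal.tendsto a).comp this
  rw [← hlim.liminf_eq]
  refine liminf_le_liminf ?_
  filter_upwards [h, eventually_gt_atTop 1] with t ht ht1
  have hlog : 0 < Real.log t := Real.log_pos ht1
  rw [EReal.le_div_iff_mul_le (by exact_mod_cast hlog) (EReal.coe_ne_top _), ← EReal.coe_mul]
  have h1 : (a - C / Real.log t) * Real.log t = a * Real.log t - C := by field_simp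
  rw [h1]
  calc ((a * Real.log t - C : ℝ) : EReal) ≤ ((ENNReal.ofReal (a * Real.log t - C) : ℝ≥0∞) : EReal) := by
        rw [EReal.coe_ennreal_ofReal]
        exact_mod_cast le_max_left _ _
    _ ≤ _ := by exact_mod_cast ht

/-- A capacity upper bound `a log SNR + C` gives the upper bound `a` on the pre-log. -/
theorem limsup_div_log_le {f : ℝ → ℝ≥0∞} {a C : ℝ} (ha : 0 < a)
    (h : ∀ᶠ t in atTop, f t ≤ ENNReal.ofReal (a * Real.log t + C)) :
    limsup (fun t => (f t : EReal) / (Real.log t : EReal)) atTop ≤ (a : EReal) := by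
  have hlim : Tendsto (fun t => ((a + C / Real.log t : ℝ) : EReal)) atTop (𝓝 (a : EReal)) := by
    have : Tendsto (fun t => a + C / Real.log t) atTop (𝓝 (a + 0)) :=
      tendsto_const_nhds.add (tendsto_const_nhds.div_atTop Real.tendsto_log_atTop)
    rw [add_zero] at this
    exact (continuous_coe_real_ereal.tendsto a).comp this
  rw [← hlim.limsup_eq]
  refine limsup_le_limsup ?_
  filter_upwards [h, eventually_gt_atTop 1,
    Real.tendsto_log_atTop.eventually_ge_atTop (-C / a)] with t ht ht1 ht2
  have hlog : 0 < Real.log t := Real.log_pos ht1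
  have hnn : 0 ≤ a * Real.log t + C := by
    rw [div_le_iff₀ ha] at ht2; linarith
  rw [EReal.div_le_iff_le_mul (by exact_mod_cast hlog) (EReal.coe_ne_top _), ← EReal.coe_mul]
  have h1 : Real.log t * (a + C / Real.log t) = a * Real.log t + C := by field_simp
  rw [h1]
  calc (f t : EReal) ≤ ((ENNReal.ofReal (a * Real.log t + C) : ℝ≥0∞) : EReal) := by
        exact_mod_cast ht
    _ = _ := by rw [EReal.coe_ennreal_ofReal, max_eq_left hnn]

/-- With one sample per symbol, the choice `κ = 1` in the metric keeps only the information of the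
modulus. -/
theorem exists_le_capacity_one {β noiseVar : ℝ} (hβ : 0 < β) (hN : 0 < noiseVar) :
    ∃ C : ℝ, ∀ᶠ snr in atTop,
      ENNReal.ofReal (1 / 2 * Real.log snr - C) ≤ capacity β noiseVar 1 snr := by
  have hM := gaussianFourthMoment_nonneg
  refine ⟨Real.log (4 * √(2 * Real.pi * noiseVar)) - 1 / 2 * Real.log noiseVar +
    (4 + gaussianFourthMoment + (6 * Real.pi * β + 30)), ?_⟩
  filter_upwards [eventually_ge_atTop 1] with snr hsnr
  have h0 : 0 < snr := by linarith
  refine le_trans (ENNReal.ofReal_le_ofReal ?_) (le_capacity hβ hN h0 one_pos one_pos)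
  rw [metricConst, Real.log_mul h0.ne' hN.ne', Real.log_one]
  have h1 : gaussianFourthMoment / snr ≤ gaussianFourthMoment := div_le_self hM hsnr
  have h2 : 30 / snr ≤ 30 := div_le_self (by norm_num) hsnr
  simp only [Nat.cast_one, one_mul, div_one, mul_one, mul_zero]
  linarith

/-- With `⌈β √SNR⌉` samples per symbol the phase is tracked to a precision of order `SNR^(-1/2)`, and
the choice `κ = √SNR` adds its information to that of the modulus. -/
theorem exists_le_capacity_ceil {β noiseVar : ℝ} (hβ : 0 < β) (hN : 0 < noiseVar) :
    ∃ C : ℝ, ∀ᶠ snr in atTop,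
      ENNReal.ofReal (3 / 4 * Real.log snr - C) ≤ capacity β noiseVar ⌈β * √snr⌉₊ snr := by
  have hM := gaussianFourthMoment_nonneg
  have hpi := Real.pi_pos
  refine ⟨Real.log (4 * √(2 * Real.pi * noiseVar)) - 1 / 2 * Real.log noiseVar +
    (4 + (β + 1) * gaussianFourthMoment + (6 * Real.pi + 30 * (β + 1))), ?_⟩
  filter_upwards [eventually_ge_atTop 1] with snr hsnr
  have h0 : 0 < snr := by linarith
  set r := √snr with hr
  have hr1 : 1 ≤ r := Real.one_le_sqrt.2 hsnr
  have hr0 : 0 < r := by linarith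
  have hrr : snr = r * r := (Real.mul_self_sqrt h0.le).symm
  have hL : 0 < ⌈β * r⌉₊ := Nat.ceil_pos.2 (by positivity)
  refine le_trans (ENNReal.ofReal_le_ofReal ?_) (le_capacity hβ hN h0 hr0 hL)
  have hle : β * r ≤ (⌈β * r⌉₊ : ℝ) := Nat.le_ceil _
  have hge : (⌈β * r⌉₊ : ℝ) ≤ (β + 1) * r := by
    have := (Nat.ceil_lt_add_one (by positivity : 0 ≤ β * r)).le
    linarith
  set ℓ : ℝ := (⌈β * r⌉₊ : ℝ) with hℓ
  have hℓ0 : 0 < ℓ := lt_of_lt_of_le (by positivity) hle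
  have hlog : Real.log r = 1 / 2 * Real.log snr := by
    rw [hr, Real.log_sqrt h0.le]; ring
  rw [metricConst, Real.log_mul h0.ne' hN.ne', hlog]
  have h1 : ℓ * gaussianFourthMoment / snr ≤ (β + 1) * gaussianFourthMoment := by
    rw [div_le_iff₀ h0]
    have : ℓ ≤ (β + 1) * snr := hge.trans (by rw [hrr]; nlinarith)
    nlinarith
  have h2 : r * (6 * Real.pi * β / ℓ + 30 * ℓ / snr) ≤ 6 * Real.pi + 30 * (β + 1) := by
    rw [mul_add]
    refine add_le_add ?_ ?_
    · rw [mul_div_assoc', div_le_iff₀ hℓ0]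
      nlinarith
    · rw [mul_div_assoc', div_le_iff₀ h0, hrr]
      nlinarith
  linarith

end PreLog

end PhaseNoise

theorem mainTheorem2 (β noiseVar : ℝ) (hβ : 0 < β) (hN : 0 < noiseVar) :
    -- the limit that defines the capacity exists and is finite
    (∀ (L : ℕ) (snr : ℝ), 1 ≤ L → 0 < snr →
      Tendsto (PhaseNoise.blockRate β noiseVar L (snr * noiseVar)) atTop
          (𝓝 (PhaseNoise.capacity β noiseVar L snr)) ∧
        PhaseNoise.capacity β noiseVar L snr ≠ ∞) ∧
    -- with `L = ⌈β √SNR⌉` samples per symbol the pre-log is at least `3/4`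
    ((3 / 4 : ℝ) : EReal) ≤
      liminf (fun snr : ℝ =>
        (PhaseNoise.capacity β noiseVar ⌈β * √snr⌉₊ snr : EReal) / (Real.log snr : EReal)) atTop ∧
    -- with one sample per symbol the pre-log is `1/2`
    Tendsto (fun snr : ℝ =>
        (PhaseNoise.capacity β noiseVar 1 snr : EReal) / (Real.log snr : EReal)) atTop
      (𝓝 ((1 / 2 : ℝ) : EReal)) := by
  refine ⟨fun L snr hL _ => PhaseNoise.tendsto_capacity hN hL snr, ?_, ?_⟩
  · obtain ⟨C, hC⟩ := PhaseNoise.exists_le_capacity_ceil hβ hN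
    exact PhaseNoise.le_liminf_div_log hC
  · obtain ⟨C, hC⟩ := PhaseNoise.exists_le_capacity_one hβ hN
    obtain ⟨C', hC'⟩ := PhaseNoise.exists_capacity_one_le hβ hN
    refine tendsto_of_le_liminf_of_limsup_le (PhaseNoise.le_liminf_div_log hC)
      (PhaseNoise.limsup_div_log_le (C := 1 / 2 * Real.log noiseVar + C') (by norm_num) ?_)
    filter_upwards [eventually_ge_atTop noiseVar⁻¹] with snr hsnr
    have h1 : 1 ≤ snr * noiseVar := by
      have := mul_le_mul_of_nonneg_right hsnr hN.le
      rwa [inv_mul_cancel₀ hN.ne'] at this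
    have h0 : 0 < snr := (inv_pos.2 hN).trans_le hsnr
    refine (hC' snr h1).trans (le_of_eq ?_)
    rw [Real.log_mul h0.ne' hN.ne']
    congr 1
    ring
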